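/- A \emph{Grassmannian forest} with $n\ge 0$ boundary vertices is a finite forest $F$ properly embedded in a disk, with $n$ boundary vertices $b_1,\dots,b_n$ of degree $1$ on the boundary circle, labelled in clockwise order, such that every internal (i.e. non-boundary) vertex is connected by a path to the boundary and no vertex has degree $2$, together with an integer \emph{helicity} $h(v)$ for every internal vertex $v$: $h(v)\in\{0,1\}$ if $v$ has degree $1$ and is joined to a boundary vertex, and $1\le h(v)\le \deg(v)-1$ otherwise. Forests are considered up to isotopy of the disk fixing the boundary labels. It is a \emph{Grassmannian tree} if it is connected (and nonempty). An internal vertex $v$ is \emph{white} if $h(v)=1$, \emph{black} if $h(v)=\deg(v)-1$, and \emph{generic} otherwise; $F$ is \emph{plabic} if it has no generic vertex. $F$ is \emph{contracted} if no two adjacent internal vertices are both white or both black, i.e. no two adjacent internal vertices can be contracted to a single vertex of the same colour; thus contracted plabic forests are the bipartite planar forests. The \emph{type} of $F$ is $(k,n)$ with $$k=\sum_{v}\Bigl(h(v)-\frac{\deg(v)}2\Bigr)+\frac n2,$$ the sum being over the internal vertices. Put $m(v)=2\deg(v)-4$ if $v$ is generic and $m(v)=\deg(v)-1$ otherwise.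 The \emph{mom-dimension} of a tree with $n$ boundary vertices is $n-1$ if $n\le 2$ and $1+\sum_v (m(v)-1)$ if $n\ge 3$; the mom-dimension of a forest is the sum of the mom-dimensions of its trees. \textbf{Theorem.} Below, compositional inverses $\langle -1\rangle$ are taken with respect to the variable $x$, for formal power series in $x$ over $\mathbb{Q}[y,q]$. (1) For all $n,k,r\ge 0$, the number of contracted plabic trees (equivalently, bipartite planar trees) of type $(k,n)$ with mom-dimension $r$ is finite and equals the coefficient $[x^ny^kq^r]P_{\mathrm{tree}}(x,y,q)$, where $$P_{\mathrm{tree}}(x,y,q)=x\bigl(1+y+yq\,C^{\langle -1\rangle}(x,y,q)\bigr),\qquad C(x,y,q)=\frac{x(1-q^2x^2y)}{(1+xq)(1+xyq)}.$$ (2) For all $n,k,r\ge 0$, the number of contracted plabic forests of type $(k,n)$ with mom-dimension $r$ is finite and equals $[x^ny^kq^r]P_{\mathrm{forest}}(x,y,q)$, where $P_{\mathrm{forest}}$ is given by $$x\,P_{\mathrm{forest}}(x,y,q)=\left(\frac{x}{1+P_{\mathrm{tree}}(x,y,q)}\right)^{\langle -1\rangle}.$$ (3) Equivalently, $P_{\mathrm{forest}}$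 is given by $$[x^n]P_{\mathrm{forest}}(x,y,q)=\frac1{n+1}[x^n]\bigl(1+P_{\mathrm{tree}}(x,y,q)\bigr)^{n+1}\qquad (n\ge 0);$$ that is, a power series $P$ satisfies the equation for $P_{\mathrm{forest}}$ in (2) if and only if it satisfies this formula for every $n\ge 0$. -/

import Mathlib

open PowerSeries

/-! ### Grassmannian forests embedded in a disk

A forest properly embedded in a disk is recorded, up to isotopy, by its underlying graph together
with the clockwise cyclic order of the edges around every vertex. -/

/-- `Clockwise i j k`: the points `i`, `j`, `k` are distinct and occur in this cyclic order among
the points `0, 1, …, n - 1` placed clockwise on a circle. -/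
def Clockwise {n : ℕ} (i j k : Fin n) : Prop :=
  (i < j ∧ j < k) ∨ (j < k ∧ k < i) ∨ (k < i ∧ i < j)

/-- `Beyond G v x w`: the vertex `w` is reached from `v` by a path of `G` whose first step goes
from `v` to `x`. -/
def Beyond {V : Type*} (G : SimpleGraph V) (v x w : V) : Prop :=
  ∃ p : G.Walk v w, p.IsPath ∧ ¬ p.Nil ∧ p.snd = x

/-- For a cyclic ordering `ρ` of the finite set `α` (`ρ` sends an element to the next one
clockwise), `ClockwiseFor ρ x y z` says that `x`, `y`, `z` are distinct and that turning clockwise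
from `x` one meets `y` strictly before `z`, and `z` strictly before coming back to `x`. -/
def ClockwiseFor {α : Type*} (ρ : Equiv.Perm α) (x y z : α) : Prop :=
  ∃ a b : ℕ, 0 < a ∧ a < b ∧ b < Nat.card α ∧ (ρ ^ a) x = y ∧ (ρ ^ b) x = z

/-- A Grassmannian forest with `n` boundary vertices. The boundary vertex `b_{i+1}` is
`Sum.inl i`, and the internal vertices are the `Sum.inr v`. -/
structure GrassmannianForest (n : ℕ) : Type 1 where
  /-- the internal vertices -/
  Internal : Type
  [fintypeInternal : Fintype Internal]
  /-- the underlying graph -/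
  graph : SimpleGraph (Fin n ⊕ Internal)
  acyclic : graph.IsAcyclic
  /-- boundary vertices have degree `1` -/
  degree_boundary : ∀ i : Fin n, (graph.neighborSet (Sum.inl i)).ncard = 1
  /-- there are no vertices of degree `2` -/
  degree_ne_two : ∀ v : Internal, (graph.neighborSet (Sum.inr v)).ncard ≠ 2
  /-- every internal vertex is connected by a path to the boundary of the disk -/
  reaches_boundary : ∀ v : Internal, ∃ i : Fin n, graph.Reachable (Sum.inr v) (Sum.inl i)
  /-- the embedding: `rot v` sends an edge at `v` to the next edge at `v` in clockwise order
  (an edge at `v` is given by its other end) -/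
  rot : ∀ v : Fin n ⊕ Internal, Equiv.Perm (graph.neighborSet v)
  /-- `rot v` is a single cycle through all the edges at `v` -/
  rot_cyclic : ∀ (v : Fin n ⊕ Internal) (x y : graph.neighborSet v), (rot v).SameCycle x y
  /-- each tree is drawn in the disk without crossings and with the given clockwise orders at its
  vertices: three branches leaving a vertex in clockwise order end in boundary vertices in
  clockwise order -/
  branches_clockwise : ∀ (v : Fin n ⊕ Internal) (x y z : graph.neighborSet v) (i j k : Fin n),
    ClockwiseFor (rot v) x y z →
    Beyond graph v x (Sum.inl i) → Beyond graph v y (Sum.inl j) → Beyond graph v z (Sum.inl k) →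
    Clockwise i j k
  /-- distinct trees do not cross in the disk -/
  trees_noncrossing : ∀ a b c d : Fin n, a < b → b < c → c < d →
    graph.Reachable (Sum.inl a) (Sum.inl c) → graph.Reachable (Sum.inl b) (Sum.inl d) →
    graph.Reachable (Sum.inl a) (Sum.inl b)
  /-- the helicity of the internal vertices -/
  hel : Internal → ℕ
  /-- an internal vertex of degree `1` joined to a boundary vertex (a boundary leaf) has helicity
  `0` or `1` -/
  hel_boundaryLeaf : ∀ v : Internal, (graph.neighborSet (Sum.inr v)).ncard = 1 →
    (∃ i : Fin n, graph.Adj (Sum.inr v) (Sum.inl i)) → hel v = 0 ∨ hel v = 1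
  /-- every other internal vertex has helicity between `1` and its degree minus `1` -/
  hel_internal : ∀ v : Internal, ¬ ((graph.neighborSet (Sum.inr v)).ncard = 1 ∧
    ∃ i : Fin n, graph.Adj (Sum.inr v) (Sum.inl i)) →
    1 ≤ hel v ∧ hel v + 1 ≤ (graph.neighborSet (Sum.inr v)).ncard

namespace GrassmannianForest

attribute [instance] GrassmannianForest.fintypeInternal

variable {n : ℕ}

/-- The degree of an internal vertex. -/
noncomputable def deg (F : GrassmannianForest n) (v : F.Internal) : ℕ :=
  (F.graph.neighborSet (Sum.inr v)).ncard

/-- White vertices are those of helicity `1`. -/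
def White (F : GrassmannianForest n) (v : F.Internal) : Prop := F.hel v = 1

/-- Black vertices are those of helicity `deg v - 1`. -/
def Black (F : GrassmannianForest n) (v : F.Internal) : Prop := F.hel v + 1 = F.deg v

/-- Generic vertices are neither white nor black. -/
def Generic (F : GrassmannianForest n) (v : F.Internal) : Prop := ¬ F.White v ∧ ¬ F.Black v

/-- A plabic forest has no generic vertices. -/
def IsPlabic (F : GrassmannianForest n) : Prop := ∀ v : F.Internal, F.White v ∨ F.Black v

/-- A Grassmannian forest is a tree if it is connected (in particular, not empty). -/
def IsTree (F : GrassmannianForest n) : Prop := F.graph.Connected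

/-- A vertex contraction move can be applied to two adjacent internal vertices of the same colour
(both white or both black), merging them into one vertex of that colour. -/
def CanContract (F : GrassmannianForest n) (u v : F.Internal) : Prop :=
  F.graph.Adj (Sum.inr u) (Sum.inr v) ∧ ((F.White u ∧ F.White v) ∨ (F.Black u ∧ F.Black v))

/-- A forest is contracted (maximal in the refinement order) if no vertex contraction move can be
applied to it. For a plabic forest this says that the colouring of the internal vertices is a
bipartite one. -/
def IsContracted (F : GrassmannianForest n) : Prop := ∀ u v : F.Internal, ¬ F.CanContract u v

/-- The helicity of a Grassmannian forest. -/
noncomputable def helicity (F : GrassmannianForest n) : ℚ :=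
  ∑ v : F.Internal, ((F.hel v : ℚ) - (F.deg v : ℚ) / 2) + (n : ℚ) / 2

open scoped Classical in
/-- The number `m(v)`. -/
noncomputable def m (F : GrassmannianForest n) (v : F.Internal) : ℤ :=
  if F.Generic v then 2 * (F.deg v : ℤ) - 4 else (F.deg v : ℤ) - 1

/-- The number of boundary vertices of a tree (connected component) of `F`. -/
noncomputable def numBoundary (F : GrassmannianForest n) (T : F.graph.ConnectedComponent) : ℕ :=
  {i : Fin n | F.graph.connectedComponentMk (Sum.inl i) = T}.ncard

open scoped Classical in
/-- The mom-dimension of a tree (connected component) of `F`. -/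
noncomputable def treeMomDim (F : GrassmannianForest n) (T : F.graph.ConnectedComponent) : ℤ :=
  if F.numBoundary T ≤ 2 then (F.numBoundary T : ℤ) - 1
  else 1 + ∑ v : F.Internal with F.graph.connectedComponentMk (Sum.inr v) = T, (F.m v - 1)

/-- The mom-dimension of a forest is the sum of the mom-dimensions of its trees. -/
noncomputable def momDim (F : GrassmannianForest n) : ℤ :=
  ∑ᶠ T : F.graph.ConnectedComponent, F.treeMomDim T

/-- Two Grassmannian forests are identified if there is an isomorphism of graphs between them that
fixes each boundary vertex and preserves the helicities and the clockwise orders. -/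
def Equivalent (F F' : GrassmannianForest n) : Prop :=
  ∃ φ : F.graph ≃g F'.graph,
    (∀ i : Fin n, φ (Sum.inl i) = Sum.inl i) ∧
    (∀ (v : F.Internal) (w : F'.Internal), φ (Sum.inr v) = Sum.inr w → F'.hel w = F.hel v) ∧
    (∀ (v : Fin n ⊕ F.Internal) (x : F.graph.neighborSet v),
      φ.mapNeighborSet v (F.rot v x) = F'.rot (φ v) (φ.mapNeighborSet v x))

theorem Equivalent.refl (F : GrassmannianForest n) : F.Equivalent F := by
  refine ⟨SimpleGraph.Iso.refl, fun _ => rfl, ?_, fun _ _ => rfl⟩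
  rintro v w h
  have : v = w := by simpa using h
  rw [this]

theorem Equivalent.symm {F F' : GrassmannianForest n} (h : F.Equivalent F') :
    F'.Equivalent F := by
  obtain ⟨φ, hb, hh, hr⟩ := h
  refine ⟨φ.symm, fun i => ?_, fun v w hvw => ?_, fun v x => ?_⟩
  · rw [← hb i, RelIso.symm_apply_apply]
  · refine (hh w v ?_).symm
    rw [← hvw, RelIso.apply_symm_apply]
  · obtain ⟨u, rfl⟩ := φ.surjective v
    obtain ⟨y, rfl⟩ := (φ.mapNeighborSet u).surjective x
    rw [← hr u y]
    have key : ∀ (a : Fin n ⊕ F.Internal) (_ : a = u) (z z' : F.graph.neighborSet a)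
        (t t' : F.graph.neighborSet u), (z : Fin n ⊕ F.Internal) = t →
        (z' : Fin n ⊕ F.Internal) = t' → t' = F.rot u t → z' = F.rot a z := by
      rintro a rfl z z' t t' h1 h2 h3
      rw [Subtype.ext h1, Subtype.ext h2, h3]
    refine key _ (φ.symm_apply_apply u) _ _ y (F.rot u y) ?_ ?_ rfl
    · exact φ.symm_apply_apply _
    · exact φ.symm_apply_apply _

theorem Equivalent.trans {F F' F'' : GrassmannianForest n} (h : F.Equivalent F')
    (h' : F'.Equivalent F'') : F.Equivalent F'' := by
  obtain ⟨φ, hb, hh, hr⟩ := h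
  obtain ⟨ψ, hb', hh', hr'⟩ := h'
  refine ⟨φ.trans ψ, fun i => ?_, fun v w hvw => ?_, fun v x => ?_⟩
  · rw [RelIso.trans_apply, hb, hb']
  · rw [RelIso.trans_apply] at hvw
    rcases hφ : φ (Sum.inr v) with i | u
    · rw [hφ, hb'] at hvw
      cases hvw
    · rw [hφ] at hvw
      rw [hh' u w hvw, hh v u hφ]
  · have := hr' (φ v) (φ.mapNeighborSet v x)
    rw [← hr v x] at this
    exact this

/-- Grassmannian forests up to equivalence (isotopy). -/
def setoid (n : ℕ) : Setoid (GrassmannianForest n) where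
  r := Equivalent
  iseqv := ⟨Equivalent.refl, Equivalent.symm, Equivalent.trans⟩

/-- The contracted plabic forests of type `(k, n)` with mom-dimension `r`, up to isotopy. -/
def contractedPlabicForests (n k r : ℕ) : Set (Quotient (setoid n)) :=
  {c | ∃ F : GrassmannianForest n, Quotient.mk (setoid n) F = c ∧
    F.IsPlabic ∧ F.IsContracted ∧ F.helicity = k ∧ F.momDim = r}

/-- The contracted plabic trees of type `(k, n)` with mom-dimension `r`, up to isotopy. -/
def contractedPlabicTrees (n k r : ℕ) : Set (Quotient (setoid n)) :=
  {c | ∃ F : GrassmannianForest n, Quotient.mk (setoid n) F = c ∧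
    F.IsTree ∧ F.IsPlabic ∧ F.IsContracted ∧ F.helicity = k ∧ F.momDim = r}

end GrassmannianForest

/-! ### Generating functions

Power series in `x` over the ring `ℚ[y][q]`. The variable `x` is `PowerSeries.X`, and `vy`, `vq`
are `y` and `q` as constant power series. -/

/-- The ring of power series in `x` whose coefficients are polynomials in `y` and `q`. -/
abbrev GF : Type := PowerSeries (Polynomial (Polynomial ℚ))

/-- The variable `y`. -/
noncomputable def vy : GF := PowerSeries.C (Polynomial.C Polynomial.X)

/-- The variable `q`. -/
noncomputable def vq : GF := PowerSeries.C Polynomial.X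

/-- The coefficient `[x^n y^k q^r] P`. -/
noncomputable def coeffXYQ (n k r : ℕ) (P : GF) : ℚ :=
  ((PowerSeries.coeff n P).coeff r).coeff k

/-- The reciprocal of a power series with constant term `1`. -/
noncomputable def recip (P : GF) : GF := PowerSeries.invOfUnit P 1

theorem mul_recip {P : GF} (h : PowerSeries.constantCoeff P = 1) : P * recip P = 1 :=
  PowerSeries.mul_invOfUnit P 1 h

/-- `C = x (1 - q² x² y) / ((1 + x q) (1 + x y q))`. -/
noncomputable def seriesC : GF :=
  X * (1 - vq ^ 2 * X ^ 2 * vy) * recip ((1 + X * vq) * (1 + X * vy * vq))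

theorem isUnit_coeff_one_seriesC : IsUnit (PowerSeries.coeff 1 seriesC) := by
  have : PowerSeries.coeff 1 seriesC = 1 := by
    rw [seriesC, mul_assoc, show (1 : ℕ) = 0 + 1 from rfl, PowerSeries.coeff_succ_X_mul,
      PowerSeries.coeff_zero_eq_constantCoeff_apply]
    simp [recip]
  rw [this]
  exact isUnit_one

/-- `P_tree = x (1 + y + y q C^{⟨-1⟩})`. -/
noncomputable def treeSeries : GF :=
  X * (1 + vy + vy * vq * seriesC.substInvOfIsUnit isUnit_coeff_one_seriesC)

/-- `x / (1 + P_tree)`. -/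
noncomputable def seriesR : GF := X * recip (1 + treeSeries)

theorem isUnit_coeff_one_seriesR : IsUnit (PowerSeries.coeff 1 seriesR) := by
  have : PowerSeries.coeff 1 seriesR = 1 := by
    rw [seriesR, show (1 : ℕ) = 0 + 1 from rfl, PowerSeries.coeff_succ_X_mul,
      PowerSeries.coeff_zero_eq_constantCoeff_apply]
    simp [recip]
  rw [this]
  exact isUnit_one

/-!
A contracted plabic forest is encoded by a word with one letter per boundary vertex. Root every tree
at its boundary leaf if it has one, and at its first boundary vertex otherwise. The first boundary
vertex below an internal vertex is said to open it; the vertices opened by `b` form a path that ends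
at `b`. The letter of `b` records either that `b` lies in the tree of a boundary leaf, or that `b` is
a root, or else the colours on this path, the vertex `p` to which the path is attached, and whether
this is the last child of `p`. The conditions on a word are collected in `IsCode`.

Words satisfying them are the same thing as isotopy classes of contracted plabic forests. The word is
recovered from the graph (`Represents.unique`), since the rooting and hence all labels are intrinsic.
The forest is recovered from the word (`Represents.equivalent`): the word determines the coloured
graph, and the clockwise order around a vertex is determined by the boundary vertices on its
branches. Each forest has a word (`isCode_word`), where planarity gives the noncrossing condition, and
each word comes from a forest (`wordForest`), whose edges can be drawn above a line without crossings.
By the handshake lemma in each tree, a plabic tree with `b` boundary vertices has mom-dimension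
`b - 1`, so that mom-dimension counts the letters `join` (`Represents.momDim_eq`), a forest is a tree
if exactly one letter is of another kind (`Represents.isTree_iff`), and helicity is a sum of
contributions of the letters as well (`Represents.helicity_eq`).

The words are the runs of a stack machine that keeps the opened vertices still awaiting children
(`isCode_iff_run`). Reading a run up to the moment when the top entry of the stack is removed shows
that the generating function of the runs from a given stack is a product `F * ∏ R κ` over its entries
(`RunSeries.sum_runWeight`); here a weight `u` marks the letters that start a tree. The factors are
`R = T` for boundary vertices and white vertices and `R = y T` for black vertices, where
`T (1 - y T ^ 2) = x q F (1 + T) (1 + y T)` and `F = 1 + u x (1 + y) F + u x y F T`.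

For `u = 0` one has `F = 1`, and `T` is `q C^{⟨-1⟩}`. A word of a tree is a letter starting it
followed by a run for `u = 0`, which gives `P_tree = x (1 + y + y T)`. For `u = 1` the equations are
solved by substituting `x F` for `x` in this `T`, where `F = 1 + P_tree(x F)`; that is, `x F` is the
compositional inverse of `x / (1 + P_tree)` (`exists_runSeries_forest`). The explicit formula for the
coefficients of `F` is Lagrange inversion (`coeff_substInvOfIsUnit`).
-/

/-! ### Rooted forests -/

/-- A way of rooting every connected component of `G`: every vertex has at most one parent, the
edges are exactly the pairs formed by a vertex and its parent, and some natural number increases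
from a parent to its children. -/
structure Rooting {V : Type*} (G : SimpleGraph V) where
  /-- the parent of a vertex, if the vertex is not a root -/
  par : V → Option V
  /-- a number that increases strictly from a parent to its children -/
  key : V → ℕ
  adj_iff : ∀ u v, G.Adj u v ↔ par u = some v ∨ par v = some u
  key_lt : ∀ {u v}, par v = some u → key u < key v

namespace Rooting

variable {V : Type*} {G : SimpleGraph V} (R : Rooting G)

/-- `R.Anc u v`: the vertex `u` is an ancestor of `v`, possibly `v` itself. -/
def Anc (u v : V) : Prop := Relation.ReflTransGen (fun a b => R.par b = some a) u v

variable {R}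

theorem Anc.refl (v : V) : R.Anc v v := Relation.ReflTransGen.refl

theorem Anc.trans {u v w : V} (h : R.Anc u v) (h' : R.Anc v w) : R.Anc u w :=
  Relation.ReflTransGen.trans h h'

theorem anc_of_par {u v : V} (h : R.par v = some u) : R.Anc u v :=
  Relation.ReflTransGen.single h

theorem anc_cases {u v : V} (h : R.Anc u v) : u = v ∨ ∃ w, R.par v = some w ∧ R.Anc u w := by
  rcases Relation.ReflTransGen.cases_tail h with h | ⟨w, h1, h2⟩
  · exact Or.inl h.symm
  · exact Or.inr ⟨w, h2, h1⟩

theorem anc_cases_head {u v : V} (h : R.Anc u v) :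
    u = v ∨ ∃ w, R.par w = some u ∧ R.Anc w v := by
  rcases Relation.ReflTransGen.cases_head h with h | ⟨w, h1, h2⟩
  · exact Or.inl h
  · exact Or.inr ⟨w, h1, h2⟩

theorem Anc.of_par {u v w : V} (h : R.Anc u v) (hne : u ≠ v) (hw : R.par v = some w) :
    R.Anc u w := by
  rcases anc_cases h with h | ⟨w', h1, h2⟩
  · exact absurd h hne
  · rw [hw] at h1
    cases h1
    exact h2

theorem Anc.key_le {u v : V} (h : R.Anc u v) : R.key u ≤ R.key v := by
  induction h with
  | refl => exact le_rfl
  | tail _ h ih => exact ih.trans (R.key_lt h).le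

theorem Anc.key_lt {u v : V} (h : R.Anc u v) (hne : u ≠ v) : R.key u < R.key v := by
  rcases anc_cases h with h | ⟨w, h1, h2⟩
  · exact absurd h hne
  · exact h2.key_le.trans_lt (R.key_lt h1)

theorem Anc.antisymm {u v : V} (h : R.Anc u v) (h' : R.Anc v u) : u = v := by
  by_contra hne
  exact absurd (h.key_lt hne) (not_lt.2 h'.key_le)

theorem not_anc_par {u v : V} (h : R.par v = some u) : ¬ R.Anc v u := fun h' =>
  absurd (R.key_lt h) (not_lt.2 h'.key_le)

theorem eq_of_anc_of_par_eq_none {u v : V} (h : R.Anc u v) (hv : R.par v = none) : u = v := by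
  rcases anc_cases h with h | ⟨w, h1, -⟩
  · exact h
  · rw [hv] at h1; cases h1

/-- The ancestors of a vertex form a chain. -/
theorem Anc.total {u v w : V} (h : R.Anc u w) (h' : R.Anc v w) : R.Anc u v ∨ R.Anc v u := by
  induction h with
  | refl => exact Or.inr h'
  | tail h1 h2 ih =>
    rename_i b c
    rcases anc_cases h' with rfl | ⟨d, hd, hd'⟩
    · exact Or.inl (h1.trans (anc_of_par h2))
    · rw [h2] at hd
      cases hd
      exact ih hd'

/-- Two children of the same vertex with a common descendant coincide. -/
theorem eq_of_anc_of_par_eq {u v w x : V} (hu : R.par u = some w) (hv : R.par v = some w)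
    (hux : R.Anc u x) (hvx : R.Anc v x) : u = v := by
  by_contra hne
  rcases hux.total hvx with h | h
  · exact not_anc_par hu (h.of_par hne hv)
  · exact not_anc_par hv (h.of_par (Ne.symm hne) hu)

theorem Anc.reachable {u v : V} (h : R.Anc u v) : G.Reachable u v := by
  induction h with
  | refl => exact SimpleGraph.Reachable.refl _
  | tail _ h ih => exact ih.trans ((R.adj_iff _ _).2 (Or.inr h)).reachable

theorem exists_root (v : V) : ∃ r, R.par r = none ∧ R.Anc r v := by
  induction hk : R.key v using Nat.strong_induction_on generalizing v with
  | _ k ih =>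
    rcases hp : R.par v with _ | u
    · exact ⟨v, hp, Anc.refl v⟩
    · obtain ⟨r, hr, hru⟩ := ih (R.key u) (hk ▸ R.key_lt hp) u rfl
      exact ⟨r, hr, hru.trans (anc_of_par hp)⟩

variable (R) in
/-- The root of the component of `v`. -/
noncomputable def root (v : V) : V := (R.exists_root v).choose

theorem par_root (v : V) : R.par (R.root v) = none := (R.exists_root v).choose_spec.1

theorem root_anc (v : V) : R.Anc (R.root v) v := (R.exists_root v).choose_spec.2

theorem eq_root {r v : V} (hr : R.par r = none) (h : R.Anc r v) : r = R.root v := by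
  rcases h.total (root_anc v) with h | h
  · exact eq_of_anc_of_par_eq_none h (par_root v)
  · exact (eq_of_anc_of_par_eq_none h hr).symm

theorem Anc.root_eq {u v : V} (h : R.Anc u v) : R.root u = R.root v :=
  eq_root (par_root u) ((root_anc u).trans h)

theorem reachable_iff_root {u v : V} : G.Reachable u v ↔ R.root u = R.root v := by
  constructor
  · rintro ⟨p⟩
    induction p with
    | nil => rfl
    | cons h _ ih =>
      rw [← ih]
      rcases (R.adj_iff _ _).1 h with h | h
      · exact (anc_of_par h).root_eq.symm
      · exact (anc_of_par h).root_eq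
  · intro h
    have h2 := (root_anc (R := R) v).reachable
    rw [← h] at h2
    exact (root_anc u).reachable.symm.trans h2

/-- A walk that starts at a child `x` of `v` and avoids `v` stays among the descendants of `x`. -/
theorem anc_of_walk_avoiding {v x y w : V} (hx : R.par x = some v) (p : G.Walk y w)
    (hy : R.Anc x y) (hp : v ∉ p.support) : R.Anc x w := by
  induction p with
  | nil => exact hy
  | cons h q ih =>
    rename_i a b c
    rw [SimpleGraph.Walk.support_cons, List.mem_cons, not_or] at hp
    refine ih ?_ hp.2
    rcases (R.adj_iff _ _).1 h with h | h
    · rcases eq_or_ne x a with rfl | hne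
      · rw [hx] at h
        cases h
        exact absurd q.start_mem_support hp.2
      · exact hy.of_par hne h
    · exact hy.trans (anc_of_par h)

/-- A walk that starts outside the descendants of `v` and avoids `v` stays outside. -/
theorem not_anc_of_walk_avoiding {v y w : V} (p : G.Walk y w)
    (hy : ¬ R.Anc v y) (hp : v ∉ p.support) : ¬ R.Anc v w := by
  induction p with
  | nil => exact hy
  | cons h q ih =>
    rename_i a b c
    rw [SimpleGraph.Walk.support_cons, List.mem_cons, not_or] at hp
    refine ih ?_ hp.2
    intro hb
    rcases (R.adj_iff _ _).1 h with h | h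
    · exact hy (hb.trans (anc_of_par h))
    · rcases eq_or_ne v b with rfl | hne
      · exact hp.2 q.start_mem_support
      · exact hy (hb.of_par hne h)

/-- The branches at `v` lead to a child `x` and its descendants, or to the parent `x` of `v` and the
vertices of the component that are not descendants of `v`. -/
theorem of_beyond {v x w : V} (h : Beyond G v x w) :
    (R.par x = some v ∧ R.Anc x w) ∨ (R.par v = some x ∧ ¬ R.Anc v w ∧ R.root v = R.root w) := by
  obtain ⟨p, hp, hnil, hx⟩ := h
  cases p with
  | nil => exact absurd SimpleGraph.Walk.Nil.nil hnil
  | cons h q =>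
    rename_i b
    have hxb : b = x := by simpa using hx
    subst hxb
    rw [SimpleGraph.Walk.cons_isPath_iff] at hp
    rcases (R.adj_iff _ _).1 h with h' | h'
    · exact Or.inr ⟨h', not_anc_of_walk_avoiding q (not_anc_par h') hp.2,
        (reachable_iff_root).1 (h.reachable.trans q.reachable)⟩
    · exact Or.inl ⟨h', anc_of_walk_avoiding h' q (Anc.refl _) hp.2⟩

theorem exists_beyond {v w : V} (h : G.Reachable v w) (hne : v ≠ w) : ∃ x, Beyond G v x w := by
  obtain ⟨p, hp⟩ := h.exists_isPath
  exact ⟨p.snd, p, hp, fun hn => hne hn.eq, rfl⟩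

/-- The branch at `v` through a child `x` of `v` consists of the descendants of `x`. -/
theorem beyond_child {v x w : V} (hx : R.par x = some v) (h : R.Anc x w) : Beyond G v x w := by
  have hvx := anc_of_par hx
  have hne : v ≠ w := by
    rintro rfl
    exact not_anc_par hx h
  obtain ⟨y, hy⟩ := exists_beyond (hvx.trans h).reachable hne
  rcases of_beyond (R := R) hy with ⟨h1, h2⟩ | ⟨-, h2, -⟩
  · rwa [eq_of_anc_of_par_eq hx h1 h h2]
  · exact absurd (hvx.trans h) h2

/-- The branch at `v` through the parent of `v` consists of the vertices of the component that are
not descendants of `v`. -/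
theorem beyond_par {v x w : V} (hx : R.par v = some x) (h : ¬ R.Anc v w)
    (hr : R.root v = R.root w) : Beyond G v x w := by
  have hne : v ≠ w := by
    rintro rfl
    exact h (Anc.refl _)
  obtain ⟨y, hy⟩ := exists_beyond (reachable_iff_root.2 hr) hne
  rcases of_beyond (R := R) hy with ⟨h1, h2⟩ | ⟨h1, -, -⟩
  · exact absurd ((anc_of_par h1).trans h2) h
  · rw [hx] at h1
    cases h1
    exact hy

theorem isAcyclic (R : Rooting G) : G.IsAcyclic := by
  have key : ∀ u v, R.par v = some u → G.IsBridge s(u, v) := by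
    intro u v h
    rw [SimpleGraph.isBridge_iff]
    suffices H : ∀ {a b : V} (p : (G.deleteEdges {s(u, v)}).Walk a b), R.Anc v a → R.Anc v b by
      rintro ⟨p⟩
      exact not_anc_par h (H p.reverse (Anc.refl v))
    intro a b p
    induction p with
    | nil => exact id
    | cons hadj _ ih =>
      rename_i a b c
      intro ha
      refine ih ?_
      rw [SimpleGraph.deleteEdges_adj] at hadj
      rcases (R.adj_iff _ _).1 hadj.1 with h' | h'
      · refine ha.of_par ?_ h'
        rintro rfl
        rw [h] at h'
        cases h'
        exact hadj.2 (by simp [Sym2.eq_swap])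
      · exact ha.trans (anc_of_par h')
  rw [SimpleGraph.isAcyclic_iff_forall_adj_isBridge]
  intro v w h
  rcases (R.adj_iff _ _).1 h with h | h
  · rw [Sym2.eq_swap]
    exact key _ _ h
  · exact key _ _ h

/-- A rooting is determined by the choice of the roots. -/
theorem par_eq_of_roots {R R' : Rooting G} (h : ∀ v, R.par v = none ↔ R'.par v = none) (v : V) :
    R.par v = R'.par v := by
  induction hk : R.key v using Nat.strong_induction_on generalizing v with
  | _ k ih =>
    rcases hp : R.par v with _ | u
    · exact ((h v).1 hp).symm
    · have hadj : G.Adj v u := (R.adj_iff _ _).2 (Or.inl hp)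
      rcases (R'.adj_iff _ _).1 hadj with h' | h'
      · exact h'.symm
      · have := ih (R.key u) (hk ▸ R.key_lt hp) u rfl
        rw [h'] at this
        exact absurd (R.key_lt this) (not_lt.2 (R.key_lt hp).le)

/-- Every choice of one root in each component of an acyclic graph gives a rooting. -/
theorem exists_rooting (hG : G.IsAcyclic) (rt : V → V) (hrt : ∀ v, G.Reachable (rt v) v)
    (hrt' : ∀ u v, G.Reachable u v → rt u = rt v) :
    ∃ R : Rooting G, ∀ v, R.par v = none ↔ rt v = v := by
  classical
  have hadjrt : ∀ u v, G.Adj u v → rt u = rt v := fun u v h => hrt' u v h.reachable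
  have hex : ∀ v, rt v ≠ v → ∃ u, G.Adj v u ∧ G.dist (rt v) v = G.dist (rt v) u + 1 := by
    intro v hv
    obtain ⟨p, hp, hl⟩ := (hrt v).exists_path_of_dist
    refine ⟨p.penultimate, ?_⟩
    have hnil : ¬ p.Nil := fun h => hv h.eq
    have hadj := p.adj_penultimate hnil
    refine ⟨hadj.symm, ?_⟩
    have h1 := SimpleGraph.dist_le p.dropLast
    have h2 : p.dropLast.length + 1 = p.length := SimpleGraph.Walk.length_dropLast_add_one hnil
    rcases hG.dist_eq_dist_add_one_of_adj_of_reachable (rt v) hadj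
      ((hrt v).trans hadj.symm.reachable) with h | h
    · omega
    · exact h
  have huniq : ∀ v u u', G.Adj v u → G.Adj v u' → G.dist (rt v) v = G.dist (rt v) u + 1 →
      G.dist (rt v) v = G.dist (rt v) u' + 1 → u = u' := by
    intro v u u' h h' hd hd'
    obtain ⟨p, hp, hl⟩ := ((hrt v).trans h.reachable).exists_path_of_dist
    obtain ⟨p', hp', hl'⟩ := ((hrt v).trans h'.reachable).exists_path_of_dist
    have hlen : ∀ {a b : V} (q : G.Walk a b), G.dist a v = G.dist a b + 1 →
        q.length = G.dist a b → v ∉ q.support := by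
      intro a b q h1 h2 h3
      have h4 := SimpleGraph.dist_le (q.takeUntil v h3)
      have h5 := q.length_takeUntil_le_length h3
      omega
    have hq := hp.concat (hlen p hd hl) h.symm
    have hq' := hp'.concat (hlen p' hd' hl') h'.symm
    have := (SimpleGraph.isAcyclic_iff_subsingleton_path.1 hG _ _).elim ⟨_, hq⟩ ⟨_, hq'⟩
    have h6 := congrArg (fun q : G.Path (rt v) v => q.1.penultimate) this
    simpa using h6
  refine ⟨⟨fun v => if h : rt v = v then none else some (hex v h).choose,
    fun v => G.dist (rt v) v, ?_, ?_⟩, ?_⟩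
  · have key : ∀ u v, G.Adj u v → G.dist (rt u) u = G.dist (rt u) v + 1 →
        (if h : rt u = u then none else some (hex u h).choose) = some v := by
      intro u v h hd
      have hne : rt u ≠ u := by
        intro h'
        rw [h'] at hd
        simp at hd
      rw [dif_neg hne]
      have := (hex u hne).choose_spec
      rw [huniq u _ _ this.1 h this.2 hd]
    have key' : ∀ u v, (if h : rt u = u then none else some (hex u h).choose) = some v →
        G.Adj u v := by
      intro u v h
      split_ifs at h with h'
      cases h
      exact (hex u h').choose_spec.1
    intro u v
    constructor
    · intro h
      rcases hG.dist_eq_dist_add_one_of_adj_of_reachable (rt u) h (hrt u) with h' | h'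
      · exact Or.inl (key u v h h')
      · refine Or.inr (key v u h.symm ?_)
        rw [← hadjrt u v h]
        exact h'
    · rintro (h | h)
      · exact key' _ _ h
      · exact (key' _ _ h).symm
  · intro u v h
    split_ifs at h with h'
    cases h
    have := (hex v h').choose_spec
    have h2 := hadjrt _ _ this.1
    rw [← h2]
    have := this.2
    omega
  · intro v
    by_cases h : rt v = v <;> simp [h]

end Rooting

/-! ### Words describing forests -/

/-- The information carried by one boundary vertex `b` of a contracted plabic forest. Each tree is
rooted at its boundary leaf if it has one, and at its first boundary vertex otherwise; the internal
vertices *opened* by `b` are those for which `b` is the first boundary vertex among their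
descendants. Together with `b` they form a path that ends at `b`. Colours are Booleans, `true` for
black.

The vertices opened by `b` and `b` itself are labelled `(b, 0)`, `(b, 1)`, …, from the top down, so
that the label of `b` comes last. -/
inductive Letter : Type
  /-- `b` is joined to a boundary leaf of the given colour, which is the root of its tree -/
  | single (black : Bool)
  /-- `b` is the root of its tree -/
  | start
  /-- the topmost vertex among `b` and the vertices opened by `b` is a child of the vertex with
  label `p`, the last one in clockwise order if `last` holds; the vertices opened by `b` have
  colours `cs`, from the top down -/
  | join (p : ℕ × ℕ) (last : Bool) (cs : List Bool)

namespace Letter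

/-- The number of internal vertices opened by a boundary vertex. -/
def size : Letter → ℕ
  | single _ => 1
  | start => 0
  | join _ _ cs => cs.length

/-- The label of the parent of the topmost vertex opened by a boundary vertex. -/
def parent : Letter → Option (ℕ × ℕ)
  | join p _ _ => some p
  | _ => none

/-- The colour of the `t`-th internal vertex opened by a boundary vertex. -/
def color : Letter → ℕ → Option Bool
  | single b, 0 => some b
  | join _ _ cs, t => cs[t]?
  | _, _ => none

/-- The `t`-th vertex opened by a boundary vertex may receive children from later boundary
vertices. Here `κ` is its colour, or `none` if it is the boundary vertex itself. -/
def Opens : Letter → ℕ → Option Bool → Prop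
  | single _, _, _ => False
  | start, t, κ => t = 0 ∧ κ = none
  | join _ _ cs, t, κ => ∃ b, cs[t]? = some b ∧ κ = some b

end Letter

section Codes

variable {n : ℕ}

/-- The parent of the vertex with label `(i, t)`, that is, of the `t`-th vertex opened by the
boundary vertex `i`. -/
def parId (c : Fin n → Letter) (x : ℕ × ℕ) : Option (ℕ × ℕ) :=
  match x.2 with
  | t + 1 => some (x.1, t)
  | 0 => if h : x.1 < n then (c ⟨x.1, h⟩).parent else none

/-- The colour of the internal vertex with label `x`. -/
def colorId (c : Fin n → Letter) (x : ℕ × ℕ) : Option Bool :=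
  if h : x.1 < n then (c ⟨x.1, h⟩).color x.2 else none

/-- The vertex with label `x` has colour `κ` and may receive children from boundary vertices that
come after the one opening it. -/
def Opened (c : Fin n → Letter) (x : ℕ × ℕ) (κ : Option Bool) : Prop :=
  ∃ i : Fin n, x.1 = i ∧ (c i).Opens x.2 κ

/-- The conditions on a word to describe a contracted plabic forest. -/
structure IsCode (c : Fin n → Letter) : Prop where
  /-- a vertex is opened before it receives further children -/
  lt : ∀ {j p e cs}, c j = .join p e cs → p.1 < j
  /-- only opened vertices that may receive children do so -/
  opened : ∀ {j p e cs}, c j = .join p e cs → ∃ κ, Opened c p κ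
  /-- an opened vertex does receive children: a boundary vertex at the root has a neighbour, and no
  internal vertex has degree `2` -/
  used : ∀ {x κ}, Opened c x κ → ∃ j e cs, c j = .join x e cs
  /-- the last child of a vertex is marked -/
  last : ∀ {j p e cs}, c j = .join p e cs →
    (e = true ↔ ∀ k e' cs', j < k → c k ≠ .join p e' cs')
  /-- a boundary vertex at the root has a single child -/
  once : ∀ {j p e cs}, c j = .join p e cs → Opened c p none → e = true
  /-- once a vertex has received a child, the vertices opened after it but before this child receive
  no further children -/
  noncrossing : ∀ {i j p q e e' cs cs'}, i < j → c i = .join p e cs → c j = .join q e' cs' →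
    q.1 < i → q.1 < p.1 ∨ q.1 = p.1 ∧ q.2 ≤ p.2
  /-- adjacent internal vertices have different colours -/
  alternating : ∀ {j p e cs κ}, c j = .join p e cs → Opened c p κ →
    (κ :: cs.map some).IsChain (· ≠ ·)

/-- `ℓ` identifies the vertices of `G` with the vertices described by the word `c`. -/
structure Labelling (c : Fin n → Letter) {I : Type*} (G : SimpleGraph (Fin n ⊕ I))
    (ℓ : Fin n ⊕ I → ℕ × ℕ) : Prop where
  inj : Function.Injective ℓ
  inl : ∀ i, ℓ (Sum.inl i) = (↑i, (c i).size)
  inr : ∀ v, ∃ i : Fin n, ∃ t < (c i).size, ℓ (Sum.inr v) = (↑i, t)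
  surj : ∀ i : Fin n, ∀ t < (c i).size, ∃ v, ℓ (Sum.inr v) = (↑i, t)
  adj : ∀ u v, G.Adj u v ↔ parId c (ℓ u) = some (ℓ v) ∨ parId c (ℓ v) = some (ℓ u)

variable {c : Fin n → Letter}

@[simp] theorem parId_succ (i t : ℕ) : parId c (i, t + 1) = some (i, t) := rfl

@[simp] theorem parId_zero (i : Fin n) : parId c (↑i, 0) = (c i).parent := by
  simp [parId]

@[simp] theorem colorId_mk (i : Fin n) (t : ℕ) : colorId c (↑i, t) = (c i).color t := by
  simp [colorId]

theorem Letter.parent_eq_some {l : Letter} {p : ℕ × ℕ} (h : l.parent = some p) :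
    ∃ e cs, l = .join p e cs := by
  cases l <;> simp [Letter.parent] at h
  subst h
  exact ⟨_, _, rfl⟩

theorem Letter.Opens.le_size {l : Letter} {t : ℕ} {κ : Option Bool} (h : l.Opens t κ) :
    t ≤ l.size := by
  cases l with
  | single => exact h.elim
  | start => exact h.1.le
  | join p e cs =>
    obtain ⟨b, hb, -⟩ := h
    exact (List.getElem?_eq_some_iff.1 hb).1.le

theorem IsCode.not_pred_opened_single (hc : IsCode c) {i : Fin n} {b : Bool}
    (h : c i = .single b) {j : Fin n} {t : ℕ} : (c j).parent ≠ some (↑i, t) := by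
  intro hj
  obtain ⟨e, cs, hj⟩ := Letter.parent_eq_some hj
  obtain ⟨κ, i', hi', ho⟩ := hc.opened hj
  have : i = i' := Fin.ext hi'
  subst this
  rw [h] at ho
  exact ho

theorem Letter.opens_none {l : Letter} {t : ℕ} : l.Opens t none ↔ l = .start ∧ t = 0 := by
  cases l <;> simp [Letter.Opens]

theorem Letter.opens_some {l : Letter} {t : ℕ} {b : Bool} :
    l.Opens t (some b) ↔ (∃ p e cs, l = .join p e cs) ∧ t < l.size ∧ l.color t = some b := by
  cases l with
  | single => simp [Letter.Opens]
  | start => simp [Letter.Opens]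
  | join p e cs =>
    simp only [Letter.Opens, Letter.size, Letter.color]
    constructor
    · rintro ⟨b', h, h'⟩
      cases h'
      exact ⟨⟨_, _, _, rfl⟩, (List.getElem?_eq_some_iff.1 h).1, h⟩
    · rintro ⟨-, -, h⟩
      exact ⟨b, h, rfl⟩

theorem IsCode.parId_idx (hc : IsCode c) {x y : ℕ × ℕ} (h : parId c x = some y) :
    (y.1 < x.1 ∧ x.2 = 0) ∨ (y.1 = x.1 ∧ x.2 = y.2 + 1) := by
  rcases x with ⟨a, t⟩
  cases t with
  | succ t =>
    rw [parId_succ] at h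
    cases h
    exact Or.inr ⟨rfl, rfl⟩
  | zero =>
    unfold parId at h
    dsimp only at h
    split_ifs at h with ha
    obtain ⟨e, cs, h⟩ := Letter.parent_eq_some h
    exact Or.inl ⟨hc.lt h, rfl⟩

/-- The labels of a word form a finite set on which this number is strictly increasing for the
lexicographic order. -/
def keyId (c : Fin n → Letter) (x : ℕ × ℕ) : ℕ := x.1 * (∑ i, (c i).size + 1) + x.2

theorem keyId_lt {x y : ℕ × ℕ} (hx : ∃ i : Fin n, x.2 ≤ (c i).size)
    (h : x.1 < y.1 ∨ x.1 = y.1 ∧ x.2 < y.2) : keyId c x < keyId c y := by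
  unfold keyId
  rcases h with h | ⟨h, h'⟩
  · obtain ⟨i, hi⟩ := hx
    have h1 : (c i).size ≤ ∑ i, (c i).size :=
      Finset.single_le_sum (f := fun i => (c i).size) (fun _ _ => Nat.zero_le _)
        (Finset.mem_univ i)
    have h2 := Nat.mul_le_mul_right (∑ i, (c i).size + 1) (Nat.succ_le_of_lt h)
    rw [Nat.succ_mul] at h2
    omega
  · rw [h]
    omega

namespace Labelling

variable {I : Type*} {G : SimpleGraph (Fin n ⊕ I)} {ℓ : Fin n ⊕ I → ℕ × ℕ}

theorem exists_idx (hℓ : Labelling c G ℓ) (v : Fin n ⊕ I) :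
    ∃ i : Fin n, (ℓ v).1 = i ∧ (ℓ v).2 ≤ (c i).size := by
  rcases v with i | v
  · exact ⟨i, by simp [hℓ.inl], by simp [hℓ.inl]⟩
  · obtain ⟨i, t, ht, h⟩ := hℓ.inr v
    exact ⟨i, by simp [h], by simp [h, ht.le]⟩

theorem exists_eq (hℓ : Labelling c G ℓ) (i : Fin n) {t : ℕ} (ht : t ≤ (c i).size) :
    ∃ v, ℓ v = (↑i, t) := by
  rcases ht.eq_or_lt with rfl | ht
  · exact ⟨_, hℓ.inl i⟩
  · obtain ⟨v, hv⟩ := hℓ.surj i t ht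
    exact ⟨_, hv⟩

theorem exists_par (hc : IsCode c) (hℓ : Labelling c G ℓ) {v : Fin n ⊕ I} {x : ℕ × ℕ}
    (h : parId c (ℓ v) = some x) : ∃ u, ℓ u = x := by
  obtain ⟨i, hi, ht⟩ := hℓ.exists_idx v
  rcases hv : ℓ v with ⟨a, t⟩
  rw [hv] at h hi ht
  dsimp only at hi ht
  subst hi
  cases t with
  | succ t =>
    rw [parId_succ] at h
    cases h
    exact hℓ.exists_eq i (by omega)
  | zero =>
    rw [parId_zero] at h
    obtain ⟨e, cs, h⟩ := Letter.parent_eq_some h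
    obtain ⟨κ, i', hi', ho⟩ := hc.opened h
    obtain ⟨u, hu⟩ := hℓ.exists_eq i' ho.le_size
    exact ⟨u, by rw [hu, ← hi']⟩

open scoped Classical in
/-- The vertex with a given label, if there is one. -/
noncomputable def vertexOf {W : Type*} (ℓ : W → ℕ × ℕ) (x : Option (ℕ × ℕ)) : Option W :=
  if h : ∃ u, x = some (ℓ u) then some h.choose else none

theorem vertexOf_eq_some {W : Type*} {ℓ : W → ℕ × ℕ} (hℓ : Function.Injective ℓ)
    {x : Option (ℕ × ℕ)} {v : W} : vertexOf ℓ x = some v ↔ x = some (ℓ v) := by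
  unfold vertexOf
  split_ifs with h
  · rw [Option.some_inj]
    constructor
    · rintro rfl
      exact h.choose_spec
    · intro h'
      exact hℓ (Option.some_inj.1 (h.choose_spec.symm.trans h'))
  · exact ⟨fun h' => by simp at h', fun h' => absurd ⟨_, h'⟩ h⟩

/-- The rooting of a graph described by a word. -/
noncomputable def rooting (hc : IsCode c) (hℓ : Labelling c G ℓ) : Rooting G where
  par v := vertexOf ℓ (parId c (ℓ v))
  key v := keyId c (ℓ v)
  adj_iff u v := by
    rw [vertexOf_eq_some hℓ.inj, vertexOf_eq_some hℓ.inj]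
    exact hℓ.adj u v
  key_lt := by
    intro u v h
    rw [vertexOf_eq_some hℓ.inj] at h
    refine keyId_lt ?_ ?_
    · obtain ⟨i, -, hi⟩ := hℓ.exists_idx u
      exact ⟨i, hi⟩
    · rcases hc.parId_idx h with h | h
      · exact Or.inl h.1
      · right
        omega

theorem rooting_par (hc : IsCode c) (hℓ : Labelling c G ℓ) {u v : Fin n ⊕ I} :
    (hℓ.rooting hc).par u = some v ↔ parId c (ℓ u) = some (ℓ v) :=
  vertexOf_eq_some hℓ.inj

theorem rooting_par_none (hc : IsCode c) (hℓ : Labelling c G ℓ) {u : Fin n ⊕ I} :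
    (hℓ.rooting hc).par u = none ↔ parId c (ℓ u) = none := by
  rw [← not_iff_not, ← ne_eq, ← ne_eq, Option.ne_none_iff_exists', Option.ne_none_iff_exists']
  constructor
  · rintro ⟨v, hv⟩
    exact ⟨_, (rooting_par hc hℓ).1 hv⟩
  · rintro ⟨x, hx⟩
    obtain ⟨v, rfl⟩ := exists_par hc hℓ hx
    exact ⟨v, (rooting_par hc hℓ).2 hx⟩

theorem anc_idx_le (hc : IsCode c) (hℓ : Labelling c G ℓ) {u v : Fin n ⊕ I}
    (h : (hℓ.rooting hc).Anc u v) : (ℓ u).1 ≤ (ℓ v).1 := by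
  induction h with
  | refl => exact le_rfl
  | tail _ h ih =>
    rcases hc.parId_idx ((rooting_par hc hℓ).1 h) with h | h <;> omega

/-- Every vertex is an ancestor of the boundary vertex that opens it. -/
theorem anc_inl (hc : IsCode c) (hℓ : Labelling c G ℓ) {v : Fin n ⊕ I} {i : Fin n}
    (hi : (ℓ v).1 = i) : (hℓ.rooting hc).Anc v (Sum.inl i) := by
  obtain ⟨i', hi', ht⟩ := hℓ.exists_idx v
  have : i = i' := Fin.ext (hi.symm.trans hi')
  subst this
  induction hk : (c i).size - (ℓ v).2 generalizing v with
  | zero =>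
    have : v = Sum.inl i := hℓ.inj (by rw [hℓ.inl]; exact Prod.ext hi (by dsimp only; omega))
    rw [this]
    exact Rooting.Anc.refl _
  | succ k ih =>
    obtain ⟨w, hw⟩ := hℓ.exists_eq i (t := (ℓ v).2 + 1) (by omega)
    have h1 : (hℓ.rooting hc).par w = some v := by
      rw [rooting_par, hw, parId_succ, ← hi]
    exact (Rooting.anc_of_par h1).trans
      (ih (by rw [hw]) (by rw [hw]) (by rw [hw]; dsimp only; omega) (by rw [hw]; dsimp only; omega))

theorem idx_eq_of_single (hc : IsCode c) (hℓ : Labelling c G ℓ) {u v : Fin n ⊕ I} {i : Fin n}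
    {b : Bool} (hi : c i = .single b) (hu : (ℓ u).1 = i) (h : (hℓ.rooting hc).Anc u v) :
    (ℓ v).1 = i := by
  induction h with
  | refl => exact hu
  | tail _ h ih =>
    rename_i a w _
    rw [rooting_par] at h
    rcases hc.parId_idx h with h' | h'
    · exfalso
      obtain ⟨j, hj, hjt⟩ := hℓ.exists_idx w
      rw [show ℓ w = (↑j, 0) from Prod.ext hj h'.2, parId_zero,
        show ℓ a = (↑i, (ℓ a).2) from Prod.ext ih rfl] at h
      exact hc.not_pred_opened_single hi h
    · omega

theorem color_of_lt {i : Fin n} {t : ℕ} (ht : t < (c i).size) : ∃ b, (c i).color t = some b := by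
  rcases hi : c i with b | _ | ⟨p, e, cs⟩ <;> rw [hi] at ht <;> simp [Letter.size] at ht
  · subst ht
    exact ⟨b, rfl⟩
  · exact ⟨cs[t], List.getElem?_eq_getElem ht⟩

/-- The labels of the neighbours of a vertex: its parent, the next vertex opened by the same boundary
vertex, and the topmost vertices opened by others that have it as a parent. -/
theorem image_neighborSet (hc : IsCode c) (hℓ : Labelling c G ℓ) (v : Fin n ⊕ I) :
    ℓ '' G.neighborSet v = {y | parId c (ℓ v) = some y} ∪
      {y | (ℓ v).1 = y.1 ∧ y.2 = (ℓ v).2 + 1 ∧ v.isRight} ∪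
      (fun j : Fin n => ((j : ℕ), 0)) '' {j | (c j).parent = some (ℓ v)} := by
  ext y
  simp only [Set.mem_image, SimpleGraph.mem_neighborSet, Set.mem_union, Set.mem_ofPred_eq]
  constructor
  · rintro ⟨u, hu, rfl⟩
    rcases (hℓ.adj _ _).1 hu with h | h
    · exact Or.inl (Or.inl h)
    · obtain ⟨i, hi, ht⟩ := hℓ.exists_idx u
      rcases hc.parId_idx h with h' | h'
      · right
        have : ℓ u = (↑i, 0) := Prod.ext hi h'.2
        refine ⟨i, ?_, this.symm⟩
        rwa [this, parId_zero] at h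
      · left
        right
        refine ⟨h'.1, h'.2, ?_⟩
        rcases v with j | v
        · exfalso
          simp only [hℓ.inl] at h'
          have : i = j := Fin.ext (hi.symm.trans h'.1.symm)
          subst this
          omega
        · rfl
  · rintro ((h | ⟨h1, h2, h3⟩) | ⟨j, h, rfl⟩)
    · obtain ⟨u, rfl⟩ := exists_par hc hℓ h
      exact ⟨u, (hℓ.adj _ _).2 (Or.inl h), rfl⟩
    · rcases v with j | v
      · cases h3
      · obtain ⟨i, t, ht, hv⟩ := hℓ.inr v
        rw [hv] at h1 h2
        dsimp only at h1 h2
        obtain ⟨u, hu⟩ := hℓ.exists_eq i (t := t + 1) ht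
        have hy : y = (↑i, t + 1) := Prod.ext h1.symm h2
        refine ⟨u, (hℓ.adj _ _).2 (Or.inr ?_), by rw [hu, hy]⟩
        rw [hu, parId_succ, hv]
    · obtain ⟨u, hu⟩ := hℓ.exists_eq j (Nat.zero_le _)
      refine ⟨u, (hℓ.adj _ _).2 (Or.inr ?_), hu⟩
      rw [hu, parId_zero, h]

theorem ncard_neighborSet (hc : IsCode c) (hℓ : Labelling c G ℓ) (v : Fin n ⊕ I) :
    (G.neighborSet v).ncard = (if (parId c (ℓ v)).isSome then 1 else 0) +
      (if v.isRight then 1 else 0) + {j | (c j).parent = some (ℓ v)}.ncard := by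
  rw [← Set.ncard_image_of_injective _ hℓ.inj, image_neighborSet hc hℓ v]
  have hA : {y | parId c (ℓ v) = some y}.ncard = if (parId c (ℓ v)).isSome then 1 else 0 := by
    rcases parId c (ℓ v) with _ | x <;> simp
  have hB : {y : ℕ × ℕ | (ℓ v).1 = y.1 ∧ y.2 = (ℓ v).2 + 1 ∧ v.isRight}.ncard =
      if v.isRight then 1 else 0 := by
    split_ifs with h
    · rw [Set.ncard_eq_one]
      refine ⟨((ℓ v).1, (ℓ v).2 + 1), ?_⟩
      ext y
      simp only [Set.mem_ofPred_eq, Set.mem_singleton_iff, h, and_true, Prod.ext_iff]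
      tauto
    · simp [h]
  have hAf : {y | parId c (ℓ v) = some y}.Finite := by
    rcases parId c (ℓ v) with _ | x <;> simp
  have hBf : {y : ℕ × ℕ | (ℓ v).1 = y.1 ∧ y.2 = (ℓ v).2 + 1 ∧ v.isRight}.Finite := by
    refine (Set.finite_singleton ((ℓ v).1, (ℓ v).2 + 1)).subset ?_
    rintro y ⟨h1, h2, -⟩
    exact Prod.ext h1.symm h2
  have hinj : Function.Injective (fun j : Fin n => ((j : ℕ), 0)) := by
    intro a b h
    exact Fin.ext (Prod.ext_iff.1 h).1
  rw [Set.ncard_union_eq ?_ (hAf.union hBf) (Set.toFinite _), Set.ncard_union_eq ?_ hAf hBf, hA, hB,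
    Set.ncard_image_of_injective _ hinj]
  · rw [Set.disjoint_left]
    rintro y h1 ⟨h2, h3, -⟩
    rcases hc.parId_idx h1 with h | h <;> omega
  · rw [Set.disjoint_left]
    rintro y h1 ⟨j, h2, rfl⟩
    obtain ⟨e, cs, h2⟩ := Letter.parent_eq_some h2
    have h4 := hc.lt h2
    rcases h1 with h1 | ⟨h1, h3, -⟩
    · rcases hc.parId_idx h1 with h | h <;> dsimp only at h <;> omega
    · dsimp only at h3
      omega

theorem ncard_neighborSet_single (hc : IsCode c) (hℓ : Labelling c G ℓ) {v : I} {i : Fin n}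
    {t : ℕ} {b : Bool} (hv : ℓ (Sum.inr v) = (↑i, t)) (hi : c i = .single b) :
    (G.neighborSet (Sum.inr v)).ncard = 1 := by
  obtain ⟨i', t', ht', hv'⟩ := hℓ.inr v
  rw [hv] at hv'
  obtain ⟨h1, rfl⟩ := Prod.ext_iff.1 hv'
  dsimp only at h1 ht'
  have : i = i' := Fin.ext h1
  subst this
  rw [hi] at ht'
  have ht0 : t = 0 := by simpa [Letter.size] using ht'
  subst ht0
  have : {j | (c j).parent = some (ℓ (Sum.inr v))} = ∅ := by
    ext j
    simp only [Set.mem_ofPred_eq, Set.mem_empty_iff_false, iff_false, hv]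
    exact hc.not_pred_opened_single hi
  rw [ncard_neighborSet hc hℓ, this, hv, parId_zero, hi]
  simp [Letter.parent]

theorem ncard_neighborSet_join (hc : IsCode c) (hℓ : Labelling c G ℓ) {v : I} {i : Fin n}
    {t : ℕ} {p : ℕ × ℕ} {e : Bool} {cs : List Bool} (hv : ℓ (Sum.inr v) = (↑i, t))
    (hi : c i = .join p e cs) : (G.neighborSet (Sum.inr v)).ncard =
      2 + {j | (c j).parent = some (↑i, t)}.ncard := by
  rw [ncard_neighborSet hc hℓ, hv]
  have : (parId c (↑i, t)).isSome := by
    cases t with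
    | zero => rw [parId_zero, hi]; rfl
    | succ t => rfl
  simp [this]

theorem users_nonempty (hc : IsCode c) {x : ℕ × ℕ} {κ : Option Bool} (h : Opened c x κ) :
    1 ≤ {j | (c j).parent = some x}.ncard := by
  obtain ⟨j, e, cs, hj⟩ := hc.used h
  exact (Set.ncard_pos (Set.toFinite _)).2 ⟨j, by simp [hj, Letter.parent]⟩

theorem opened_of_join {i : Fin n} {t : ℕ} {p : ℕ × ℕ} {e : Bool} {cs : List Bool}
    (hi : c i = .join p e cs) (ht : t < (c i).size) :
    ∃ b, Opened c (↑i, t) (some b) ∧ (c i).color t = some b := by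
  rw [hi] at ht
  have h1 : cs[t]? = some cs[t] := List.getElem?_eq_getElem ht
  refine ⟨cs[t], ⟨i, rfl, ?_⟩, ?_⟩
  · rw [hi]
    exact ⟨_, h1, rfl⟩
  · rw [hi]
    exact h1

theorem ncard_neighborSet_inl (hc : IsCode c) (hℓ : Labelling c G ℓ) (i : Fin n) :
    (G.neighborSet (Sum.inl i)).ncard = 1 := by
  rw [ncard_neighborSet hc hℓ, hℓ.inl]
  rcases hi : c i with b | _ | ⟨p, e, cs⟩
  · have : {j | (c j).parent = some (↑i, (Letter.single b).size)} = ∅ := by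
      ext j
      simpa using hc.not_pred_opened_single hi
    rw [this]
    simp [Letter.size]
  · have ho : Opened c (↑i, 0) none := ⟨i, rfl, by rw [hi]; exact ⟨rfl, rfl⟩⟩
    have h1 := users_nonempty hc ho
    have h2 : {j | (c j).parent = some (↑i, 0)}.ncard ≤ 1 := by
      rw [Set.ncard_le_one]
      intro a ha b hb
      obtain ⟨e, cs, ha⟩ := Letter.parent_eq_some ha
      obtain ⟨e', cs', hb⟩ := Letter.parent_eq_some hb
      rcases lt_trichotomy a b with h | h | h
      · exact absurd hb (((hc.last ha).1 (hc.once ha ho)) b e' cs' h)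
      · exact h
      · exact absurd ha (((hc.last hb).1 (hc.once hb ho)) a e cs h)
    have h3 : parId c (↑i, Letter.start.size) = none := by
      show parId c (↑i, 0) = none
      rw [parId_zero, hi]
      rfl
    rw [h3]
    show 0 + 0 + {j | (c j).parent = some (↑i, 0)}.ncard = 1
    omega
  · have : {j | (c j).parent = some (↑i, (Letter.join p e cs).size)} = ∅ := by
      ext j
      simp only [Set.mem_ofPred_eq, Set.mem_empty_iff_false, iff_false]
      intro hj
      obtain ⟨e', cs', hj⟩ := Letter.parent_eq_some hj
      obtain ⟨κ, i', hi', ho⟩ := hc.opened hj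
      have : i = i' := Fin.ext hi'
      subst this
      rw [hi] at ho
      obtain ⟨b, hb, -⟩ := ho
      have := (List.getElem?_eq_some_iff.1 hb).1
      simp [Letter.size] at this
    rw [this]
    have : (parId c (↑i, (Letter.join p e cs).size)).isSome := by
      rcases h : (Letter.join p e cs).size with _ | t
      · rw [parId_zero, hi]; rfl
      · rfl
    simp [this]

end Labelling

/-- The vertex of a forest at which its tree is rooted: the boundary leaf if there is one, and the
first boundary vertex otherwise. -/
def IsRootOf {I : Type*} (G : SimpleGraph (Fin n ⊕ I)) : Fin n ⊕ I → Prop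
  | Sum.inr u => (G.neighborSet (Sum.inr u)).ncard = 1
  | Sum.inl i => (∀ u, G.Adj (Sum.inl i) (Sum.inr u) → (G.neighborSet (Sum.inr u)).ncard ≠ 1) ∧
      ∀ j, G.Reachable (Sum.inl i) (Sum.inl j) → i ≤ j

namespace Labelling

variable {I : Type*} {G : SimpleGraph (Fin n ⊕ I)} {ℓ ℓ' : Fin n ⊕ I → ℕ × ℕ}

/-- The root of a tree, as given by the labels, is characterised by the graph alone. -/
theorem parId_none_iff (hc : IsCode c) (hℓ : Labelling c G ℓ) (v : Fin n ⊕ I) :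
    parId c (ℓ v) = none ↔ IsRootOf G v := by
  rcases v with i | v
  · rw [hℓ.inl]
    rcases hi : c i with b | _ | ⟨p, e, cs⟩
    · simp only [Letter.size]
      rw [show (1 : ℕ) = 0 + 1 from rfl, parId_succ]
      simp only [reduceCtorEq, false_iff]
      rintro ⟨h, -⟩
      obtain ⟨u, hu⟩ := hℓ.surj i 0 (by simp [hi, Letter.size])
      refine h u ?_ (ncard_neighborSet_single hc hℓ hu hi)
      rw [hℓ.adj, hℓ.inl, hu, hi]
      exact Or.inl rfl
    · simp only [Letter.size]
      rw [parId_zero, hi]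
      simp only [Letter.parent, true_iff]
      constructor
      · intro u hu h1
        obtain ⟨j, t, ht, hj⟩ := hℓ.inr u
        rcases hcj : c j with b | _ | ⟨p, e, cs⟩
        · rw [hcj] at ht
          have ht0 : t = 0 := by simpa [Letter.size] using ht
          subst ht0
          rw [hℓ.adj, hℓ.inl, hj, parId_zero, hcj, hi] at hu
          simp [Letter.size, Letter.parent, parId_zero, hi] at hu
        · rw [hcj] at ht
          simp [Letter.size] at ht
        · rw [ncard_neighborSet_join hc hℓ hj hcj] at h1
          omega
      · intro j hj
        rw [Rooting.reachable_iff_root (R := hℓ.rooting hc)] at hj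
        have h1 : (hℓ.rooting hc).par (Sum.inl i) = none := by
          rw [rooting_par_none, hℓ.inl, hi]
          show parId c (↑i, 0) = none
          rw [parId_zero, hi]
          rfl
        have h2 := Rooting.eq_root h1 (Rooting.Anc.refl _)
        have h3 := Rooting.root_anc (R := hℓ.rooting hc) (Sum.inl j)
        rw [← hj, ← h2] at h3
        have h4 := anc_idx_le hc hℓ h3
        rw [hℓ.inl, hℓ.inl] at h4
        exact h4
    · have h1 : parId c (↑i, (Letter.join p e cs).size) ≠ none := by
        rcases h : (Letter.join p e cs).size with _ | t
        · rw [parId_zero, hi]; simp [Letter.parent]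
        · simp
      simp only [h1, false_iff]
      rintro ⟨-, h⟩
      have h2 := Rooting.root_anc (R := hℓ.rooting hc) (Sum.inl i)
      have h3 := Rooting.par_root (R := hℓ.rooting hc) (Sum.inl i)
      set r := (hℓ.rooting hc).root (Sum.inl i)
      obtain ⟨a, ha, hat⟩ := hℓ.exists_idx r
      rw [rooting_par_none] at h3
      have hr0 : ℓ r = (↑a, 0) := by
        rcases hr : ℓ r with ⟨a', t⟩
        rw [hr] at h3 ha
        cases t with
        | zero => exact Prod.ext ha rfl
        | succ t => simp at h3
      rw [hr0, parId_zero] at h3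
      have hai := anc_idx_le hc hℓ h2
      rw [hℓ.inl, hr0] at hai
      dsimp only at hai
      rcases hca : c a with b | _ | ⟨p', e', cs'⟩
      · have := idx_eq_of_single hc hℓ hca ha h2
        rw [hℓ.inl] at this
        have : i = a := Fin.ext this
        subst this
        rw [hi] at hca
        cases hca
      · have hra : r = Sum.inl a := hℓ.inj (by rw [hr0, hℓ.inl, hca]; rfl)
        rw [hra] at h2
        have := h a h2.reachable.symm
        have : i = a := le_antisymm this hai
        subst this
        rw [hi] at hca
        cases hca
      · rw [hca] at h3
        cases h3
  · obtain ⟨i, t, ht, hv⟩ := hℓ.inr v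
    rcases hi : c i with b | _ | ⟨p, e, cs⟩
    · rw [hi] at ht
      have ht0 : t = 0 := by simpa [Letter.size] using ht
      subst ht0
      rw [hv, parId_zero, hi]
      simp only [Letter.parent, true_iff]
      exact ncard_neighborSet_single hc hℓ hv hi
    · rw [hi] at ht
      simp [Letter.size] at ht
    · have h1 : parId c (↑i, t) ≠ none := by
        cases t with
        | zero => rw [parId_zero, hi]; simp [Letter.parent]
        | succ t => simp
      rw [hv]
      simp only [h1, false_iff]
      intro h
      have h : (G.neighborSet (Sum.inr v)).ncard = 1 := h
      rw [ncard_neighborSet_join hc hℓ hv hi] at h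
      omega

variable {c' : Fin n → Letter}

/-- The labels of the vertices of a forest do not depend on the word describing it. -/
theorem unique (hc : IsCode c) (hc' : IsCode c') (hℓ : Labelling c G ℓ)
    (hℓ' : Labelling c' G ℓ') : ℓ = ℓ' := by
  have hpar : ∀ v, (hℓ.rooting hc).par v = (hℓ'.rooting hc').par v := by
    refine Rooting.par_eq_of_roots fun v => ?_
    rw [rooting_par_none, rooting_par_none, parId_none_iff hc hℓ, parId_none_iff hc' hℓ']
  have hanc : ∀ u v, (hℓ.rooting hc).Anc u v ↔ (hℓ'.rooting hc').Anc u v := by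
    intro u v
    unfold Rooting.Anc
    simp only [hpar]
  have hidx : ∀ v, (ℓ v).1 = (ℓ' v).1 := by
    intro v
    obtain ⟨i, hi, -⟩ := hℓ.exists_idx v
    obtain ⟨i', hi', -⟩ := hℓ'.exists_idx v
    have h1 := anc_idx_le hc' hℓ' ((hanc _ _).1 (anc_inl hc hℓ hi))
    have h2 := anc_idx_le hc hℓ ((hanc _ _).2 (anc_inl hc' hℓ' hi'))
    rw [hℓ'.inl] at h1
    rw [hℓ.inl] at h2
    dsimp only at h1 h2
    omega
  funext v
  induction hk : (hℓ.rooting hc).key v using Nat.strong_induction_on generalizing v with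
  | _ k ih =>
    refine Prod.ext (hidx v) ?_
    rcases hp : (hℓ.rooting hc).par v with _ | u
    · have hp' := (hpar v).symm.trans hp
      rw [rooting_par_none] at hp hp'
      rcases h : ℓ v with ⟨a, t⟩
      rcases h' : ℓ' v with ⟨a', t'⟩
      rw [h] at hp
      rw [h'] at hp'
      cases t <;> cases t' <;> simp at hp hp' ⊢
    · have hp' := (hpar v).symm.trans hp
      have hu := ih _ (hk ▸ (hℓ.rooting hc).key_lt hp) u rfl
      rw [rooting_par] at hp hp'
      have h1 := hc.parId_idx hp
      have h2 := hc'.parId_idx hp'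
      have h3 := hidx v
      rw [hu] at h1
      omega

end Labelling

namespace GrassmannianForest

/-- The word `c` describes the forest `F`. -/
def Represents (F : GrassmannianForest n) (c : Fin n → Letter) : Prop :=
  ∃ ℓ, Labelling c F.graph ℓ ∧ ∀ v,
    (colorId c (ℓ (Sum.inr v)) = some true → F.Black v) ∧
    (colorId c (ℓ (Sum.inr v)) = some false → F.White v)

theorem not_white_and_black (F : GrassmannianForest n) (v : F.Internal) :
    ¬ (F.White v ∧ F.Black v) := by
  rintro ⟨h1, h2⟩
  unfold White at h1
  unfold Black deg at h2
  rw [h1] at h2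
  exact F.degree_ne_two v h2.symm

/-- A forest is described by at most one word. -/
theorem Represents.unique {F : GrassmannianForest n} {c c' : Fin n → Letter}
    (h : F.Represents c) (h' : F.Represents c') (hc : IsCode c) (hc' : IsCode c') : c = c' := by
  obtain ⟨ℓ, hℓ, hcol⟩ := h
  obtain ⟨ℓ', hℓ', hcol'⟩ := h'
  obtain rfl := Labelling.unique hc hc' hℓ hℓ'
  have hsize : ∀ i, (c i).size = (c' i).size := by
    intro i
    have := hℓ.inl i
    rw [hℓ'.inl i] at this
    simpa using this.symm
  have hparent : ∀ i, (c i).parent = (c' i).parent := by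
    intro i
    obtain ⟨v, hv⟩ := hℓ.exists_eq i (Nat.zero_le _)
    have hR : (hℓ.rooting hc).par v = (hℓ'.rooting hc').par v := by
      refine Rooting.par_eq_of_roots (fun v => ?_) v
      rw [Labelling.rooting_par_none, Labelling.rooting_par_none, Labelling.parId_none_iff hc hℓ,
        Labelling.parId_none_iff hc' hℓ']
    rw [← parId_zero, ← parId_zero (c := c'), ← hv]
    rcases hp : (hℓ.rooting hc).par v with _ | u
    · rw [(Labelling.rooting_par_none hc hℓ).1 hp,
        (Labelling.rooting_par_none hc' hℓ').1 (hR ▸ hp)]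
    · rw [(Labelling.rooting_par hc hℓ).1 hp, (Labelling.rooting_par hc' hℓ').1 (hR ▸ hp)]
  have hcolor : ∀ i t b b', t < (c i).size → (c i).color t = some b →
      (c' i).color t = some b' → b = b' := by
    intro i t b b' ht hb hb'
    obtain ⟨v, hv⟩ := hℓ.surj i t ht
    have h1 := hcol v
    have h2 := hcol' v
    rw [hv, colorId_mk, hb] at h1
    rw [hv, colorId_mk, hb'] at h2
    cases b <;> cases b' <;> simp at h1 h2 ⊢
    · exact F.not_white_and_black v ⟨h1, h2⟩
    · exact F.not_white_and_black v ⟨h2, h1⟩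
  funext i
  have h1 := hsize i
  have h2 := hparent i
  have h3 := hcolor i
  rcases hi : c i with b | _ | ⟨p, e, cs⟩ <;> rcases hi' : c' i with b' | _ | ⟨p', e', cs'⟩ <;>
    rw [hi, hi'] at h1 h2 h3 <;> simp only [Letter.size, Letter.parent, reduceCtorEq,
      Option.some_inj] at h1 h2
  · rw [h3 0 b b' (by simp [Letter.size]) rfl rfl]
  · subst h2
    have h4 : cs = cs' := by
      refine List.ext_getElem h1 fun t ht ht' => ?_
      exact h3 t _ _ ht (List.getElem?_eq_getElem ht) (List.getElem?_eq_getElem ht')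
    subst h4
    have h5 : e = true ↔ e' = true := by
      rw [hc.last hi, hc'.last hi']
      have : ∀ k, (∃ e cs, c k = .join p e cs) ↔ ∃ e cs, c' k = .join p e cs := by
        have : ∀ (d : Fin n → Letter) k, (∃ e cs, d k = .join p e cs) ↔ (d k).parent = some p := by
          intro d k
          constructor
          · rintro ⟨_, _, h⟩
            rw [h]
            rfl
          · exact Letter.parent_eq_some
        intro k
        rw [this, this, hparent]
      constructor
      · intro h k e' cs' hk h'
        obtain ⟨e'', cs'', h''⟩ := (this k).2 ⟨_, _, h'⟩
        exact h k _ _ hk h''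
      · intro h k e' cs' hk h'
        obtain ⟨e'', cs'', h''⟩ := (this k).1 ⟨_, _, h'⟩
        exact h k _ _ hk h''
    rw [Bool.eq_iff_iff.2 h5]

end GrassmannianForest

end Codes

/-! ### Cyclic orders -/

section Cyclic

variable {α : Type*} [Finite α] {ρ : Equiv.Perm α}

theorem exists_pow_lt_card {x y : α} (h : ρ.SameCycle x y) :
    ∃ i < Nat.card α, (ρ ^ i) x = y := by
  classical
  have := Fintype.ofFinite α
  rcases eq_or_ne x y with rfl | hne
  · exact ⟨0, Nat.card_pos_iff.2 ⟨⟨x⟩, inferInstance⟩, rfl⟩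
  · have hx : x ∈ ρ.support := by
      rw [Equiv.Perm.mem_support]
      intro hx
      obtain ⟨k, hk⟩ := h
      rw [Equiv.Perm.zpow_apply_eq_self_of_apply_eq_self hx] at hk
      exact hne hk
    obtain ⟨i, hi, hi'⟩ := h.exists_pow_eq_of_mem_support hx
    refine ⟨i, hi.trans_le ?_, hi'⟩
    rw [Nat.card_eq_fintype_card]
    exact Finset.card_le_univ (ρ.cycleOf x).support

theorem clockwiseFor_or {x y z : α} (h : ∀ x y, ρ.SameCycle x y) (hxy : x ≠ y) (hxz : x ≠ z)
    (hyz : y ≠ z) : ClockwiseFor ρ x y z ∨ ClockwiseFor ρ x z y := by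
  obtain ⟨a, ha, ha'⟩ := exists_pow_lt_card (h x y)
  obtain ⟨b, hb, hb'⟩ := exists_pow_lt_card (h x z)
  have ha0 : 0 < a := Nat.pos_of_ne_zero (by rintro rfl; exact hxy ha')
  have hb0 : 0 < b := Nat.pos_of_ne_zero (by rintro rfl; exact hxz hb')
  rcases lt_trichotomy a b with hab | rfl | hab
  · exact Or.inl ⟨a, b, ha0, hab, hb, ha', hb'⟩
  · exact absurd (ha'.symm.trans hb') hyz
  · exact Or.inr ⟨b, a, hb0, hab, ha, hb', ha'⟩

theorem clockwiseFor_next {x z : α} (h : ∀ x y, ρ.SameCycle x y) (hz : ρ x ≠ z) (hxz : x ≠ z) :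
    ClockwiseFor ρ x (ρ x) z := by
  obtain ⟨b, hb, hb'⟩ := exists_pow_lt_card (h x z)
  refine ⟨1, b, one_pos, ?_, hb, rfl, hb'⟩
  rcases b with _ | _ | b
  · exact absurd hb' hxz
  · exact absurd hb' hz
  · omega

theorem apply_ne_self {x z : α} (h : ρ.SameCycle x z) (hxz : x ≠ z) : ρ x ≠ x := by
  intro hx
  obtain ⟨b, -, hb'⟩ := exists_pow_lt_card h
  rw [Equiv.Perm.pow_apply_eq_self_of_apply_eq_self hx] at hb'
  exact hxz hb'

theorem Clockwise.not_swap {n : ℕ} {i j k : Fin n} (h : Clockwise i j k) : ¬ Clockwise i k j := by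
  unfold Clockwise at *
  omega

end Cyclic

/-! ### Branches of a Grassmannian forest -/

namespace GrassmannianForest

variable {n : ℕ} (F : GrassmannianForest n)

theorem boundary_adj_unique {i : Fin n} {a b : Fin n ⊕ F.Internal}
    (ha : F.graph.Adj (Sum.inl i) a) (hb : F.graph.Adj (Sum.inl i) b) : a = b := by
  obtain ⟨x, hx⟩ := Set.ncard_eq_one.1 (F.degree_boundary i)
  have h1 : a ∈ F.graph.neighborSet (Sum.inl i) := ha
  have h2 : b ∈ F.graph.neighborSet (Sum.inl i) := hb
  rw [hx] at h1 h2
  exact h1.trans h2.symm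

theorem exists_boundary_reachable (v : Fin n ⊕ F.Internal) :
    ∃ i : Fin n, F.graph.Reachable v (Sum.inl i) := by
  rcases v with i | v
  · exact ⟨i, SimpleGraph.Reachable.refl _⟩
  · exact F.reaches_boundary v

/-- An internal vertex of degree `1` is joined to the boundary. -/
theorem exists_inl_of_degree_one {u : F.Internal}
    (hu : (F.graph.neighborSet (Sum.inr u)).ncard = 1) :
    ∃ i : Fin n, ∀ w, F.graph.Adj (Sum.inr u) w ↔ w = Sum.inl i := by
  have h : ∃ i : Fin n, F.graph.Adj (Sum.inr u) (Sum.inl i) := by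
    by_contra h
    have := F.hel_internal u (fun h' => h h'.2)
    omega
  obtain ⟨i, hi⟩ := h
  refine ⟨i, fun w => ⟨fun hw => ?_, fun hw => hw ▸ hi⟩⟩
  obtain ⟨x, hx⟩ := Set.ncard_eq_one.1 hu
  have h1 : w ∈ F.graph.neighborSet (Sum.inr u) := hw
  have h2 : Sum.inl i ∈ F.graph.neighborSet (Sum.inr u) := hi
  rw [hx] at h1 h2
  exact h1.trans h2.symm

theorem exists_isRootOf (C : F.graph.ConnectedComponent) :
    ∃ v, F.graph.connectedComponentMk v = C ∧ IsRootOf F.graph v := by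
  classical
  obtain ⟨w, rfl⟩ := C.exists_rep
  by_cases h : ∃ u, F.graph.Reachable (Sum.inr u) w ∧
      (F.graph.neighborSet (Sum.inr u)).ncard = 1
  · obtain ⟨u, h1, h2⟩ := h
    exact ⟨Sum.inr u, SimpleGraph.ConnectedComponent.sound h1, h2⟩
  · obtain ⟨i, hi⟩ := F.exists_boundary_reachable w
    have hne : (Finset.univ.filter fun i : Fin n => F.graph.Reachable w (Sum.inl i)).Nonempty :=
      ⟨i, by simpa using hi⟩
    have hm := Finset.min'_mem _ hne
    set m := Finset.min' _ hne with hmdef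
    have hm : F.graph.Reachable w (Sum.inl m) := by simpa using hm
    refine ⟨Sum.inl m, SimpleGraph.ConnectedComponent.sound hm.symm, ?_, ?_⟩
    · intro u hu h1
      exact h ⟨u, hu.symm.reachable.trans hm.symm, h1⟩
    · intro j hj
      exact Finset.min'_le _ _ (by simpa using hm.trans hj)

theorem exists_canonical_rooting :
    ∃ R : Rooting F.graph, ∀ v, R.par v = none → IsRootOf F.graph v := by
  choose f hf hf' using F.exists_isRootOf
  obtain ⟨R, hR⟩ := Rooting.exists_rooting F.acyclic
    (fun v => f (F.graph.connectedComponentMk v))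
    (fun v => SimpleGraph.ConnectedComponent.exact (hf _))
    (fun u v h => by rw [SimpleGraph.ConnectedComponent.sound h])
  refine ⟨R, fun v hv => ?_⟩
  rw [hR] at hv
  rw [← hv]
  exact hf' _

/-- The rooting of a forest in which a tree is rooted at its boundary leaf if there is one, and at
its first boundary vertex otherwise. -/
noncomputable def rooting : Rooting F.graph := F.exists_canonical_rooting.choose

variable {F}

theorem isRootOf_of_par {v : Fin n ⊕ F.Internal} (h : F.rooting.par v = none) :
    IsRootOf F.graph v :=
  F.exists_canonical_rooting.choose_spec v h

theorem adj_of_par {u v : Fin n ⊕ F.Internal} (h : F.rooting.par v = some u) :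
    F.graph.Adj u v :=
  (F.rooting.adj_iff _ _).2 (Or.inr h)

theorem par_of_degree_one {u : F.Internal} (hu : (F.graph.neighborSet (Sum.inr u)).ncard = 1) :
    F.rooting.par (Sum.inr u) = none := by
  by_contra h
  obtain ⟨w, hw⟩ := Option.ne_none_iff_exists'.1 h
  obtain ⟨i, hi⟩ := F.exists_inl_of_degree_one hu
  obtain rfl := (hi w).1 (adj_of_par hw).symm
  have hroot : F.rooting.par (Sum.inl i) = none := by
    by_contra h'
    obtain ⟨w', hw'⟩ := Option.ne_none_iff_exists'.1 h'
    obtain rfl := F.boundary_adj_unique (adj_of_par hw').symm (adj_of_par hw)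
    exact absurd (F.rooting.key_lt hw) (not_lt.2 (F.rooting.key_lt hw').le)
  exact (isRootOf_of_par hroot).1 u (adj_of_par hw) hu

/-- A nontrivial vertex of a tree with a boundary leaf `u` is the boundary vertex joined to `u`. -/
theorem eq_of_anc_boundaryLeaf {u : F.Internal} {w : Fin n ⊕ F.Internal}
    (hu : (F.graph.neighborSet (Sum.inr u)).ncard = 1) (h : F.rooting.Anc (Sum.inr u) w) :
    w = Sum.inr u ∨ ∃ i, w = Sum.inl i ∧ F.rooting.par w = some (Sum.inr u) := by
  induction h with
  | refl => exact Or.inl rfl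
  | tail _ h ih =>
    obtain ⟨i, hi⟩ := F.exists_inl_of_degree_one hu
    rcases ih with rfl | ⟨j, rfl, hj⟩
    · exact Or.inr ⟨i, (hi _).1 (adj_of_par h), h⟩
    · obtain rfl := F.boundary_adj_unique (adj_of_par h) (adj_of_par hj).symm
      exact absurd (F.rooting.key_lt h) (not_lt.2 (F.rooting.key_lt hj).le)

/-- Every vertex has a descendant on the boundary. -/
theorem exists_anc_inl (v : Fin n ⊕ F.Internal) : ∃ i : Fin n, F.rooting.Anc v (Sum.inl i) := by
  classical
  obtain ⟨w, hw, hmax⟩ := Set.exists_max_image {w | F.rooting.Anc v w} F.rooting.key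
    (Set.toFinite _) ⟨v, Rooting.Anc.refl v⟩
  have hchild : ∀ x, F.rooting.par x ≠ some w := fun x hx =>
    absurd (F.rooting.key_lt hx) (not_lt.2 (hmax x (hw.trans (Rooting.anc_of_par hx))))
  rcases w with i | u
  · exact ⟨i, hw⟩
  · exfalso
    rcases hp : F.rooting.par (Sum.inr u) with _ | x
    · obtain ⟨i, ⟨p⟩⟩ := F.reaches_boundary u
      cases p with
      | cons h _ =>
        rcases (F.rooting.adj_iff _ _).1 h with h | h
        · rw [hp] at h; cases h
        · exact hchild _ h
    · have : (F.graph.neighborSet (Sum.inr u)).ncard = 1 := by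
        rw [Set.ncard_eq_one]
        refine ⟨x, Set.ext fun y => ?_⟩
        rw [SimpleGraph.mem_neighborSet, F.rooting.adj_iff, hp, Set.mem_singleton_iff,
          Option.some_inj, eq_comm (a := x)]
        exact or_iff_left (hchild y)
      rw [par_of_degree_one this] at hp
      cases hp

/-- The root of the tree of an internal vertex that is not a boundary leaf lies on the boundary. -/
theorem exists_root_eq_inl {v : F.Internal} {x : Fin n ⊕ F.Internal}
    (hx : F.rooting.par (Sum.inr v) = some x) :
    ∃ i : Fin n, F.rooting.root (Sum.inr v) = Sum.inl i := by
  rcases hr : F.rooting.root (Sum.inr v) with i | u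
  · exact ⟨i, rfl⟩
  · exfalso
    have h1 := Rooting.par_root (R := F.rooting) (Sum.inr v)
    have h2 := Rooting.root_anc (R := F.rooting) (Sum.inr v)
    rw [hr] at h1 h2
    rcases eq_of_anc_boundaryLeaf (isRootOf_of_par h1) h2 with h | ⟨i, h, -⟩
    · rw [h, h1] at hx
      cases hx
    · cases h

/-- Every branch at an internal vertex contains boundary vertices. -/
theorem exists_beyond_inl {v : F.Internal} {x : Fin n ⊕ F.Internal}
    (hx : F.graph.Adj (Sum.inr v) x) : ∃ i : Fin n, Beyond F.graph (Sum.inr v) x (Sum.inl i) := by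
  rcases (F.rooting.adj_iff _ _).1 hx with h | h
  · obtain ⟨i, hi⟩ := exists_root_eq_inl h
    refine ⟨i, Rooting.beyond_par h (fun ha => ?_) ?_⟩
    · have h1 := Rooting.par_root (R := F.rooting) (Sum.inr v)
      rw [hi] at h1
      have := Rooting.eq_of_anc_of_par_eq_none ha h1
      cases this
    · rw [← hi]
      exact ((Rooting.root_anc (R := F.rooting) (Sum.inr v)).root_eq).symm
  · obtain ⟨i, hi⟩ := exists_anc_inl x
    exact ⟨i, Rooting.beyond_child h hi⟩

theorem Beyond.map {V W : Type*} {G : SimpleGraph V} {H : SimpleGraph W} (φ : G ≃g H) {v x w : V}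
    (h : Beyond G v x w) : Beyond H (φ v) (φ x) (φ w) := by
  obtain ⟨p, hp, hnil, rfl⟩ := h
  refine ⟨p.map φ.toHom, hp.map φ.injective, ?_, ?_⟩
  · simpa using hnil
  · cases p with
    | nil => exact absurd SimpleGraph.Walk.Nil.nil hnil
    | cons h q => simp

/-- An isomorphism of forests that fixes the boundary preserves the clockwise orders: these are
determined by the labels of the boundary vertices on the branches. -/
theorem rot_preserved {F F' : GrassmannianForest n} (φ : F.graph ≃g F'.graph)
    (hφ : ∀ i : Fin n, φ (Sum.inl i) = Sum.inl i) (v : Fin n ⊕ F.Internal)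
    (x : F.graph.neighborSet v) :
    φ.mapNeighborSet v (F.rot v x) = F'.rot (φ v) (φ.mapNeighborSet v x) := by
  by_contra hne
  -- let `z` be the neighbour of `v` that should follow `x` according to `F'`; the branches through
  -- `x`, `F.rot v x` and `z` then end on the boundary in both cyclic orders
  obtain ⟨z, hz⟩ := (φ.mapNeighborSet v).surjective (F'.rot (φ v) (φ.mapNeighborSet v x))
  rw [← hz] at hne
  have hyz : F.rot v x ≠ z := fun h => hne (by rw [h])
  have hinj := (φ.mapNeighborSet v).injective
  have hxz : x ≠ z := by
    rintro rfl
    have := apply_ne_self (F'.rot_cyclic (φ v) (φ.mapNeighborSet v x)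
      (φ.mapNeighborSet v (F.rot v x))) (fun h => hyz (hinj h).symm)
    exact this hz.symm
  have hxy : x ≠ F.rot v x := (apply_ne_self (F.rot_cyclic v x z) hxz).symm
  have h1 := clockwiseFor_next (F.rot_cyclic v) hyz hxz
  have h2 : ClockwiseFor (F'.rot (φ v)) (φ.mapNeighborSet v x)
      (φ.mapNeighborSet v z) (φ.mapNeighborSet v (F.rot v x)) := by
    rw [hz]
    refine clockwiseFor_next (F'.rot_cyclic (φ v)) ?_ (fun h => hxy (hinj h))
    rw [← hz]
    exact fun h => hyz (hinj h).symm
  rcases v with i | v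
  · exact hxz (Subtype.ext (F.boundary_adj_unique x.2 z.2))
  · obtain ⟨i, hi⟩ := exists_beyond_inl x.2
    obtain ⟨j, hj⟩ := exists_beyond_inl (F.rot (Sum.inr v) x).2
    obtain ⟨k, hk⟩ := exists_beyond_inl z.2
    have hi' := Beyond.map φ hi
    have hj' := Beyond.map φ hj
    have hk' := Beyond.map φ hk
    rw [hφ] at hi' hj' hk'
    exact (F.branches_clockwise _ _ _ _ _ _ _ h1 hi hj hk).not_swap
      (F'.branches_clockwise _ _ _ _ _ _ _ h2 hi' hk' hj')

/-- Two forests described by the same word are equivalent. -/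
theorem Represents.equivalent {F F' : GrassmannianForest n} {c : Fin n → Letter}
    (h : F.Represents c) (h' : F'.Represents c) : F.Equivalent F' := by
  obtain ⟨ℓ, hℓ, hcol⟩ := h
  obtain ⟨ℓ', hℓ', hcol'⟩ := h'
  have hex : ∀ v, ∃ w, ℓ' w = ℓ v := by
    intro v
    obtain ⟨i, hi, ht⟩ := hℓ.exists_idx v
    obtain ⟨w, hw⟩ := hℓ'.exists_eq i ht
    exact ⟨w, by rw [hw, ← hi]⟩
  have hex' : ∀ v, ∃ w, ℓ w = ℓ' v := by
    intro v
    obtain ⟨i, hi, ht⟩ := hℓ'.exists_idx v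
    obtain ⟨w, hw⟩ := hℓ.exists_eq i ht
    exact ⟨w, by rw [hw, ← hi]⟩
  choose f hf using hex
  choose g hg using hex'
  let φ : F.graph ≃g F'.graph :=
    { toFun := f
      invFun := g
      left_inv := fun v => hℓ.inj (by rw [hg, hf])
      right_inv := fun v => hℓ'.inj (by rw [hf, hg])
      map_rel_iff' := by
        intro u v
        show F'.graph.Adj (f u) (f v) ↔ _
        rw [hℓ'.adj, hℓ.adj, hf, hf] }
  have hφ : ∀ v, ℓ' (φ v) = ℓ v := hf
  have hb : ∀ i : Fin n, φ (Sum.inl i) = Sum.inl i := fun i =>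
    hℓ'.inj (by rw [hφ, hℓ.inl, hℓ'.inl])
  refine ⟨φ, hb, fun v w hvw => ?_, rot_preserved φ hb⟩
  have hdeg : F'.deg w = F.deg v := by
    unfold deg
    rw [← hvw, ← Nat.card_coe_set_eq, ← Nat.card_coe_set_eq]
    exact Nat.card_congr (φ.mapNeighborSet (Sum.inr v)).symm
  have hw : ℓ' (Sum.inr w) = ℓ (Sum.inr v) := by rw [← hvw, hφ]
  have h1 := hcol v
  have h2 := hcol' w
  rw [hw] at h2
  obtain ⟨i, t, ht, hit⟩ := hℓ.inr v
  rw [hit, colorId_mk] at h1 h2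
  obtain ⟨b, hb⟩ := Labelling.color_of_lt ht
  rw [hb] at h1 h2
  cases b
  · have e1 := h1.2 rfl
    have e2 := h2.2 rfl
    unfold White at e1 e2
    rw [e1, e2]
  · have e1 := h1.1 rfl
    have e2 := h2.1 rfl
    unfold Black at e1 e2
    omega

end GrassmannianForest

/-! ### The word of a forest -/

namespace GrassmannianForest

variable {n : ℕ} {F : GrassmannianForest n}

/-- A boundary vertex with children is a root, as its degree is `1`. -/
theorem par_none_of_child {i : Fin n} {w : Fin n ⊕ F.Internal}
    (hw : F.rooting.par w = some (Sum.inl i)) : F.rooting.par (Sum.inl i) = none := by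
  by_contra h
  obtain ⟨x, hx⟩ := Option.ne_none_iff_exists'.1 h
  obtain rfl := F.boundary_adj_unique (adj_of_par hx).symm (adj_of_par hw)
  exact absurd (F.rooting.key_lt hw) (not_lt.2 (F.rooting.key_lt hx).le)

theorem le_of_anc_inl {i j : Fin n} (h : F.rooting.Anc (Sum.inl i) (Sum.inl j)) : i ≤ j := by
  rcases Rooting.anc_cases_head h with h' | ⟨w, hw, -⟩
  · exact (Sum.inl.inj h').le
  · exact (isRootOf_of_par (par_none_of_child hw)).2 j h.reachable

open scoped Classical in
/-- The first boundary vertex among the descendants of `v`. -/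
noncomputable def first (v : Fin n ⊕ F.Internal) : Fin n :=
  Finset.min' (Finset.univ.filter fun i => F.rooting.Anc v (Sum.inl i)) (by
    obtain ⟨i, hi⟩ := exists_anc_inl v
    exact ⟨i, by simpa using hi⟩)

open scoped Classical in
theorem anc_first (v : Fin n ⊕ F.Internal) : F.rooting.Anc v (Sum.inl (first v)) :=
  (Finset.mem_filter.1 (Finset.min'_mem (Finset.univ.filter fun i => F.rooting.Anc v (Sum.inl i))
    (by
      obtain ⟨i, hi⟩ := exists_anc_inl v
      exact ⟨i, by simpa using hi⟩))).2

theorem first_le {v : Fin n ⊕ F.Internal} {i : Fin n} (h : F.rooting.Anc v (Sum.inl i)) :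
    first v ≤ i := by
  classical
  exact Finset.min'_le _ _ (by simpa using h)

theorem first_mono {u v : Fin n ⊕ F.Internal} (h : F.rooting.Anc u v) : first u ≤ first v :=
  first_le (h.trans (anc_first v))

theorem first_inl (i : Fin n) : first (Sum.inl i : Fin n ⊕ F.Internal) = i :=
  le_antisymm (first_le (Rooting.Anc.refl _)) (le_of_anc_inl (anc_first _))

/-- The number of proper ancestors of `v` with the same first boundary vertex below them. -/
noncomputable def rank (v : Fin n ⊕ F.Internal) : ℕ :=
  {u | F.rooting.Anc u v ∧ u ≠ v ∧ first u = first v}.ncard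

theorem rank_lt {u v : Fin n ⊕ F.Internal} (h : F.rooting.Anc u v) (hne : u ≠ v)
    (hf : first u = first v) : rank u < rank v := by
  refine Set.ncard_lt_ncard ?_ (Set.toFinite _)
  rw [Set.ssubset_iff_exists]
  refine ⟨fun w hw => ⟨hw.1.trans h, ?_, hw.2.2.trans hf⟩, u, ⟨h, hne, hf⟩, fun h' => h'.2.1 rfl⟩
  rintro rfl
  exact hne (h.antisymm hw.1)

/-- Ranks increase by one from a parent to the child with the same first boundary vertex. -/
theorem rank_of_first_eq {u v : Fin n ⊕ F.Internal} (h : F.rooting.par v = some u)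
    (hf : first u = first v) : rank v = rank u + 1 := by
  have hne : u ≠ v := fun huv => absurd (F.rooting.key_lt h) (by rw [huv]; exact lt_irrefl _)
  have : {w | F.rooting.Anc w v ∧ w ≠ v ∧ first w = first v} =
      insert u {w | F.rooting.Anc w u ∧ w ≠ u ∧ first w = first u} := by
    ext w
    simp only [Set.mem_ofPred_eq, Set.mem_insert_iff]
    constructor
    · rintro ⟨h1, h2, h3⟩
      rcases eq_or_ne w u with rfl | hw
      · exact Or.inl rfl
      · exact Or.inr ⟨h1.of_par h2 h, hw, h3.trans hf.symm⟩
    · rintro (rfl | ⟨h1, h2, h3⟩)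
      · exact ⟨Rooting.anc_of_par h, hne, hf⟩
      · refine ⟨h1.trans (Rooting.anc_of_par h), ?_, h3.trans hf⟩
        rintro rfl
        exact Rooting.not_anc_par h h1
  unfold rank
  rw [this, Set.ncard_insert_of_notMem (fun h => h.2.1 rfl) (Set.toFinite _)]

theorem rank_eq_zero {v : Fin n ⊕ F.Internal}
    (h : ∀ u, F.rooting.par v = some u → first u ≠ first v) : rank v = 0 := by
  unfold rank
  rw [Set.ncard_eq_zero (Set.toFinite _), Set.eq_empty_iff_forall_notMem]
  rintro w ⟨h1, h2, h3⟩
  rcases Rooting.anc_cases h1 with h4 | ⟨u, hu, hwu⟩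
  · exact h2 h4
  · refine h u hu (le_antisymm (first_mono (Rooting.anc_of_par hu)) ?_)
    rw [← h3]
    exact first_mono hwu

theorem first_lt_of_rank {u v : Fin n ⊕ F.Internal} (h : F.rooting.par v = some u)
    (hr : rank v = 0) : first u < first v := by
  refine lt_of_le_of_ne (first_mono (Rooting.anc_of_par h)) fun hf => ?_
  rw [rank_of_first_eq h hf] at hr
  omega

theorem exists_par_of_rank {v : Fin n ⊕ F.Internal} {t : ℕ} (hr : rank v = t + 1) :
    ∃ u, F.rooting.par v = some u ∧ first u = first v ∧ rank u = t := by
  by_contra hcon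
  have : rank v = 0 := by
    refine rank_eq_zero fun u hu hf => hcon ⟨u, hu, hf, ?_⟩
    have := rank_of_first_eq hu hf
    omega
  omega

/-- The label of a vertex: the boundary vertex opening it and its position among the vertices
opened by this boundary vertex. -/
noncomputable def label (v : Fin n ⊕ F.Internal) : ℕ × ℕ := (↑(first v), rank v)

theorem label_injective : Function.Injective (label : Fin n ⊕ F.Internal → ℕ × ℕ) := by
  intro u v h
  have h1 : first u = first v := Fin.ext (Prod.ext_iff.1 h).1
  have h2 : rank u = rank v := (Prod.ext_iff.1 h).2
  by_contra hne
  have h3 := anc_first u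
  rw [h1] at h3
  rcases h3.total (anc_first v) with h | h
  · exact (rank_lt h hne h1).ne h2
  · exact (rank_lt h (Ne.symm hne) h1.symm).ne h2.symm

theorem label_mono {u v : Fin n ⊕ F.Internal} (h : F.rooting.Anc u v) :
    (label u).1 < (label v).1 ∨ (label u).1 = (label v).1 ∧ (label u).2 ≤ (label v).2 := by
  rcases (first_mono h).lt_or_eq with hf | hf
  · exact Or.inl hf
  · refine Or.inr ⟨congrArg Fin.val hf, ?_⟩
    rcases eq_or_ne u v with rfl | hne
    · exact le_rfl
    · exact (rank_lt h hne hf).le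

theorem exists_label_eq (i : Fin n) {t : ℕ} (ht : t ≤ rank (Sum.inl i : Fin n ⊕ F.Internal)) :
    ∃ v : Fin n ⊕ F.Internal, first v = i ∧ rank v = t := by
  obtain ⟨k, hk⟩ := Nat.exists_eq_add_of_le' ht
  induction k generalizing t with
  | zero => exact ⟨Sum.inl i, first_inl i, by omega⟩
  | succ k ih =>
    obtain ⟨v, hv, hv'⟩ := ih (t := t + 1) (by omega) (by omega)
    obtain ⟨u, -, hu, hu'⟩ := exists_par_of_rank hv'
    exact ⟨u, hu.trans hv, hu'⟩

theorem rank_inr_lt (v : F.Internal) :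
    rank (Sum.inr v) < rank (Sum.inl (first (Sum.inr v)) : Fin n ⊕ F.Internal) :=
  rank_lt (anc_first _) (by simp) (first_inl _).symm

/-- The topmost vertex opened by the boundary vertex `i`. -/
noncomputable def top (i : Fin n) : Fin n ⊕ F.Internal :=
  (exists_label_eq (F := F) i (Nat.zero_le _)).choose

theorem first_top (i : Fin n) : first (top i : Fin n ⊕ F.Internal) = i :=
  (exists_label_eq (F := F) i (Nat.zero_le _)).choose_spec.1

theorem rank_top (i : Fin n) : rank (top i : Fin n ⊕ F.Internal) = 0 :=
  (exists_label_eq (F := F) i (Nat.zero_le _)).choose_spec.2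

theorem top_first {v : Fin n ⊕ F.Internal} (h : rank v = 0) : top (first v) = v :=
  label_injective (Prod.ext (by simp [label, first_top]) (by simp [label, rank_top, h]))

theorem top_anc (i : Fin n) : F.rooting.Anc (top i) (Sum.inl i) := by
  have := anc_first (top i : Fin n ⊕ F.Internal)
  rwa [first_top] at this

open scoped Classical in
/-- Whether the vertex with a given label is a black internal vertex. -/
noncomputable def blackAt (F : GrassmannianForest n) (x : ℕ × ℕ) : Bool :=
  decide (∃ v : F.Internal, label (Sum.inr v : Fin n ⊕ F.Internal) = x ∧ F.Black v)

open scoped Classical in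
theorem blackAt_label (v : F.Internal) :
    F.blackAt (label (Sum.inr v)) = decide (F.Black v) := by
  unfold blackAt
  rw [decide_eq_decide]
  constructor
  · rintro ⟨w, hw, h⟩
    rwa [← Sum.inr.inj (label_injective hw)]
  · exact fun h => ⟨v, rfl, h⟩

open scoped Classical in
/-- The word describing a forest. -/
noncomputable def word (F : GrassmannianForest n) (i : Fin n) : Letter :=
  match F.rooting.par (top i) with
  | none => if rank (Sum.inl i : Fin n ⊕ F.Internal) = 0 then .start
      else .single (F.blackAt (↑i, 0))
  | some w => .join (label w) (decide (∀ j, i < j → F.rooting.par (top j) ≠ some w))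
      ((List.range (rank (Sum.inl i : Fin n ⊕ F.Internal))).map fun t => F.blackAt (↑i, t))

theorem word_of_none {i : Fin n} (h : F.rooting.par (top i) = none) :
    F.word i = if rank (Sum.inl i : Fin n ⊕ F.Internal) = 0 then .start
      else .single (F.blackAt (↑i, 0)) := by
  unfold word
  rw [h]

open scoped Classical in
theorem word_of_some {i : Fin n} {w : Fin n ⊕ F.Internal} (h : F.rooting.par (top i) = some w) :
    F.word i = .join (label w) (decide (∀ j, i < j → F.rooting.par (top j) ≠ some w))
      ((List.range (rank (Sum.inl i : Fin n ⊕ F.Internal))).map fun t => F.blackAt (↑i, t)) := by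
  unfold word
  rw [h]

theorem parent_word (i : Fin n) : (F.word i).parent = (F.rooting.par (top i)).map label := by
  rcases h : F.rooting.par (top i) with _ | w
  · rw [word_of_none h]
    split_ifs <;> rfl
  · rw [word_of_some h]
    rfl

/-- If the topmost vertex opened by a boundary vertex is a root, then it is this boundary vertex or
its boundary leaf. -/
theorem rank_inl_of_none {i : Fin n} (h : F.rooting.par (top i) = none)
    (h0 : rank (Sum.inl i : Fin n ⊕ F.Internal) ≠ 0) :
    rank (Sum.inl i : Fin n ⊕ F.Internal) = 1 := by
  rcases ht : (top i : Fin n ⊕ F.Internal) with j | u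
  · have h1 := first_top (F := F) i
    rw [ht, first_inl] at h1
    subst h1
    exact absurd (ht ▸ rank_top j) h0
  · rw [ht] at h
    have h1 := top_anc (F := F) i
    rw [ht] at h1
    rcases eq_of_anc_boundaryLeaf (isRootOf_of_par h) h1 with h2 | ⟨j, -, h3⟩
    · cases h2
    · have h4 := first_top (F := F) i
      have h5 := rank_top (F := F) i
      rw [ht] at h4 h5
      rw [rank_of_first_eq h3 (h4.trans (first_inl i).symm), h5]

theorem size_word (i : Fin n) : (F.word i).size = rank (Sum.inl i : Fin n ⊕ F.Internal) := by
  rcases h : F.rooting.par (top i) with _ | w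
  · rw [word_of_none h]
    split_ifs with h0
    · exact h0.symm
    · exact (rank_inl_of_none h h0).symm
  · rw [word_of_some h]
    simp [Letter.size]

theorem parId_label (v : Fin n ⊕ F.Internal) :
    parId F.word (label v) = (F.rooting.par v).map label := by
  rcases hr : rank v with _ | t
  · have : label v = (↑(first v), 0) := by rw [label, hr]
    rw [this, parId_zero, parent_word, top_first hr]
  · obtain ⟨u, hu, hf, hu'⟩ := exists_par_of_rank hr
    have : label v = (↑(first v), t + 1) := by rw [label, hr]
    rw [this, parId_succ, hu, ← hf, ← hu']
    rfl

theorem labelling_word (F : GrassmannianForest n) : Labelling F.word F.graph label where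
  inj := label_injective
  inl i := by rw [label, first_inl, size_word]
  inr v := ⟨first (Sum.inr v), rank (Sum.inr v), by rw [size_word]; exact rank_inr_lt v, rfl⟩
  surj i t ht := by
    rw [size_word] at ht
    obtain ⟨v, hv, hv'⟩ := exists_label_eq i ht.le
    rcases v with j | v
    · rw [first_inl] at hv
      subst hv
      exact absurd hv' ht.ne'
    · exact ⟨v, by rw [label, hv, hv']⟩
  adj u v := by
    rw [F.rooting.adj_iff, parId_label, parId_label]
    have : ∀ a b : Fin n ⊕ F.Internal, (F.rooting.par a).map label = some (label b) ↔
        F.rooting.par a = some b := by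
      intro a b
      rw [← Option.map_some, (Option.map_injective label_injective).eq_iff]
    rw [this, this]

open scoped Classical in
theorem colorId_label (v : F.Internal) :
    colorId F.word (label (Sum.inr v)) = some (decide (F.Black v)) := by
  have hlt := rank_inr_lt v
  rw [← blackAt_label, label, colorId_mk]
  set i := first (Sum.inr v : Fin n ⊕ F.Internal)
  rcases h : F.rooting.par (top i) with _ | w
  · rw [word_of_none h, if_neg (by omega)]
    have h1 := rank_inl_of_none h (by omega)
    rw [show rank (Sum.inr v : Fin n ⊕ F.Internal) = 0 by omega]
    rfl
  · rw [word_of_some h]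
    simp only [Letter.color, List.getElem?_map]
    rw [List.getElem?_range hlt]
    rfl

theorem represents_word (hF : F.IsPlabic) : F.Represents F.word := by
  refine ⟨label, F.labelling_word, fun v => ⟨fun h => ?_, fun h => ?_⟩⟩
  · rw [colorId_label] at h
    simpa using h
  · rw [colorId_label] at h
    have h : ¬ F.Black v := by simpa using h
    exact (hF v).resolve_right h

open scoped Classical in
theorem par_top_of_word {i : Fin n} {p : ℕ × ℕ} {e : Bool} {cs : List Bool}
    (h : F.word i = .join p e cs) : ∃ w, F.rooting.par (top i) = some w ∧ p = label w ∧
      (e = true ↔ ∀ j, i < j → F.rooting.par (top j) ≠ some w) ∧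
      cs = (List.range (rank (Sum.inl i : Fin n ⊕ F.Internal))).map fun t => F.blackAt (↑i, t) := by
  rcases hp : F.rooting.par (top i) with _ | w
  · rw [word_of_none hp] at h
    split_ifs at h
  · rw [word_of_some hp, Letter.join.injEq] at h
    obtain ⟨h1, h2, h3⟩ := h
    exact ⟨w, rfl, h1.symm, by rw [← h2, decide_eq_true_iff], h3.symm⟩

theorem parent_word_eq_some {i : Fin n} {w : Fin n ⊕ F.Internal} :
    (∃ e cs, F.word i = .join (label w) e cs) ↔ F.rooting.par (top i) = some w := by
  constructor
  · rintro ⟨e, cs, h⟩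
    obtain ⟨w', h1, h2, -⟩ := par_top_of_word h
    rw [h1, label_injective h2]
  · intro h
    exact ⟨_, _, word_of_some h⟩

open scoped Classical in
/-- The vertices that may receive children are the boundary vertices at a root and the internal
vertices other than boundary leaves. -/
theorem of_opened {x : ℕ × ℕ} {κ : Option Bool} (h : Opened F.word x κ) :
    (∃ i, x = label (Sum.inl i : Fin n ⊕ F.Internal) ∧ κ = none ∧
      F.rooting.par (Sum.inl i) = none) ∨
    ∃ v : F.Internal, x = label (Sum.inr v : Fin n ⊕ F.Internal) ∧ κ = some (decide (F.Black v)) ∧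
      F.rooting.par (Sum.inr v) ≠ none := by
  obtain ⟨i, hi, ho⟩ := h
  rcases κ with _ | b
  · left
    obtain ⟨h1, h2⟩ := Letter.opens_none.1 ho
    refine ⟨i, ?_, rfl, ?_⟩
    · rw [F.labelling_word.inl, h1]
      exact Prod.ext hi h2
    · have h3 := size_word (F := F) i
      rw [h1] at h3
      have h4 : top i = (Sum.inl i : Fin n ⊕ F.Internal) := by
        have := top_first (v := (Sum.inl i : Fin n ⊕ F.Internal)) h3.symm
        rwa [first_inl] at this
      have h5 := parent_word (F := F) i
      rw [h1, h4] at h5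
      rcases h6 : F.rooting.par (Sum.inl i) with _ | w
      · rfl
      · rw [h6] at h5
        cases h5
  · right
    obtain ⟨⟨p, e, cs, h1⟩, h2, h3⟩ := Letter.opens_some.1 ho
    obtain ⟨v, hv⟩ := F.labelling_word.surj i x.2 h2
    have hx : x = label (Sum.inr v : Fin n ⊕ F.Internal) := by
      rw [hv]
      exact Prod.ext hi rfl
    refine ⟨v, hx, ?_, ?_⟩
    · rw [← colorId_label, hv, colorId_mk, h3]
    · intro h4
      have h5 := parId_label (Sum.inr v : Fin n ⊕ F.Internal)
      rw [h4, hv] at h5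
      rcases h6 : x.2 with _ | t
      · rw [h6, parId_zero, h1] at h5
        cases h5
      · rw [h6] at h5
        cases h5

theorem opened_inl {i : Fin n} (h : F.rooting.par (top i) = none)
    (h0 : top i = (Sum.inl i : Fin n ⊕ F.Internal)) :
    Opened F.word (label (Sum.inl i : Fin n ⊕ F.Internal)) none := by
  have hr := rank_top (F := F) i
  rw [h0] at hr
  refine ⟨i, by rw [label, first_inl], ?_⟩
  rw [word_of_none h, if_pos hr]
  exact ⟨hr, rfl⟩

open scoped Classical in
theorem opened_inr {v : F.Internal} (h : F.rooting.par (Sum.inr v) ≠ none) :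
    Opened F.word (label (Sum.inr v)) (some (decide (F.Black v))) := by
  have hlt := rank_inr_lt v
  refine ⟨first (Sum.inr v), rfl, Letter.opens_some.2 ⟨?_, ?_, ?_⟩⟩
  · rcases hp : F.rooting.par (top (first (Sum.inr v : Fin n ⊕ F.Internal))) with _ | w
    · exfalso
      have h1 := rank_inl_of_none hp (by omega)
      rw [top_first (by omega)] at hp
      exact h hp
    · exact ⟨_, _, _, word_of_some hp⟩
  · rw [size_word]
    exact hlt
  · rw [← colorId_label, label, colorId_mk]

/-- If two boundary vertices are descendants of `w`, then so are the boundary vertices of the tree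
of `w` between them. -/
theorem anc_of_between {w : Fin n ⊕ F.Internal} {a i j : Fin n} (ha : F.rooting.Anc w (Sum.inl a))
    (hj : F.rooting.Anc w (Sum.inl j)) (hai : a < i) (hij : i < j)
    (hr : F.rooting.root w = F.rooting.root (Sum.inl i)) : F.rooting.Anc w (Sum.inl i) := by
  classical
  by_contra hcon
  -- `u` is the lowest common ancestor of `w` and the boundary vertex `i`
  obtain ⟨u, ⟨hu1, hu2⟩, hmax⟩ := Set.exists_max_image
    {u | F.rooting.Anc u w ∧ F.rooting.Anc u (Sum.inl i)} F.rooting.key (Set.toFinite _)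
    ⟨F.rooting.root w, Rooting.root_anc w, by rw [hr]; exact Rooting.root_anc _⟩
  obtain ⟨x, hx, hxw⟩ := (Rooting.anc_cases_head hu1).resolve_left (by rintro rfl; exact hcon hu2)
  obtain ⟨y, hy, hyi⟩ := (Rooting.anc_cases_head hu2).resolve_left (by
    rintro rfl
    exact absurd (le_of_anc_inl (hu1.trans ha)) (not_le.2 hai))
  have hxy : x ≠ y := by
    rintro rfl
    exact absurd (F.rooting.key_lt hx) (not_lt.2 (hmax x ⟨hxw, hyi⟩))
  rcases u with b | u
  · exact hxy (F.boundary_adj_unique (adj_of_par hx) (adj_of_par hy))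
  rcases hs : F.rooting.par (Sum.inr u) with _ | s
  · obtain ⟨b, hb⟩ := F.exists_inl_of_degree_one (isRootOf_of_par hs)
    exact hxy (((hb x).1 (adj_of_par hx)).trans ((hb y).1 (adj_of_par hy)).symm)
  -- around `u` there are the branches through `s`, `x` and `y`; they contain the first boundary
  -- vertex `r` of the tree, both `a` and `j`, and `i`, which is impossible if `r ≤ a < i < j`
  obtain ⟨r, hr'⟩ := exists_root_eq_inl hs
  have hrpar := Rooting.par_root (R := F.rooting) (Sum.inr u)
  rw [hr'] at hrpar
  have hrle : ∀ b : Fin n, F.rooting.Anc (Sum.inr u) (Sum.inl b) → r ≤ b := by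
    intro b hb
    have := (Rooting.root_anc (R := F.rooting) (Sum.inr u)).trans hb
    rw [hr'] at this
    exact le_of_anc_inl this
  have bs : Beyond F.graph (Sum.inr u) s (Sum.inl r) := by
    refine Rooting.beyond_par hs (fun h => ?_) ?_
    · have := Rooting.eq_of_anc_of_par_eq_none h hrpar
      cases this
    · rw [← hr']
      exact ((Rooting.root_anc (R := F.rooting) (Sum.inr u)).root_eq).symm
  have bxa := Rooting.beyond_child hx (hxw.trans ha)
  have bxj := Rooting.beyond_child hx (hxw.trans hj)
  have byi := Rooting.beyond_child hy hyi
  have hsx : s ≠ x := by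
    rintro rfl
    exact absurd (F.rooting.key_lt hs) (not_lt.2 (F.rooting.key_lt hx).le)
  have hsy : s ≠ y := by
    rintro rfl
    exact absurd (F.rooting.key_lt hs) (not_lt.2 (F.rooting.key_lt hy).le)
  have hra := hrle a (hu1.trans ha)
  have hri := hrle i hu2
  let s' : F.graph.neighborSet (Sum.inr u) := ⟨s, (adj_of_par hs).symm⟩
  let x' : F.graph.neighborSet (Sum.inr u) := ⟨x, adj_of_par hx⟩
  let y' : F.graph.neighborSet (Sum.inr u) := ⟨y, adj_of_par hy⟩
  rcases clockwiseFor_or (F.rot_cyclic (Sum.inr u)) (x := s') (y := x') (z := y')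
    (fun h => hsx (Subtype.ext_iff.1 h)) (fun h => hsy (Subtype.ext_iff.1 h))
    (fun h => hxy (Subtype.ext_iff.1 h)) with h | h
  · have := F.branches_clockwise _ _ _ _ _ _ _ h bs bxj byi
    unfold Clockwise at this
    omega
  · have := F.branches_clockwise _ _ _ _ _ _ _ h bs byi bxa
    unfold Clockwise at this
    omega

theorem blackAt_ne (hF : F.IsPlabic) (hF' : F.IsContracted) {u v : F.Internal}
    (h : F.rooting.par (Sum.inr v) = some (Sum.inr u)) :
    F.blackAt (label (Sum.inr u)) ≠ F.blackAt (label (Sum.inr v)) := by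
  classical
  rw [blackAt_label, blackAt_label]
  intro hb
  rw [decide_eq_decide] at hb
  refine hF' u v ⟨adj_of_par h, ?_⟩
  by_cases hu : F.Black u
  · exact Or.inr ⟨hu, hb.1 hu⟩
  · exact Or.inl ⟨(hF u).resolve_right hu, (hF v).resolve_right (fun h => hu (hb.2 h))⟩

theorem isCode_word (hF : F.IsPlabic) (hF' : F.IsContracted) : IsCode F.word where
  lt := by
    intro j p e cs h
    obtain ⟨w, hw, rfl, -⟩ := par_top_of_word h
    have := first_lt_of_rank hw (rank_top j)
    rwa [first_top] at this
  opened := by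
    classical
    intro j p e cs h
    obtain ⟨w, hw, rfl, -⟩ := par_top_of_word h
    rcases w with i | v
    · have hp := par_none_of_child hw
      have hr : rank (Sum.inl i : Fin n ⊕ F.Internal) = 0 :=
        rank_eq_zero fun u hu => by rw [hp] at hu; cases hu
      have ht := top_first hr
      rw [first_inl] at ht
      exact ⟨_, opened_inl (by rw [ht]; exact hp) ht⟩
    · refine ⟨_, opened_inr fun hp => ?_⟩
      have h1 := first_lt_of_rank hw (rank_top j)
      rcases eq_of_anc_boundaryLeaf (isRootOf_of_par hp) (anc_first (Sum.inr v)) with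
        h2 | ⟨i, h2, h3⟩
      · cases h2
      · rcases eq_of_anc_boundaryLeaf (isRootOf_of_par hp) (Rooting.anc_of_par hw) with
          h4 | ⟨i', h4, h5⟩
        · rw [h4] at h1
          exact lt_irrefl _ h1
        · obtain ⟨b, hb⟩ := F.exists_inl_of_degree_one (isRootOf_of_par hp)
          have h6 := (hb _).1 (adj_of_par hw)
          have h7 := (hb _).1 (adj_of_par h3)
          rw [h6, ← h7, first_inl] at h1
          exact lt_irrefl _ h1
  used := by
    intro x κ h
    rcases of_opened h with ⟨i, rfl, -, hi⟩ | ⟨v, rfl, -, hv⟩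
    · obtain ⟨u, hu⟩ := Set.ncard_eq_one.1 (F.degree_boundary i)
      have hadj : F.graph.Adj (Sum.inl i) u := by
        have : u ∈ F.graph.neighborSet (Sum.inl i) := by rw [hu]; rfl
        exact this
      have hpar : F.rooting.par u = some (Sum.inl i) := by
        rcases (F.rooting.adj_iff _ _).1 hadj with h | h
        · rw [hi] at h; cases h
        · exact h
      have hr : rank u = 0 := by
        refine rank_eq_zero fun w hw hf => ?_
        rw [hpar] at hw
        cases hw
        have := anc_first u
        rw [← hf, first_inl] at this
        exact Rooting.not_anc_par hpar this
      exact ⟨first u, parent_word_eq_some.2 (by rw [top_first hr]; exact hpar)⟩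
    · obtain ⟨s, hs⟩ := Option.ne_none_iff_exists'.1 hv
      -- `v` has at least two children, and only one of them has the same first boundary vertex
      have hdeg : 2 < (F.graph.neighborSet (Sum.inr v)).ncard := by
        have h1 : (F.graph.neighborSet (Sum.inr v)).ncard ≠ 1 := fun h => hv (par_of_degree_one h)
        have h2 := F.degree_ne_two v
        have h3 : 0 < (F.graph.neighborSet (Sum.inr v)).ncard :=
          (Set.ncard_pos (Set.toFinite _)).2 ⟨s, (adj_of_par hs).symm⟩
        omega
      have hch : 1 < (F.graph.neighborSet (Sum.inr v) \ {s}).ncard := by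
        rw [Set.ncard_sdiff_singleton_of_mem (show s ∈ F.graph.neighborSet (Sum.inr v) from
          (adj_of_par hs).symm)]
        omega
      obtain ⟨a, ha, b, hb, hab⟩ := (Set.one_lt_ncard (Set.toFinite _)).1 hch
      have hpar : ∀ a ∈ F.graph.neighborSet (Sum.inr v) \ {s},
          F.rooting.par a = some (Sum.inr v) := by
        rintro a ⟨ha, hne⟩
        rcases (F.rooting.adj_iff _ _).1 ha with h | h
        · rw [hs] at h
          cases h
          exact absurd rfl hne
        · exact h
      have key : ∀ a, F.rooting.par a = some (Sum.inr v) → first (Sum.inr v) ≠ first a →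
          ∃ j e cs, F.word j = .join (label (Sum.inr v)) e cs := by
        intro a ha hf
        have hr : rank a = 0 := rank_eq_zero fun w hw => by
          rw [ha] at hw
          cases hw
          exact hf
        exact ⟨first a, parent_word_eq_some.2 (by rw [top_first hr]; exact ha)⟩
      by_cases hfa : first (Sum.inr v) = first a
      · refine key b (hpar b hb) fun hfb => hab ?_
        have h1 := anc_first a
        have h2 := anc_first b
        rw [← hfa] at h1
        rw [← hfb] at h2
        exact Rooting.eq_of_anc_of_par_eq (hpar a ha) (hpar b hb) h1 h2
      · exact key a (hpar a ha) hfa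
  last := by
    intro j p e cs h
    obtain ⟨w, hw, rfl, he, -⟩ := par_top_of_word h
    rw [he]
    constructor
    · intro h1 k e' cs' hk h2
      exact h1 k hk (parent_word_eq_some.1 ⟨_, _, h2⟩)
    · intro h1 k hk h2
      obtain ⟨e', cs', h3⟩ := parent_word_eq_some.2 h2
      exact h1 k e' cs' hk h3
  once := by
    intro j p e cs h ho
    obtain ⟨w, hw, rfl, he, -⟩ := par_top_of_word h
    rw [he]
    intro k hk hk'
    rcases of_opened ho with ⟨i, hi, -, -⟩ | ⟨v, -, hv, -⟩
    · obtain rfl := label_injective hi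
      have h1 := F.boundary_adj_unique (adj_of_par hw) (adj_of_par hk')
      have h2 := congrArg first h1
      rw [first_top, first_top] at h2
      exact hk.ne h2
    · cases hv
  noncrossing := by
    intro i j p q e e' cs cs' hij hi hj hq
    obtain ⟨w, hw, rfl, -⟩ := par_top_of_word hi
    obtain ⟨z, hz, rfl, -⟩ := par_top_of_word hj
    have hq : first z < i := hq
    have hzj : F.rooting.Anc z (Sum.inl j) := (Rooting.anc_of_par hz).trans (top_anc j)
    have hwi : F.rooting.Anc w (Sum.inl i) := (Rooting.anc_of_par hw).trans (top_anc i)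
    have hfw : first w < i := by
      have := first_lt_of_rank hw (rank_top i)
      rwa [first_top] at this
    -- within a tree, crossings are excluded by the clockwise orders
    by_cases hroot : F.rooting.root z = F.rooting.root (Sum.inl i)
    · have h1 := anc_of_between (anc_first z) hzj hq hij hroot
      rcases h1.total (top_anc i) with h2 | h2
      · refine label_mono (h2.of_par ?_ hw)
        rintro rfl
        rw [first_top] at hq
        exact lt_irrefl _ hq
      · have := first_mono h2
        rw [first_top] at this
        exact absurd this (not_le.2 hq)
    · left
      show first z < first w
      have hsame : ∀ {a b}, F.rooting.Anc z (Sum.inl a) → F.rooting.Anc w (Sum.inl b) →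
          ¬ F.graph.Reachable (Sum.inl a) (Sum.inl b) := by
        intro a b ha hb h
        apply hroot
        rw [Rooting.reachable_iff_root (R := F.rooting)] at h
        rw [ha.root_eq, h, ← hb.root_eq, hwi.root_eq]
      rcases lt_trichotomy (first z) (first w) with h | h | h
      · exact h
      · exfalso
        refine hsame (anc_first z) (anc_first w) ?_
        rw [h]
      · exfalso
        refine hsame (anc_first z) (anc_first w) (SimpleGraph.Reachable.symm ?_)
        exact F.trees_noncrossing _ _ i j h hq hij
          ((anc_first w).reachable.symm.trans hwi.reachable)
          ((anc_first z).reachable.symm.trans hzj.reachable)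
  alternating := by
    classical
    intro j p e cs κ h ho
    obtain ⟨w, hw, rfl, -, rfl⟩ := par_top_of_word h
    have hv : ∀ t < rank (Sum.inl j : Fin n ⊕ F.Internal),
        ∃ v : F.Internal, label (Sum.inr v : Fin n ⊕ F.Internal) = (↑j, t) := by
      intro t ht
      exact F.labelling_word.surj j t (by rwa [size_word])
    rw [List.isChain_cons]
    constructor
    · intro y hy
      rcases of_opened ho with ⟨i, -, rfl, -⟩ | ⟨u, hu, rfl, -⟩
      · rintro rfl
        simp at hy
      · obtain rfl := label_injective hu
        rcases hr : rank (Sum.inl j : Fin n ⊕ F.Internal) with _ | m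
        · rw [hr] at hy
          simp at hy
        · rw [hr, List.range_succ_eq_map] at hy
          simp only [List.map_cons, List.head?_cons, Option.mem_some_iff] at hy
          subst hy
          obtain ⟨v, hv⟩ := hv 0 (by omega)
          have htop : top j = (Sum.inr v : Fin n ⊕ F.Internal) := by
            refine label_injective ?_
            rw [hv, label, first_top, rank_top]
          rw [htop] at hw
          have := blackAt_ne hF hF' hw
          rw [hv, blackAt_label] at this
          simpa using this
    · rw [List.isChain_iff_getElem]
      intro t ht
      simp only [List.length_map, List.length_range] at ht
      simp only [List.getElem_map, List.getElem_range, ne_eq, Option.some_inj]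
      obtain ⟨u, hu⟩ := hv t (by omega)
      obtain ⟨v, hv⟩ := hv (t + 1) (by omega)
      rw [← hu, ← hv]
      refine blackAt_ne hF hF' ?_
      have h1 := parId_label (Sum.inr v : Fin n ⊕ F.Internal)
      rw [hv, parId_succ, ← hu] at h1
      exact Option.map_injective label_injective h1.symm

end GrassmannianForest

/-! ### The forest of a word -/

/-- A finite set whose elements are numbered has a cyclic permutation that follows the numbering
and jumps from the last element back to the first one. -/
theorem exists_cyclic_perm {α : Type*} [Finite α] (f : α → ℕ) (hf : Function.Injective f) :
    ∃ ρ : Equiv.Perm α, (∀ x y, ρ.SameCycle x y) ∧ ∀ x y z, ClockwiseFor ρ x y z →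
      (f x < f y ∧ f y < f z) ∨ (f y < f z ∧ f z < f x) ∨ (f z < f x ∧ f x < f y) := by
  classical
  have := Fintype.ofFinite α
  let _ : LinearOrder α := LinearOrder.lift' f hf
  have hflt : ∀ x y : α, x < y ↔ f x < f y := fun x y => Iff.rfl
  rcases hd : Fintype.card α with _ | d
  · have := Fintype.card_eq_zero_iff.1 hd
    exact ⟨1, fun x => isEmptyElim x, fun x => isEmptyElim x⟩
  · let e : Fin (d + 1) ≃o α := monoEquivOfFin α hd
    have hpow : ∀ (a : ℕ) (x : α), ((e.toEquiv.permCongr (finRotate (d + 1))) ^ a) x =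
        e (e.symm x + Fin.ofNat (d + 1) a) := by
      intro a
      induction a with
      | zero =>
        intro x
        have : Fin.ofNat (d + 1) 0 = 0 := rfl
        rw [this, add_zero]
        simp
      | succ a ih =>
        intro x
        rw [pow_succ', Equiv.Perm.mul_apply, ih]
        have : Fin.ofNat (d + 1) (a + 1) = Fin.ofNat (d + 1) a + 1 := by
          ext
          simp [Fin.val_add, Fin.ofNat]
        rw [this, ← add_assoc]
        simp [Equiv.permCongr_apply]
    refine ⟨e.toEquiv.permCongr (finRotate (d + 1)), fun x y => ?_, fun x y z => ?_⟩
    · refine ⟨((e.symm y - e.symm x : Fin (d + 1)) : ℕ), ?_⟩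
      rw [zpow_natCast, hpow]
      have : Fin.ofNat (d + 1) ((e.symm y - e.symm x : Fin (d + 1)) : ℕ) =
          e.symm y - e.symm x := by
        ext
        exact Nat.mod_eq_of_lt (Fin.is_lt _)
      rw [this, add_sub_cancel, OrderIso.apply_symm_apply]
    · rintro ⟨a, b, ha, hab, hb, rfl, rfl⟩
      rw [Nat.card_eq_fintype_card, hd] at hb
      rw [hpow, hpow]
      obtain ⟨x, rfl⟩ := e.surjective x
      rw [OrderIso.symm_apply_apply]
      simp only [← hflt, OrderIso.lt_iff_lt, Fin.lt_def, Fin.val_add, Fin.ofNat]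
      have hx := x.2
      rw [Nat.mod_eq_of_lt (hab.trans hb), Nat.mod_eq_of_lt hb]
      rcases lt_or_ge ((x : ℕ) + a) (d + 1) with h1 | h1 <;>
      rcases lt_or_ge ((x : ℕ) + b) (d + 1) with h2 | h2
      · rw [Nat.mod_eq_of_lt h1, Nat.mod_eq_of_lt h2]
        omega
      · rw [Nat.mod_eq_of_lt h1, Nat.mod_eq_sub_mod h2, Nat.mod_eq_of_lt (by omega)]
        omega
      · omega
      · rw [Nat.mod_eq_sub_mod h1, Nat.mod_eq_sub_mod h2, Nat.mod_eq_of_lt (by omega),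
          Nat.mod_eq_of_lt (by omega)]
        omega

section Codes

variable {n : ℕ} {c : Fin n → Letter}

namespace Labelling

variable {I : Type*} {G : SimpleGraph (Fin n ⊕ I)} {ℓ : Fin n ⊕ I → ℕ × ℕ}

theorem key_lt_iff (hc : IsCode c) (hℓ : Labelling c G ℓ) (u v : Fin n ⊕ I) :
    (hℓ.rooting hc).key u < (hℓ.rooting hc).key v ↔
      (ℓ u).1 < (ℓ v).1 ∨ (ℓ u).1 = (ℓ v).1 ∧ (ℓ u).2 < (ℓ v).2 := by
  have key : ∀ u v : Fin n ⊕ I, (ℓ u).1 < (ℓ v).1 ∨ (ℓ u).1 = (ℓ v).1 ∧ (ℓ u).2 < (ℓ v).2 →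
      (hℓ.rooting hc).key u < (hℓ.rooting hc).key v := by
    intro u v h
    obtain ⟨i, -, hi⟩ := hℓ.exists_idx u
    exact keyId_lt ⟨i, hi⟩ h
  refine ⟨fun h => ?_, key u v⟩
  by_contra hcon
  rcases eq_or_ne u v with rfl | hne
  · exact lt_irrefl _ h
  · have hne' : ¬ ((ℓ u).1 = (ℓ v).1 ∧ (ℓ u).2 = (ℓ v).2) := fun h' =>
      hne (hℓ.inj (Prod.ext h'.1 h'.2))
    have := key v u (by omega)
    omega

theorem key_injective (hc : IsCode c) (hℓ : Labelling c G ℓ) :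
    Function.Injective (hℓ.rooting hc).key := by
  intro u v h
  by_contra hne
  have h1 := key_lt_iff hc hℓ u v
  have h2 := key_lt_iff hc hℓ v u
  have hne' : ¬ ((ℓ u).1 = (ℓ v).1 ∧ (ℓ u).2 = (ℓ v).2) := fun h' =>
    hne (hℓ.inj (Prod.ext h'.1 h'.2))
  omega

theorem key_inl_lt (hc : IsCode c) (hℓ : Labelling c G ℓ) {i j : Fin n} (h : i < j) :
    (hℓ.rooting hc).key (Sum.inl i) < (hℓ.rooting hc).key (Sum.inl j) := by
  rw [key_lt_iff, hℓ.inl, hℓ.inl]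
  exact Or.inl h

/-- Drawn above the vertices placed on a line in the order of their labels, the edges of the graph
of a word do not cross. -/
theorem edges_noncrossing (hc : IsCode c) (hℓ : Labelling c G ℓ) {a b w z : Fin n ⊕ I}
    (hz : (hℓ.rooting hc).par z = some a) (hw : (hℓ.rooting hc).par w = some b)
    (haw : (hℓ.rooting hc).key a < (hℓ.rooting hc).key w)
    (hwz : (hℓ.rooting hc).key w < (hℓ.rooting hc).key z) :
    (hℓ.rooting hc).key a ≤ (hℓ.rooting hc).key b := by
  rw [← not_lt, key_lt_iff]
  rw [rooting_par] at hz hw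
  rw [key_lt_iff] at haw hwz
  rcases hc.parId_idx hz with h1 | h1 <;> rcases hc.parId_idx hw with h2 | h2
  · obtain ⟨i, hi, -⟩ := hℓ.exists_idx w
    obtain ⟨j, hj, -⟩ := hℓ.exists_idx z
    rw [show ℓ w = (↑i, 0) from Prod.ext hi h2.2, parId_zero] at hw
    rw [show ℓ z = (↑j, 0) from Prod.ext hj h1.2, parId_zero] at hz
    obtain ⟨e, cs, hw⟩ := Letter.parent_eq_some hw
    obtain ⟨e', cs', hz⟩ := Letter.parent_eq_some hz
    have := hc.noncrossing (show i < j from by rw [Fin.lt_def]; omega) hw hz (by omega)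
    omega
  all_goals omega

/-- A vertex placed between a vertex `v` and one of its descendants is a descendant of `v`, unless
its whole tree lies to the right of `v`. -/
theorem anc_or_root_lt (hc : IsCode c) (hℓ : Labelling c G ℓ) {v w z : Fin n ⊕ I}
    (hvz : (hℓ.rooting hc).Anc v z) (hvw : (hℓ.rooting hc).key v < (hℓ.rooting hc).key w)
    (hwz : (hℓ.rooting hc).key w < (hℓ.rooting hc).key z) :
    (hℓ.rooting hc).Anc v w ∨
      (hℓ.rooting hc).key v < (hℓ.rooting hc).key ((hℓ.rooting hc).root w) := by
  set R := hℓ.rooting hc with hR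
  -- some edge between `v` and `z` passes over `w`
  have harc : ∀ w, R.key v < R.key w → R.key w < R.key z → R.Anc v w ∨ ∃ z' a', R.Anc v a' ∧
      R.par z' = some a' ∧ R.key a' < R.key w ∧ R.key w < R.key z' := by
    clear hvw hwz w
    intro w hvw hwz
    induction hvz with
    | refl => omega
    | tail h1 h2 ih =>
      rename_i b z'
      rcases lt_trichotomy (R.key b) (R.key w) with h | h | h
      · exact Or.inr ⟨_, _, h1, h2, h, hwz⟩
      · rw [← key_injective hc hℓ h]
        exact Or.inl h1
      · exact ih h
  induction hk : R.key w using Nat.strong_induction_on generalizing w with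
  | _ k ih =>
    rcases hp : R.par w with _ | b
    · rw [← Rooting.eq_root hp (Rooting.Anc.refl _)]
      exact Or.inr (by omega)
    · have hbw := R.key_lt hp
      rcases lt_trichotomy (R.key v) (R.key b) with h | h | h
      · rcases ih _ (by omega) h (by omega) rfl with h' | h'
        · exact Or.inl (h'.trans (Rooting.anc_of_par hp))
        · rw [(Rooting.anc_of_par hp).root_eq] at h'
          exact Or.inr h'
      · rw [key_injective hc hℓ h]
        exact Or.inl (Rooting.anc_of_par hp)
      · rcases harc w hvw hwz with h' | ⟨z', a', h1, h2, h3, h4⟩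
        · exact Or.inl h'
        · exfalso
          have := edges_noncrossing hc hℓ h2 hp h3 h4
          have h5 := h1.key_le
          rw [← hR] at this
          omega

/-- The boundary vertices below two children of a vertex are in the order of these children. -/
theorem lt_of_siblings (hc : IsCode c) (hℓ : Labelling c G ℓ) {v y z : Fin n ⊕ I} {j k : Fin n}
    (hy : (hℓ.rooting hc).par y = some v) (hz : (hℓ.rooting hc).par z = some v)
    (hyz : (hℓ.rooting hc).key y < (hℓ.rooting hc).key z)
    (hj : (hℓ.rooting hc).Anc y (Sum.inl j)) (hk : (hℓ.rooting hc).Anc z (Sum.inl k)) :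
    j < k := by
  set R := hℓ.rooting hc with hR
  have hne : y ≠ z := by
    rintro rfl
    exact lt_irrefl _ hyz
  rcases lt_trichotomy j k with h | rfl | h
  · exact h
  · exact absurd (Rooting.eq_of_anc_of_par_eq hy hz hj hk) hne
  · exfalso
    have h1 := hk.key_le
    rcases anc_or_root_lt hc hℓ hj (w := Sum.inl k) (by rw [← hR]; omega)
      (key_inl_lt hc hℓ h) with h2 | h2
    · exact hne (Rooting.eq_of_anc_of_par_eq hy hz h2 hk)
    · rw [← hR, ← hk.root_eq, ← (Rooting.anc_of_par hz).root_eq, (Rooting.anc_of_par hy).root_eq]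
        at h2
      have := (Rooting.root_anc (R := R) y).key_le
      omega

/-- The boundary vertices of a tree that are not below `v` do not lie between those below `v`. -/
theorem not_between (hc : IsCode c) (hℓ : Labelling c G ℓ) {v : Fin n ⊕ I} {i j k : Fin n}
    (hj : (hℓ.rooting hc).Anc v (Sum.inl j)) (hk : (hℓ.rooting hc).Anc v (Sum.inl k))
    (hi : ¬ (hℓ.rooting hc).Anc v (Sum.inl i))
    (hr : (hℓ.rooting hc).root v = (hℓ.rooting hc).root (Sum.inl i)) : ¬ (j < i ∧ i < k) := by
  rintro ⟨h1, h2⟩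
  rcases anc_or_root_lt hc hℓ hk (w := Sum.inl i)
    (hj.key_le.trans_lt (key_inl_lt hc hℓ h1)) (key_inl_lt hc hℓ h2) with h | h
  · exact hi h
  · rw [← hr] at h
    exact absurd h (not_lt.2 (Rooting.root_anc _).key_le)

/-- The branches at a vertex, ordered by the labels of its neighbours, lead to boundary vertices in
clockwise order. -/
theorem clockwise_of_lt (hc : IsCode c) (hℓ : Labelling c G ℓ) {v x y z : Fin n ⊕ I}
    {i j k : Fin n} (hxv : G.Adj v x) (hyv : G.Adj v y)
    (hxy : (hℓ.rooting hc).key x < (hℓ.rooting hc).key y)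
    (hyz : (hℓ.rooting hc).key y < (hℓ.rooting hc).key z)
    (hi : Beyond G v x (Sum.inl i)) (hj : Beyond G v y (Sum.inl j))
    (hk : Beyond G v z (Sum.inl k)) : Clockwise i j k := by
  set R := hℓ.rooting hc with hR
  have hpar : ∀ {a b}, G.Adj v a → R.key a < R.key b → R.par v ≠ some b := by
    intro a b ha hab hb
    have h1 := R.key_lt hb
    rcases (R.adj_iff _ _).1 ha with h | h
    · rw [hb] at h
      cases h
      exact lt_irrefl _ hab
    · have := R.key_lt h
      omega
  rcases Rooting.of_beyond (R := R) hj with ⟨hy, hj⟩ | ⟨hy, -⟩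
  swap
  · exact absurd hy (hpar hxv hxy)
  rcases Rooting.of_beyond (R := R) hk with ⟨hz, hk⟩ | ⟨hz, -⟩
  swap
  · exact absurd hz (hpar hyv hyz)
  have hjk := lt_of_siblings hc hℓ hy hz hyz hj hk
  rcases Rooting.of_beyond (R := R) hi with ⟨hx, hi⟩ | ⟨-, hi, hr⟩
  · exact Or.inl ⟨lt_of_siblings hc hℓ hx hy hxy hi hj, hjk⟩
  · have hvj := (Rooting.anc_of_par hy).trans hj
    have hvk := (Rooting.anc_of_par hz).trans hk
    have h1 := not_between hc hℓ hvj hvk hi hr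
    have h2 : i ≠ j := by
      rintro rfl
      exact hi hvj
    have h3 : i ≠ k := by
      rintro rfl
      exact hi hvk
    unfold Clockwise
    omega

theorem trees_noncrossing (hc : IsCode c) (hℓ : Labelling c G ℓ) {a b d e : Fin n} (hab : a < b)
    (hbd : b < d) (hde : d < e) (had : G.Reachable (Sum.inl a) (Sum.inl d))
    (hbe : G.Reachable (Sum.inl b) (Sum.inl e)) : G.Reachable (Sum.inl a) (Sum.inl b) := by
  set R := hℓ.rooting hc with hR
  rw [Rooting.reachable_iff_root (R := R)] at *
  have h1 := Rooting.root_anc (R := R) (Sum.inl a)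
  have h2 := Rooting.root_anc (R := R) (Sum.inl b)
  have h3 := Rooting.root_anc (R := R) (Sum.inl d)
  have h4 := Rooting.root_anc (R := R) (Sum.inl e)
  rw [← had] at h3
  rw [← hbe] at h4
  have ka := Rooting.par_root (R := R) (Sum.inl a)
  have kb := Rooting.par_root (R := R) (Sum.inl b)
  rcases anc_or_root_lt hc hℓ h3 (w := Sum.inl b)
    (h1.key_le.trans_lt (key_inl_lt hc hℓ hab)) (key_inl_lt hc hℓ hbd) with h | h
  · exact Rooting.eq_root ka h
  · rcases anc_or_root_lt hc hℓ h4 (w := Sum.inl d)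
      (h2.key_le.trans_lt (key_inl_lt hc hℓ hbd)) (key_inl_lt hc hℓ hde) with h' | h'
    · rw [had]
      exact (Rooting.eq_root kb h').symm
    · rw [← hR, ← had] at h'
      rw [← hR] at h
      omega

/-- Adjacent internal vertices have different colours. -/
theorem color_ne (hc : IsCode c) (hℓ : Labelling c G ℓ) {u v : I}
    (h : G.Adj (Sum.inr u) (Sum.inr v)) :
    colorId c (ℓ (Sum.inr u)) ≠ colorId c (ℓ (Sum.inr v)) := by
  have key : ∀ u v : I, parId c (ℓ (Sum.inr v)) = some (ℓ (Sum.inr u)) →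
      colorId c (ℓ (Sum.inr u)) ≠ colorId c (ℓ (Sum.inr v)) := by
    intro u v h
    obtain ⟨i, t, ht, hv⟩ := hℓ.inr v
    obtain ⟨i', t', ht', hu⟩ := hℓ.inr u
    rw [hu, hv] at h ⊢
    rw [colorId_mk, colorId_mk]
    cases t with
    | succ t =>
      rw [parId_succ, Option.some_inj, Prod.mk.injEq] at h
      obtain ⟨h1, rfl⟩ := h
      obtain rfl := Fin.ext h1
      rcases hi : c i with b | _ | ⟨p, e, cs⟩ <;> rw [hi] at ht <;> simp [Letter.size] at ht
      obtain ⟨κ, ho⟩ := hc.opened hi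
      have := (List.isChain_cons.1 (hc.alternating hi ho)).2
      rw [List.isChain_iff_getElem] at this
      have := this t (by simpa using ht)
      simp only [Letter.color]
      rw [List.getElem?_eq_getElem ht, List.getElem?_eq_getElem (by omega)]
      simpa using this
    | zero =>
      rw [parId_zero] at h
      obtain ⟨e, cs, hi⟩ := Letter.parent_eq_some h
      obtain ⟨κ, ho⟩ := hc.opened hi
      have := (List.isChain_cons.1 (hc.alternating hi ho)).1
      obtain ⟨j, hj, ho⟩ := ho
      obtain rfl := Fin.ext hj
      have hκ : κ = (c i').color t' := by
        rcases κ with _ | b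
        · rw [(Letter.opens_none.1 ho).1] at ht'
          simp [Letter.size] at ht'
        · exact (Letter.opens_some.1 ho).2.2.symm
      rw [← hκ]
      rw [hi] at ht ⊢
      simp only [Letter.size] at ht
      refine this _ ?_
      simp only [Letter.color]
      rw [List.head?_map, List.head?_eq_getElem?, List.getElem?_eq_getElem ht]
      rfl
  rcases (hℓ.adj _ _).1 h with h | h
  · exact (key _ _ h).symm
  · exact key _ _ h

end Labelling

/-- The internal vertices of the forest of a word. -/
abbrev WordInternal (c : Fin n → Letter) : Type := Σ i : Fin n, Fin (c i).size

/-- The label of a vertex of the forest of a word. -/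
def wordLabel (c : Fin n → Letter) : Fin n ⊕ WordInternal c → ℕ × ℕ
  | Sum.inl i => (↑i, (c i).size)
  | Sum.inr ⟨i, t⟩ => (↑i, ↑t)

/-- The graph of the forest of a word. -/
def wordGraph (hc : IsCode c) : SimpleGraph (Fin n ⊕ WordInternal c) where
  Adj u v := parId c (wordLabel c u) = some (wordLabel c v) ∨
    parId c (wordLabel c v) = some (wordLabel c u)
  symm := ⟨fun _ _ h => h.symm⟩
  loopless := ⟨fun u h => by rcases hc.parId_idx (h.elim id id) with h | h <;> omega⟩

theorem wordLabelling (hc : IsCode c) : Labelling c (wordGraph hc) (wordLabel c) where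
  inj := by
    rintro (i | ⟨i, t⟩) (j | ⟨j, s⟩) h <;> simp only [wordLabel, Prod.mk.injEq] at h
    · rw [Fin.ext h.1]
    · obtain rfl := Fin.ext h.1
      exact absurd h.2 s.2.ne'
    · obtain rfl := Fin.ext h.1
      exact absurd h.2 t.2.ne
    · obtain rfl := Fin.ext h.1
      rw [Fin.ext h.2]
  inl _ := rfl
  inr v := ⟨v.1, v.2, v.2.2, rfl⟩
  surj i t ht := ⟨⟨i, t, ht⟩, rfl⟩
  adj _ _ := Iff.rfl

/-- Rotation at a vertex: the neighbours are ordered by their labels, so that the parent comes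
first and is followed by the children. -/
theorem exists_wordRot (hc : IsCode c) (v : Fin n ⊕ WordInternal c) :
    ∃ ρ : Equiv.Perm ((wordGraph hc).neighborSet v), (∀ x y, ρ.SameCycle x y) ∧
      ∀ x y z, ∀ i j k : Fin n, ClockwiseFor ρ x y z →
        Beyond (wordGraph hc) v x (Sum.inl i) → Beyond (wordGraph hc) v y (Sum.inl j) →
        Beyond (wordGraph hc) v z (Sum.inl k) → Clockwise i j k := by
  have hℓ := wordLabelling hc
  obtain ⟨ρ, h1, h2⟩ := exists_cyclic_perm
    (fun x : (wordGraph hc).neighborSet v => (hℓ.rooting hc).key x.1)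
    (fun x y h => Subtype.ext (Labelling.key_injective hc hℓ h))
  refine ⟨ρ, h1, fun x y z i j k h hi hj hk => ?_⟩
  rcases h2 x y z h with h | h | h
  · exact Labelling.clockwise_of_lt hc hℓ x.2 y.2 h.1 h.2 hi hj hk
  · have := Labelling.clockwise_of_lt hc hℓ y.2 z.2 h.1 h.2 hj hk hi
    unfold Clockwise at *
    omega
  · have := Labelling.clockwise_of_lt hc hℓ z.2 x.2 h.1 h.2 hk hi hj
    unfold Clockwise at *
    omega

open scoped Classical in
/-- The helicity of an internal vertex of the forest of a word. -/
noncomputable def wordHel (hc : IsCode c) (v : WordInternal c) : ℕ :=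
  if colorId c (wordLabel c (Sum.inr v)) = some true then
    ((wordGraph hc).neighborSet (Sum.inr v)).ncard - 1 else 1

/-- The internal vertices are boundary leaves or have degree at least `3`. -/
theorem word_degree_cases (hc : IsCode c) (v : WordInternal c) :
    (∃ b, c v.1 = .single b ∧ ((wordGraph hc).neighborSet (Sum.inr v)).ncard = 1) ∨
      3 ≤ ((wordGraph hc).neighborSet (Sum.inr v)).ncard := by
  have hℓ := wordLabelling hc
  have ht := v.2.2
  rcases hi : c v.1 with b | _ | ⟨p, e, cs⟩
  · exact Or.inl ⟨b, rfl, Labelling.ncard_neighborSet_single hc hℓ rfl hi⟩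
  · replace ht : (v.2 : ℕ) < Letter.start.size := lt_of_lt_of_eq ht (congrArg _ hi)
    simp [Letter.size] at ht
  · right
    rw [Labelling.ncard_neighborSet_join hc hℓ rfl hi]
    obtain ⟨b, hb, -⟩ := Labelling.opened_of_join hi ht
    have := Labelling.users_nonempty hc hb
    omega

/-- The forest described by a word. -/
noncomputable def wordForest (hc : IsCode c) : GrassmannianForest n where
  Internal := WordInternal c
  graph := wordGraph hc
  acyclic := Rooting.isAcyclic ((wordLabelling hc).rooting hc)
  degree_boundary i := Labelling.ncard_neighborSet_inl hc (wordLabelling hc) i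
  degree_ne_two v := by
    rcases word_degree_cases hc v with ⟨b, -, h⟩ | h <;> omega
  reaches_boundary v := ⟨v.1, (Labelling.anc_inl hc (wordLabelling hc) rfl).reachable⟩
  rot v := (exists_wordRot hc v).choose
  rot_cyclic v := (exists_wordRot hc v).choose_spec.1
  branches_clockwise v := (exists_wordRot hc v).choose_spec.2
  trees_noncrossing _ _ _ _ := Labelling.trees_noncrossing hc (wordLabelling hc)
  hel := wordHel hc
  hel_boundaryLeaf v h _ := by
    unfold wordHel
    split_ifs
    · left
      omega
    · exact Or.inr rfl
  hel_internal v h := by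
    have h3 : 3 ≤ ((wordGraph hc).neighborSet (Sum.inr v)).ncard := by
      refine (word_degree_cases hc v).resolve_left ?_
      rintro ⟨b, hb, h1⟩
      refine h ⟨h1, v.1, Or.inr ?_⟩
      have ht := v.2.2
      replace ht : (v.2 : ℕ) < (Letter.single b).size := lt_of_lt_of_eq ht (congrArg _ hb)
      have ht0 : (v.2 : ℕ) = 0 := by simpa [Letter.size] using ht
      have h2 : wordLabel c (Sum.inr v) = (↑v.1, 0) := Prod.ext rfl ht0
      rw [h2]
      simp only [wordLabel, hb, Letter.size]
      rfl
    unfold wordHel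
    split_ifs <;> omega

theorem wordForest_colors (hc : IsCode c) (v : WordInternal c) :
    (colorId c (wordLabel c (Sum.inr v)) = some true → (wordForest hc).Black v) ∧
      (colorId c (wordLabel c (Sum.inr v)) ≠ some true → (wordForest hc).White v) := by
  constructor
  · intro h
    have h1 : (wordForest hc).hel v = ((wordGraph hc).neighborSet (Sum.inr v)).ncard - 1 :=
      if_pos h
    have h2 : (wordForest hc).deg v = ((wordGraph hc).neighborSet (Sum.inr v)).ncard := rfl
    unfold GrassmannianForest.Black
    rw [h1, h2]
    rcases word_degree_cases hc v with ⟨b, -, h⟩ | h <;> omega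
  · intro h
    exact if_neg h

theorem represents_wordForest (hc : IsCode c) : (wordForest hc).Represents c := by
  refine ⟨wordLabel c, wordLabelling hc, fun v => ⟨(wordForest_colors hc v).1, fun h => ?_⟩⟩
  refine (wordForest_colors hc v).2 fun h' => ?_
  have := h.symm.trans h'
  simp at this

theorem isPlabic_wordForest (hc : IsCode c) : (wordForest hc).IsPlabic := by
  intro v
  by_cases h : colorId c (wordLabel c (Sum.inr v)) = some true
  · exact Or.inr ((wordForest_colors hc v).1 h)
  · exact Or.inl ((wordForest_colors hc v).2 h)

theorem isContracted_wordForest (hc : IsCode c) : (wordForest hc).IsContracted := by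
  rintro u v ⟨hadj, h⟩
  refine Labelling.color_ne hc (wordLabelling hc) hadj ?_
  have hex : ∀ w : WordInternal c, ∃ b, colorId c (wordLabel c (Sum.inr w)) = some b := by
    intro w
    obtain ⟨b, hb⟩ := Labelling.color_of_lt w.2.2
    exact ⟨b, by rw [← hb]; exact colorId_mk _ _⟩
  have hblack : ∀ w : WordInternal c, (wordForest hc).Black w →
      colorId c (wordLabel c (Sum.inr w)) = some true := by
    intro w hw
    by_contra h
    exact (wordForest hc).not_white_and_black w ⟨(wordForest_colors hc w).2 h, hw⟩
  have hwhite : ∀ w : WordInternal c, (wordForest hc).White w →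
      colorId c (wordLabel c (Sum.inr w)) = some false := by
    intro w hw
    obtain ⟨b, hb⟩ := hex w
    cases b
    · exact hb
    · exact absurd ⟨hw, (wordForest_colors hc w).1 hb⟩ ((wordForest hc).not_white_and_black w)
  rcases h with ⟨h1, h2⟩ | ⟨h1, h2⟩
  · rw [hwhite u h1, hwhite v h2]
  · rw [hblack u h1, hblack v h2]

end Codes

/-! ### Type and mom-dimension in terms of the word -/

namespace Rooting

variable {V : Type*} {G : SimpleGraph V}

open scoped Classical in
/-- The handshake lemma for one component of a rooted forest. -/
theorem sum_degree (R : Rooting G) [Fintype V] (C : G.ConnectedComponent) :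
    ∑ v with G.connectedComponentMk v = C, (G.neighborSet v).ncard + 2 =
      2 * (Finset.univ.filter fun v => G.connectedComponentMk v = C).card := by
  set S := Finset.univ.filter fun v => G.connectedComponentMk v = C with hS
  have hmem : ∀ {u v}, R.par v = some u → (u ∈ S ↔ v ∈ S) := by
    intro u v h
    simp only [hS, Finset.mem_filter, Finset.mem_univ, true_and]
    rw [SimpleGraph.ConnectedComponent.sound ((R.adj_iff u v).2 (Or.inr h)).reachable]
  have hdeg : ∀ v, (G.neighborSet v).ncard = (if R.par v = none then 0 else 1) +
      ∑ x, if R.par x = some v then 1 else 0 := by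
    intro v
    have h1 : G.neighborSet v = {u | R.par v = some u} ∪ {x | R.par x = some v} := by
      ext u
      exact R.adj_iff v u
    have h2 : {u | R.par v = some u}.ncard = if R.par v = none then 0 else 1 := by
      rcases R.par v with _ | u <;> simp
    rw [h1, Set.ncard_union_eq ?_ (Set.toFinite _) (Set.toFinite _), h2, Finset.sum_boole,
      Set.ncard_eq_toFinset_card']
    · simp
    · rw [Set.disjoint_left]
      intro u h3 h4
      exact absurd (R.key_lt h3) (not_lt.2 (R.key_lt h4).le)
  have hroot : ∃ r ∈ S, ∀ v ∈ S, R.par v = none ↔ v = r := by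
    obtain ⟨w, rfl⟩ := C.exists_rep
    refine ⟨R.root w, ?_, fun v hv => ?_⟩
    · simp only [hS, Finset.mem_filter, Finset.mem_univ, true_and]
      exact SimpleGraph.ConnectedComponent.sound (root_anc w).reachable
    · simp only [hS, Finset.mem_filter, Finset.mem_univ, true_and] at hv
      have hv := (reachable_iff_root (R := R)).1 (SimpleGraph.ConnectedComponent.exact hv)
      constructor
      · intro h
        rw [← hv]
        exact eq_root h (Anc.refl v)
      · rintro rfl
        exact par_root w
  obtain ⟨r, hrS, hr⟩ := hroot
  have hcard : ∑ v ∈ S, (if R.par v = none then 0 else 1) + 1 = S.card := by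
    have : ∀ v ∈ S, (if R.par v = none then 0 else 1) = 1 - if v = r then 1 else 0 := by
      intro v hv
      by_cases h : v = r
      · rw [if_pos ((hr v hv).2 h), if_pos h]
      · rw [if_neg (fun h' => h ((hr v hv).1 h')), if_neg h]
    rw [Finset.sum_congr rfl this, Finset.sum_tsub_distrib _ (fun v _ => by split_ifs <;> simp),
      Finset.sum_ite_eq', if_pos hrS, Finset.sum_const, smul_eq_mul, mul_one]
    have : 0 < S.card := Finset.card_pos.2 ⟨r, hrS⟩
    omega
  have hsum : ∑ v ∈ S, ∑ x, (if R.par x = some v then 1 else 0) =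
      ∑ v ∈ S, (if R.par v = none then 0 else 1) := by
    rw [Finset.sum_comm, ← Finset.sum_subset (Finset.subset_univ S)]
    · refine Finset.sum_congr rfl fun x hx => ?_
      rcases hp : R.par x with _ | u
      · simp
      · simp only [Option.some_inj, reduceCtorEq, if_false]
        rw [Finset.sum_ite_eq, if_pos ((hmem hp).2 hx)]
    · intro x _ hx
      refine Finset.sum_eq_zero fun v hv => if_neg fun h => hx ((hmem h).1 hv)
  rw [Finset.sum_congr rfl fun v _ => hdeg v, Finset.sum_add_distrib, hsum]
  omega

end Rooting

namespace GrassmannianForest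

variable {n : ℕ} {F : GrassmannianForest n}

open scoped Classical in
theorem numBoundary_eq (T : F.graph.ConnectedComponent) :
    F.numBoundary T = (Finset.univ.filter fun i : Fin n =>
      F.graph.connectedComponentMk (Sum.inl i) = T).card := by
  unfold numBoundary
  rw [Set.ncard_eq_toFinset_card']
  simp

open scoped Classical in
/-- The sum of the numbers `deg v - 2` over a tree. -/
theorem sum_deg_sub_two (T : F.graph.ConnectedComponent) :
    ∑ v : F.Internal with F.graph.connectedComponentMk (Sum.inr v) = T, ((F.deg v : ℤ) - 2) =
      F.numBoundary T - 2 := by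
  have h := F.rooting.sum_degree T
  rw [Finset.sum_filter, Fintype.sum_sum_type, Finset.card_filter, Fintype.sum_sum_type] at h
  simp only [F.degree_boundary] at h
  rw [← Finset.card_filter, ← Finset.card_filter, ← numBoundary_eq, ← Finset.sum_filter] at h
  rw [Finset.sum_sub_distrib, Finset.sum_const, nsmul_eq_mul]
  have h2 : (∑ v : F.Internal with F.graph.connectedComponentMk (Sum.inr v) = T, (F.deg v : ℤ)) =
      ((∑ v : F.Internal with F.graph.connectedComponentMk (Sum.inr v) = T,
        (F.graph.neighborSet (Sum.inr v)).ncard : ℕ) : ℤ) := by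
    rw [Nat.cast_sum]
    rfl
  rw [h2]
  omega

open scoped Classical in
/-- A tree of a plabic forest with `b` boundary vertices has mom-dimension `b - 1`. -/
theorem treeMomDim_eq (hF : F.IsPlabic) (T : F.graph.ConnectedComponent) :
    F.treeMomDim T = F.numBoundary T - 1 := by
  unfold treeMomDim
  split_ifs with h
  · rfl
  · have : ∀ v, F.m v - 1 = (F.deg v : ℤ) - 2 := by
      intro v
      unfold m
      rw [if_neg (fun h : F.Generic v => (hF v).elim h.1 h.2)]
      ring
    simp only [this]
    rw [sum_deg_sub_two]
    ring

theorem sum_numBoundary [Fintype F.graph.ConnectedComponent] :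
    ∑ T : F.graph.ConnectedComponent, F.numBoundary T = n := by
  classical
  have := Finset.card_eq_sum_card_fiberwise
    (f := fun i : Fin n => F.graph.connectedComponentMk (Sum.inl i)) (s := Finset.univ)
    (t := Finset.univ) (fun _ _ => Finset.mem_coe.2 (Finset.mem_univ _))
  rw [Finset.card_fin] at this
  refine Eq.trans ?_ this.symm
  refine Finset.sum_congr rfl fun T _ => ?_
  rw [numBoundary_eq]

theorem momDim_eq (hF : F.IsPlabic) :
    F.momDim = n - Nat.card F.graph.ConnectedComponent := by
  classical
  have := Fintype.ofFinite F.graph.ConnectedComponent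
  unfold momDim
  rw [finsum_eq_sum_of_fintype]
  simp only [treeMomDim_eq hF]
  rw [Finset.sum_sub_distrib, Nat.card_eq_fintype_card, ← Nat.cast_sum, sum_numBoundary]
  simp

theorem sum_all_deg_sub_two (F : GrassmannianForest n) :
    ∑ v : F.Internal, ((F.deg v : ℤ) - 2) = n - 2 * Nat.card F.graph.ConnectedComponent := by
  classical
  have := Fintype.ofFinite F.graph.ConnectedComponent
  rw [← Finset.sum_fiberwise Finset.univ
    (fun v : F.Internal => F.graph.connectedComponentMk (Sum.inr v))]
  have h : ∀ T : F.graph.ConnectedComponent,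
      ∑ v : F.Internal with F.graph.connectedComponentMk (Sum.inr v) = T, ((F.deg v : ℤ) - 2) =
        F.numBoundary T - 2 := by
    intro T
    rw [← sum_deg_sub_two T]
  rw [Finset.sum_congr rfl fun T _ => h T, Finset.sum_sub_distrib, Nat.card_eq_fintype_card,
    ← Nat.cast_sum, sum_numBoundary]
  simp [mul_comm]

open scoped Classical in
/-- The helicity of a plabic forest is the number of its trees plus the sum of `deg v - 2` over the
black vertices. -/
theorem helicity_eq (hF : F.IsPlabic) :
    F.helicity = ((Nat.card F.graph.ConnectedComponent +
      ∑ v : F.Internal with F.Black v, ((F.deg v : ℤ) - 2) : ℤ) : ℚ) := by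
  have h1 := F.sum_all_deg_sub_two
  have h2 : ∀ v, (F.hel v : ℚ) - (F.deg v : ℚ) / 2 =
      (if F.Black v then (((F.deg v : ℤ) - 2 : ℤ) : ℚ) else 0) -
        (((F.deg v : ℤ) - 2 : ℤ) : ℚ) / 2 := by
    intro v
    split_ifs with h
    · have h : F.hel v + 1 = F.deg v := h
      rw [← h]
      push_cast
      ring
    · have h : F.hel v = 1 := (hF v).resolve_right h
      rw [h]
      push_cast
      ring
  unfold helicity
  rw [Finset.sum_congr rfl fun v _ => h2 v, Finset.sum_sub_distrib, ← Finset.sum_filter,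
    ← Finset.sum_div, ← Int.cast_sum, ← Int.cast_sum, h1]
  push_cast
  ring

theorem isTree_iff (F : GrassmannianForest n) :
    F.IsTree ↔ Nat.card F.graph.ConnectedComponent = 1 := by
  unfold IsTree
  rw [Nat.card_eq_one_iff_unique, SimpleGraph.connected_iff]
  constructor
  · rintro ⟨h, ⟨v⟩⟩
    exact ⟨h.subsingleton_connectedComponent, ⟨F.graph.connectedComponentMk v⟩⟩
  · rintro ⟨h, ⟨C⟩⟩
    obtain ⟨v, -⟩ := C.exists_rep
    exact ⟨fun u w => SimpleGraph.ConnectedComponent.exact (Subsingleton.elim _ _), ⟨v⟩⟩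

end GrassmannianForest

/-- `l` is a letter of the kind `join`. -/
def Letter.IsJoin (l : Letter) : Prop := l.parent ≠ none

instance : DecidablePred Letter.IsJoin := fun l => inferInstanceAs (Decidable (l.parent ≠ none))

namespace Labelling

variable {n : ℕ} {c : Fin n → Letter} {I : Type*} {G : SimpleGraph (Fin n ⊕ I)}
  {ℓ : Fin n ⊕ I → ℕ × ℕ}

/-- Every component contains exactly one boundary vertex that is not of the kind `join`. -/
theorem card_component (hc : IsCode c) (hℓ : Labelling c G ℓ) :
    Nat.card G.ConnectedComponent = (Finset.univ.filter fun i => ¬ (c i).IsJoin).card := by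
  rw [← Fintype.card_subtype, ← Nat.card_eq_fintype_card]
  symm
  refine Nat.card_congr (Equiv.ofBijective
    (fun i : {i // ¬ (c i).IsJoin} => G.connectedComponentMk (Sum.inl i.1)) ⟨?_, ?_⟩)
  · have key : ∀ i, ¬ (c i).IsJoin →
        ℓ ((hℓ.rooting hc).root (Sum.inl i)) = (↑i, 0) := by
      intro i hi
      obtain ⟨v, hv⟩ := hℓ.exists_eq i (Nat.zero_le _)
      have h1 : (hℓ.rooting hc).par v = none := by
        rw [rooting_par_none, hv, parId_zero]
        exact not_not.1 hi
      rw [← Rooting.eq_root h1 (anc_inl hc hℓ (by rw [hv])), hv]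
    rintro ⟨i, hi⟩ ⟨j, hj⟩ h
    have h := (Rooting.reachable_iff_root (R := hℓ.rooting hc)).1
      (SimpleGraph.ConnectedComponent.exact h)
    have h1 := key i hi
    rw [h, key j hj] at h1
    exact Subtype.ext (Fin.ext (Prod.ext_iff.1 h1).1.symm)
  · intro C
    obtain ⟨w, rfl⟩ := C.exists_rep
    have h1 := Rooting.par_root (R := hℓ.rooting hc) w
    have h2 := Rooting.root_anc (R := hℓ.rooting hc) w
    set r := (hℓ.rooting hc).root w
    rw [rooting_par_none] at h1
    obtain ⟨i, hi, -⟩ := hℓ.exists_idx r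
    refine ⟨⟨i, ?_⟩, ?_⟩
    · unfold Letter.IsJoin
      rw [not_not, ← parId_zero]
      rcases hr : ℓ r with ⟨a, t⟩
      rw [hr] at h1 hi
      dsimp only at hi
      subst hi
      cases t with
      | zero => exact h1
      | succ t => simp at h1
    · exact SimpleGraph.ConnectedComponent.sound
        ((anc_inl hc hℓ hi).reachable.symm.trans h2.reachable)

end Labelling

open scoped Classical in
/-- The contribution of the boundary vertex `i` to the helicity: a tree counts `1`, a black boundary
leaf `-1`, and a letter `join p _ _` counts `1` if `p` is the label of a black vertex. -/
noncomputable def letterHel {n : ℕ} (c : Fin n → Letter) (i : Fin n) : ℕ :=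
  match c i with
  | .single b => if b then 0 else 1
  | .start => 1
  | .join p _ _ => if Opened c p (some true) then 1 else 0

/-- The contribution of the boundary vertex `i` to the mom-dimension. -/
def letterDim {n : ℕ} (c : Fin n → Letter) (i : Fin n) : ℕ := if (c i).IsJoin then 1 else 0

namespace GrassmannianForest

variable {n : ℕ} {F : GrassmannianForest n} {c : Fin n → Letter}

theorem Represents.isPlabic (h : F.Represents c) : F.IsPlabic := by
  obtain ⟨ℓ, hℓ, hcol⟩ := h
  intro v
  obtain ⟨i, t, ht, hv⟩ := hℓ.inr v
  obtain ⟨b, hb⟩ := Labelling.color_of_lt ht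
  have := hcol v
  rw [hv, colorId_mk, hb] at this
  cases b
  · exact Or.inl (this.2 rfl)
  · exact Or.inr (this.1 rfl)

theorem Represents.card_component (hc : IsCode c) (h : F.Represents c) :
    Nat.card F.graph.ConnectedComponent + ∑ i, letterDim c i = n := by
  obtain ⟨ℓ, hℓ, -⟩ := h
  rw [Labelling.card_component hc hℓ]
  unfold letterDim
  rw [← Finset.card_filter, add_comm, Finset.card_filter_add_card_filter_not]
  simp

theorem Represents.momDim_eq (hc : IsCode c) (h : F.Represents c) :
    F.momDim = ∑ i, letterDim c i := by
  rw [GrassmannianForest.momDim_eq h.isPlabic]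
  have := h.card_component hc
  push_cast [← this]
  ring

theorem Represents.isTree_iff (hc : IsCode c) (h : F.Represents c) :
    F.IsTree ↔ ∑ i, letterDim c i + 1 = n := by
  rw [GrassmannianForest.isTree_iff]
  have := h.card_component hc
  omega

theorem Represents.helicity_eq (hc : IsCode c) (h : F.Represents c) :
    F.helicity = ((∑ i, letterHel c i : ℕ) : ℚ) := by
  classical
  rw [GrassmannianForest.helicity_eq h.isPlabic]
  obtain ⟨ℓ, hℓ, hcol⟩ := h
  have hcol' : ∀ v, F.Black v ↔ colorId c (ℓ (Sum.inr v)) = some true := by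
    intro v
    refine ⟨fun hb => ?_, (hcol v).1⟩
    obtain ⟨i, t, ht, hv⟩ := hℓ.inr v
    obtain ⟨b, hb'⟩ := Labelling.color_of_lt ht
    rw [hv, colorId_mk, hb']
    have := hcol v
    rw [hv, colorId_mk, hb'] at this
    cases b
    · exact absurd ⟨this.2 rfl, hb⟩ (F.not_white_and_black v)
    · rfl
  -- `deg v - 2` is the number of letters `join p _ _` for which `p` is the label of `v`, and `-1`
  -- for a boundary leaf, which is opened by a letter `single`;
  -- `B i v` is the contribution of the boundary vertex `i`
  let B : Fin n → F.Internal → ℤ := fun i v =>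
    (if (c i).parent = some (ℓ (Sum.inr v)) then 1 else 0) -
      if ¬ (c i).IsJoin ∧ ℓ (Sum.inr v) = (↑i, 0) then 1 else 0
  have hdeg : ∀ v, (F.deg v : ℤ) - 2 = ∑ i, B i v := by
    intro v
    obtain ⟨i, t, ht, hv⟩ := hℓ.inr v
    have hu : ∑ j, (if (c j).parent = some (ℓ (Sum.inr v)) then (1 : ℤ) else 0) =
        {j | (c j).parent = some (↑i, t)}.ncard := by
      rw [Finset.sum_boole, Set.ncard_eq_toFinset_card', hv]
      simp
    rw [Finset.sum_sub_distrib, hu]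
    rcases hi : c i with b | _ | ⟨p, e, cs⟩
    · have ht0 : t = 0 := by
        rw [hi] at ht
        simpa [Letter.size] using ht
      subst ht0
      have h1 : {j | (c j).parent = some (↑i, 0)} = ∅ := by
        ext j
        simpa using hc.not_pred_opened_single hi
      rw [h1, Finset.sum_eq_single i]
      · unfold deg
        rw [Labelling.ncard_neighborSet_single hc hℓ hv hi]
        simp [hv, hi, Letter.IsJoin, Letter.parent]
      · intro j _ hji
        rw [hv]
        refine if_neg fun h => hji (Fin.ext ?_)
        exact (Prod.ext_iff.1 h.2).1.symm
      · simp
    · rw [hi] at ht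
      simp [Letter.size] at ht
    · rw [Finset.sum_eq_zero, deg, Labelling.ncard_neighborSet_join hc hℓ hv hi]
      · push_cast
        ring
      · intro j _
        rw [hv]
        refine if_neg fun h => h.1 ?_
        have : i = j := Fin.ext (Prod.ext_iff.1 h.2).1
        rw [← this, hi]
        simp [Letter.IsJoin, Letter.parent]
  have hletter : ∀ i, (letterHel c i : ℤ) = (if ¬ (c i).IsJoin then 1 else 0) +
      ∑ v : F.Internal with F.Black v, B i v := by
    intro i
    rw [Finset.sum_filter]
    simp only [hcol', B]
    unfold letterHel
    rcases hi : c i with b | _ | ⟨p, e, cs⟩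
    · obtain ⟨v, hv⟩ := hℓ.surj i 0 (by simp [hi, Letter.size])
      rw [Finset.sum_eq_single v]
      · simp only [hv, colorId_mk, hi, Letter.color, Letter.IsJoin, Letter.parent]
        cases b <;> simp
      · intro w _ hw
        have : ℓ (Sum.inr w) ≠ (↑i, 0) := fun h =>
          hw (Sum.inr.inj (hℓ.inj (h.trans hv.symm)))
        simp [this, Letter.parent]
      · simp
    · rw [Finset.sum_eq_zero]
      · simp [Letter.IsJoin, Letter.parent]
      · intro v _
        obtain ⟨j, t, ht, hv⟩ := hℓ.inr v
        have : ℓ (Sum.inr v) ≠ (↑i, 0) := by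
          intro h
          rw [hv] at h
          have hj : j = i := Fin.ext (Prod.ext_iff.1 h).1
          subst hj
          rw [hi] at ht
          simp [Letter.size] at ht
        simp [this, Letter.parent]
    · simp only [Letter.IsJoin, Letter.parent, ne_eq, reduceCtorEq, not_false_eq_true, not_true,
        if_false, false_and, sub_zero, Option.some_inj, zero_add]
      obtain ⟨κ, ho⟩ := hc.opened hi
      obtain ⟨j, hj, ho'⟩ := id ho
      by_cases hp : Opened c p (some true)
      · rw [if_pos hp]
        obtain ⟨j, hj, ho⟩ := hp
        obtain ⟨-, ht, hcl⟩ := Letter.opens_some.1 ho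
        obtain ⟨v, hv⟩ := hℓ.surj j p.2 ht
        have hpv : p = ℓ (Sum.inr v) := by rw [hv]; exact Prod.ext hj rfl
        rw [Finset.sum_eq_single v]
        · rw [if_pos (by rw [hv, colorId_mk, hcl]), if_pos hpv]
          rfl
        · intro w _ hw
          rw [if_neg (c := p = _)]
          · simp
          · exact fun h => hw (Sum.inr.inj (hℓ.inj (h.symm.trans hpv)))
        · simp
      · rw [if_neg hp, Finset.sum_eq_zero]
        · rfl
        · intro v _
          split_ifs with h1 h2
          · exfalso
            apply hp
            obtain ⟨a, t, ht, hv⟩ := hℓ.inr v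
            rw [hv] at h1 h2
            subst h2
            rw [colorId_mk] at h1
            obtain rfl := Fin.ext hj
            refine ⟨a, rfl, Letter.opens_some.2 ⟨?_, ht, h1⟩⟩
            rcases κ with _ | b
            · rw [(Letter.opens_none.1 ho').1] at ht
              simp [Letter.size] at ht
            · exact (Letter.opens_some.1 ho').1
          · rfl
          · rfl
  rw [Finset.sum_congr rfl fun v _ => hdeg v, Finset.sum_comm, Labelling.card_component hc hℓ,
    Finset.card_filter, Nat.cast_sum, ← Finset.sum_add_distrib, ← Int.cast_natCast, Nat.cast_sum]
  congr 1
  refine Finset.sum_congr rfl fun i _ => ?_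
  rw [hletter]
  push_cast
  rfl

end GrassmannianForest

/-! ### Words as runs of a stack machine -/

/-- The state of the stack machine: the vertices that still await children, with their colours
(`none` for a boundary vertex), the most recent one first. -/
abbrev Stack : Type := List ((ℕ × ℕ) × Option Bool)

/-- The strict lexicographic order on labels. -/
def LabelLT (x y : ℕ × ℕ) : Prop := x.1 < y.1 ∨ x.1 = y.1 ∧ x.2 < y.2

namespace Letter

theorem Opens.unique {l : Letter} {t : ℕ} {κ κ' : Option Bool} (h : l.Opens t κ)
    (h' : l.Opens t κ') : κ = κ' := by
  cases l with
  | single => exact h.elim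
  | start => exact h.2.trans h'.2.symm
  | join p e cs =>
    obtain ⟨b, hb, rfl⟩ := h
    obtain ⟨b', hb', rfl⟩ := h'
    exact hb.symm.trans hb'

/-- The part of the stack created when the boundary vertex `j` carries the given letter. -/
def pushes (j : ℕ) : Letter → Stack
  | single _ => []
  | start => [((j, 0), none)]
  | join _ _ cs => (cs.mapIdx fun t b => ((j, t), some b)).reverse

/-- The part of the old stack that remains after the letter has been read. -/
def rest (st : Stack) : Letter → Stack
  | join _ true _ => st.tail
  | _ => st

/-- The letter may be read when the stack is `st`. -/
def Legal (st : Stack) : Letter → Prop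
  | join p e cs => ∃ κ st', st = (p, κ) :: st' ∧ (κ = none → e = true) ∧
      (κ :: cs.map some).IsChain (· ≠ ·)
  | _ => True

/-- The contribution of a letter, read when the stack is `st`, to the helicity. -/
def hel (st : Stack) : Letter → ℕ
  | single b => if b then 0 else 1
  | start => 1
  | join _ _ _ => if st.head?.map Prod.snd = some (some true) then 1 else 0

/-- The stack after the letter of the boundary vertex `j` has been read. -/
def step (j : ℕ) (st : Stack) (l : Letter) : Stack := l.pushes j ++ l.rest st

theorem mem_pushes {j : ℕ} {l : Letter} {x : ℕ × ℕ} {κ : Option Bool} :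
    (x, κ) ∈ l.pushes j ↔ x.1 = j ∧ l.Opens x.2 κ := by
  obtain ⟨i, t⟩ := x
  cases l with
  | single => simp [pushes, Opens]
  | start => simp [pushes, Opens, and_assoc]
  | join p e cs =>
    simp only [pushes, List.mem_reverse, List.mem_mapIdx, Prod.mk.injEq, Opens,
      List.getElem?_eq_some_iff]
    constructor
    · rintro ⟨s, hs, ⟨rfl, rfl⟩, rfl⟩
      exact ⟨rfl, _, ⟨hs, rfl⟩, rfl⟩
    · rintro ⟨rfl, b, ⟨hs, rfl⟩, rfl⟩
      exact ⟨t, hs, ⟨rfl, rfl⟩, rfl⟩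

theorem pairwise_pushes (j : ℕ) (l : Letter) :
    (l.pushes j).Pairwise fun a b => LabelLT b.1 a.1 := by
  cases l with
  | single => simp [pushes]
  | start => simp [pushes]
  | join p e cs =>
    rw [pushes, List.pairwise_reverse, List.pairwise_iff_getElem]
    intro s t hs ht hst
    simpa [LabelLT] using hst

theorem rest_sublist (st : Stack) (l : Letter) : (l.rest st).Sublist st := by
  rcases l with b | _ | ⟨p, e | e, cs⟩
  · exact List.Sublist.refl _
  · exact List.Sublist.refl _
  · exact List.Sublist.refl _
  · exact List.tail_sublist _

end Letter

section Machine

variable {n : ℕ} {c : Fin n → Letter}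

theorem Opened.unique {x : ℕ × ℕ} {κ κ' : Option Bool} (h : Opened c x κ)
    (h' : Opened c x κ') : κ = κ' := by
  obtain ⟨i, hi, ho⟩ := h
  obtain ⟨i', hi', ho'⟩ := h'
  obtain rfl : i = i' := Fin.ext (hi.symm.trans hi')
  exact ho.unique ho'

/-- The stack before the letter of the boundary vertex `j` is read. -/
def stackAt (c : Fin n → Letter) : ℕ → Stack
  | 0 => []
  | j + 1 => if h : j < n then (c ⟨j, h⟩).step j (stackAt c j) else stackAt c j

theorem stackAt_succ (j : Fin n) :
    stackAt c (j + 1) = (c j).step j (stackAt c j) := by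
  rw [stackAt, dif_pos j.2]

theorem mem_stackAt_succ (j : Fin n) {x : ℕ × ℕ} {κ : Option Bool} :
    (x, κ) ∈ stackAt c (j + 1) ↔
      (x.1 = j ∧ (c j).Opens x.2 κ) ∨ (x, κ) ∈ (c j).rest (stackAt c j) := by
  rw [stackAt_succ, Letter.step, List.mem_append, Letter.mem_pushes]

theorem of_mem_stackAt {j : ℕ} (hj : j ≤ n) {x : ℕ × ℕ} {κ : Option Bool}
    (h : (x, κ) ∈ stackAt c j) : x.1 < j ∧ Opened c x κ := by
  induction j with
  | zero => simp [stackAt] at h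
  | succ j ih =>
    rcases (mem_stackAt_succ ⟨j, hj⟩).1 h with h | h
    · exact ⟨by have := h.1; dsimp only at this; omega, _, h⟩
    · obtain ⟨h1, h2⟩ := ih (by omega) ((Letter.rest_sublist _ _).subset h)
      exact ⟨by omega, h2⟩

/-- The labels on the stack decrease from the top down. -/
theorem pairwise_stackAt {j : ℕ} (hj : j ≤ n) :
    (stackAt c j).Pairwise fun a b => LabelLT b.1 a.1 := by
  induction j with
  | zero => simp [stackAt]
  | succ j ih =>
    have h := stackAt_succ (c := c) ⟨j, hj⟩
    dsimp only at h
    rw [h, Letter.step, List.pairwise_append]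
    refine ⟨Letter.pairwise_pushes _ _, (ih (by omega)).sublist (Letter.rest_sublist _ _), ?_⟩
    rintro ⟨a, κ⟩ ha ⟨b, κ'⟩ hb
    left
    rw [Letter.mem_pushes] at ha
    have := (of_mem_stackAt (by omega) ((Letter.rest_sublist _ _).subset hb)).1
    dsimp only
    omega

/-- A vertex is removed from the stack only by its last child. -/
theorem mem_rest_of_not_join {j : Fin n} {x : ℕ × ℕ} {κ : Option Bool}
    (hl : (c j).Legal (stackAt c j)) (h : ∀ cs, c j ≠ .join x true cs)
    (hx : (x, κ) ∈ stackAt c j) : (x, κ) ∈ (c j).rest (stackAt c j) := by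
  rcases hc : c j with b | _ | ⟨p, e | e, cs⟩
  · exact hx
  · exact hx
  · exact hx
  · rw [hc] at hl
    obtain ⟨κ', st', hst, -⟩ := hl
    rw [hst] at hx ⊢
    rcases List.mem_cons.1 hx with h' | h'
    · cases h'
      exact absurd hc (h cs)
    · exact h'

/-- A word describes a contracted plabic forest exactly if the stack machine can read it. At any
moment the stack then consists of the opened vertices that will receive further children. -/
theorem isCode_iff : IsCode c ↔
    (∀ j, (c j).Legal (stackAt c j)) ∧ stackAt c n = [] := by
  constructor
  · intro hc
    have key : ∀ j ≤ n, (∀ i : Fin n, (i : ℕ) < j → (c i).Legal (stackAt c i)) ∧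
        ∀ x κ, (x, κ) ∈ stackAt c j ↔
          Opened c x κ ∧ x.1 < j ∧ ∃ k : Fin n, j ≤ k ∧ ∃ e cs, c k = .join x e cs := by
      intro j
      induction j with
      | zero =>
        intro _
        refine ⟨fun i hi => absurd hi (Nat.not_lt_zero _), fun x κ => ?_⟩
        simp [stackAt]
      | succ j ih =>
        intro hj
        obtain ⟨ih1, ih2⟩ := ih (by omega)
        have hlegal : (c ⟨j, hj⟩).Legal (stackAt c j) := by
          rcases hl : c ⟨j, hj⟩ with b | _ | ⟨p, e, cs⟩
          · trivial
          · trivial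
          · obtain ⟨κ, ho⟩ := hc.opened hl
            have hmem := (ih2 p κ).2 ⟨ho, hc.lt hl, ⟨j, hj⟩, le_rfl, e, cs, hl⟩
            rcases hst : stackAt c j with _ | ⟨⟨q, κ'⟩, st'⟩
            · rw [hst] at hmem
              exact absurd hmem List.not_mem_nil
            · have hq := (ih2 q κ').1 (hst ▸ List.mem_cons_self)
              have hpq : (p, κ) = (q, κ') := by
                rw [hst] at hmem
                rcases List.mem_cons.1 hmem with h | h
                · exact h
                · have h := List.rel_of_pairwise_cons (hst ▸ pairwise_stackAt (c := c)
                    (by omega : j ≤ n)) h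
                  obtain ⟨-, hqj, k, hk, e', cs', hkq⟩ := hq
                  rcases hk.eq_or_lt with rfl | hk
                  · rw [hl] at hkq
                    cases hkq
                    simp [LabelLT] at h
                  · have h' := hc.noncrossing (i := ⟨j, hj⟩) hk hl hkq hqj
                    simp only [LabelLT] at h
                    omega
              cases hpq
              exact ⟨κ, st', rfl, fun hκ => hc.once hl (hκ ▸ ho), hc.alternating hl ho⟩
        refine ⟨fun i hi => ?_, fun x κ => ?_⟩
        · rcases (Nat.lt_succ_iff.1 hi).lt_or_eq with h | h
          · exact ih1 i h
          · obtain rfl : i = ⟨j, hj⟩ := Fin.ext h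
            exact hlegal
        · rw [mem_stackAt_succ ⟨j, hj⟩]
          constructor
          · rintro (⟨h1, h2⟩ | h)
            · have ho : Opened c x κ := ⟨_, h1, h2⟩
              obtain ⟨k, e, cs, hk⟩ := hc.used ho
              have := hc.lt hk
              dsimp only at h1
              exact ⟨ho, by omega, k, by omega, e, cs, hk⟩
            · obtain ⟨ho, hx, k, hk, e, cs, hkx⟩ :=
                (ih2 x κ).1 ((Letter.rest_sublist _ _).subset h)
              refine ⟨ho, by omega, ?_⟩
              rcases hk.eq_or_lt with rfl | hk
              · by_contra hno
                have he : e = true := (hc.last hkx).2 fun k' e' cs' hk' h' =>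
                  hno ⟨k', hk', e', cs', h'⟩
                subst he
                rw [hkx] at hlegal
                obtain ⟨κ', st', hst, -⟩ := hlegal
                have hp := pairwise_stackAt (c := c) (by omega : (k : ℕ) ≤ n)
                simp only [Fin.eta] at h
                rw [hkx, hst] at h
                rw [hst] at hp
                have := List.rel_of_pairwise_cons hp h
                simp [LabelLT] at this
              · exact ⟨k, hk, e, cs, hkx⟩
          · rintro ⟨ho, hx, k, hk, e, cs, hkx⟩
            rcases (Nat.lt_succ_iff.1 hx).lt_or_eq with h | h
            · right
              refine mem_rest_of_not_join hlegal ?_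
                ((ih2 x κ).2 ⟨ho, h, k, by omega, e, cs, hkx⟩)
              intro cs' h'
              exact (hc.last h').1 rfl k e cs hk hkx
            · left
              obtain ⟨i, hi, ho⟩ := ho
              obtain rfl : i = ⟨j, hj⟩ := Fin.ext (hi.symm.trans h)
              exact ⟨h, ho⟩
    obtain ⟨h1, h2⟩ := key n le_rfl
    refine ⟨fun j => h1 j j.2, List.eq_nil_iff_forall_not_mem.2 ?_⟩
    rintro ⟨x, κ⟩ h
    obtain ⟨-, -, k, hk, -⟩ := (h2 x κ).1 h
    omega
  · rintro ⟨hlegal, hend⟩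
    have top : ∀ {j p e cs}, c j = .join p e cs → ∃ κ st', stackAt c j = (p, κ) :: st' ∧
        Opened c p κ ∧ p.1 < j ∧ (κ = none → e = true) ∧
        (κ :: cs.map some).IsChain (· ≠ ·) := by
      intro j p e cs h
      have hl := hlegal j
      rw [h] at hl
      obtain ⟨κ, st', hst, h1, h2⟩ := hl
      have := of_mem_stackAt (c := c) j.2.le (hst ▸ List.mem_cons_self (a := (p, κ)))
      exact ⟨κ, st', hst, this.2, this.1, h1, h2⟩
    -- a vertex stays on the stack until its last child
    have persist : ∀ {x κ} {j : ℕ}, j ≤ n → (x, κ) ∈ stackAt c j →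
        ∃ k : Fin n, j ≤ k ∧ ∃ e cs, c k = .join x e cs := by
      intro x κ j hj hx
      by_contra hno
      have : ∀ m, j ≤ m → m ≤ n → (x, κ) ∈ stackAt c m := by
        intro m hjm
        induction m, hjm using Nat.le_induction with
        | base => exact fun _ => hx
        | succ m hm ih =>
          intro hmn
          refine (mem_stackAt_succ ⟨m, hmn⟩).2 (Or.inr ?_)
          exact mem_rest_of_not_join (hlegal _)
            (fun cs h => hno ⟨⟨m, hmn⟩, hm, _, cs, h⟩) (ih (by omega))
      have := this n hj le_rfl
      rw [hend] at this
      exact List.not_mem_nil this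
    -- a vertex enters the stack only when it is opened
    have back : ∀ {x κ} {m j : ℕ}, m ≤ j → j ≤ n → x.1 < m → (x, κ) ∈ stackAt c j →
        (x, κ) ∈ stackAt c m := by
      intro x κ m j hmj
      induction j, hmj using Nat.le_induction with
      | base => exact fun _ _ h => h
      | succ j hj ih =>
        intro hjn hx h
        refine ih (by omega) hx ?_
        rcases (mem_stackAt_succ ⟨j, hjn⟩).1 h with h | h
        · have := h.1
          dsimp only at this
          omega
        · exact (Letter.rest_sublist _ _).subset h
    refine ⟨?_, ?_, ?_, ?_, ?_, ?_, ?_⟩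
    · intro j p e cs h
      obtain ⟨κ, st', -, -, h', -⟩ := top h
      exact h'
    · intro j p e cs h
      obtain ⟨κ, st', -, h', -⟩ := top h
      exact ⟨κ, h'⟩
    · rintro x κ ⟨i, hi, ho⟩
      obtain ⟨k, -, e, cs, hk⟩ := persist (j := i + 1) i.2
        ((mem_stackAt_succ i).2 (Or.inl ⟨hi, ho⟩))
      exact ⟨k, e, cs, hk⟩
    · intro j p e cs h
      obtain ⟨κ, st', hst, ho, hpj, -⟩ := top h
      constructor
      · rintro rfl k e' cs' hjk hk
        obtain ⟨κ', st'', hst', -⟩ := top hk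
        have h1 : (p, κ') ∈ stackAt c (j + 1) := back hjk k.2.le (by omega)
          (hst' ▸ List.mem_cons_self)
        rcases (mem_stackAt_succ j).1 h1 with h2 | h2
        · omega
        · have hp := pairwise_stackAt (c := c) j.2.le
          rw [h, hst] at h2
          rw [hst] at hp
          have := List.rel_of_pairwise_cons hp h2
          simp [LabelLT] at this
      · intro hno
        by_contra he
        have h1 : (p, κ) ∈ stackAt c (j + 1) := by
          refine (mem_stackAt_succ j).2 (Or.inr (mem_rest_of_not_join (hlegal j) ?_ ?_))
          · intro cs' h'
            rw [h] at h'
            cases h'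
            exact he rfl
          · rw [hst]
            exact List.mem_cons_self
        obtain ⟨k, hk, e', cs', hkp⟩ := persist j.2 h1
        exact hno k e' cs' hk hkp
    · intro j p e cs h ho
      obtain ⟨κ, st', -, ho', -, h', -⟩ := top h
      exact h' (ho'.unique ho)
    · intro i j p q e e' cs cs' hij hi hj hq
      obtain ⟨κ, st', hst, -⟩ := top hi
      obtain ⟨κ', st'', hst', -⟩ := top hj
      have h1 : (q, κ') ∈ stackAt c i := back (Fin.lt_def.1 hij).le j.2.le hq
        (hst' ▸ List.mem_cons_self)
      have hp := pairwise_stackAt (c := c) i.2.le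
      rw [hst] at h1 hp
      rcases List.mem_cons.1 h1 with h2 | h2
      · cases h2
        exact Or.inr ⟨rfl, le_rfl⟩
      · have := List.rel_of_pairwise_cons hp h2
        simp only [LabelLT] at this
        omega
    · intro j p e cs κ h ho
      obtain ⟨κ', st', -, ho', -, -, h'⟩ := top h
      rwa [ho.unique ho']

end Machine

/-- The stack machine can read the given letters, starting at the boundary vertex `j` with the
stack `st`, and then its stack is empty. -/
def Run (j : ℕ) (st : Stack) : List Letter → Prop
  | [] => st = []
  | l :: w => l.Legal st ∧ Run (j + 1) (l.step j st) w

/-- The sum of the contributions to the helicity of the letters read from the stack `st` on. -/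
def runHel (j : ℕ) (st : Stack) : List Letter → ℕ
  | [] => 0
  | l :: w => l.hel st + runHel (j + 1) (l.step j st) w

section Machine

variable {n : ℕ} {c : Fin n → Letter}

/-- Reading the letters from the boundary vertex `j` on, starting with the stack at this moment. -/
theorem run_drop {j : ℕ} (hj : j ≤ n) :
    (Run j (stackAt c j) ((List.ofFn c).drop j) ↔
      (∀ i : Fin n, j ≤ i → (c i).Legal (stackAt c i)) ∧ stackAt c n = []) ∧
    runHel j (stackAt c j) ((List.ofFn c).drop j) =
      ∑ i : Fin n, if j ≤ i then (c i).hel (stackAt c i) else 0 := by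
  induction hj using Nat.decreasingInduction with
  | self =>
    rw [List.drop_of_length_le (by simp)]
    constructor
    · simp only [Run, iff_and_self]
      intro _ i hi
      omega
    · rw [Finset.sum_eq_zero]
      · rfl
      · intro i _
        rw [if_neg]
        omega
  | of_succ j hj ih =>
    have hs := stackAt_succ (c := c) ⟨j, hj⟩
    dsimp only at hs
    rw [hs] at ih
    rw [List.drop_eq_getElem_cons (by simpa using hj), List.getElem_ofFn, Run, runHel, ih.1, ih.2]
    constructor
    · rw [← and_assoc, and_congr_left_iff]
      intro _
      constructor
      · rintro ⟨h1, h2⟩ i hi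
        rcases hi.eq_or_lt with rfl | hi
        · exact h1
        · exact h2 i hi
      · exact fun h => ⟨h ⟨j, hj⟩ le_rfl, fun i hi => h i (by omega)⟩
    · rw [← Finset.add_sum_erase _ _ (Finset.mem_univ (⟨j, hj⟩ : Fin n)),
        ← Finset.add_sum_erase _ _ (Finset.mem_univ (⟨j, hj⟩ : Fin n)), if_neg (by simp),
        if_pos (by simp), zero_add]
      congr 1
      refine Finset.sum_congr rfl fun i hi => ?_
      have : (i : ℕ) ≠ j := fun h => (Finset.mem_erase.1 hi).1 (Fin.ext h)
      refine if_congr ?_ rfl rfl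
      omega

theorem isCode_iff_run : IsCode c ↔ Run 0 [] (List.ofFn c) := by
  have := (run_drop (c := c) n.zero_le).1
  rw [isCode_iff, ← List.drop_zero (l := List.ofFn c)]
  simpa [stackAt] using this.symm

theorem runHel_ofFn (hc : IsCode c) : runHel 0 [] (List.ofFn c) = ∑ i, letterHel c i := by
  have := (run_drop (c := c) n.zero_le).2
  rw [List.drop_zero, stackAt] at this
  rw [this]
  refine Finset.sum_congr rfl fun i _ => ?_
  rw [if_pos (Nat.zero_le _)]
  unfold letterHel
  have hl := (isCode_iff.1 hc).1 i
  rcases hi : c i with b | _ | ⟨p, e, cs⟩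
  · rfl
  · rfl
  · rw [hi] at hl
    obtain ⟨κ, st', hst, -⟩ := hl
    have ho := (of_mem_stackAt (c := c) i.2.le (hst ▸ List.mem_cons_self (a := (p, κ)))).2
    have : (stackAt c i).head?.map Prod.snd = some (some true) ↔ Opened c p (some true) := by
      rw [hst]
      simp only [List.head?_cons, Option.map_some, Option.some_inj]
      exact ⟨fun h => h ▸ ho, fun h => ho.unique h⟩
    simp only [Letter.hel]
    split_ifs <;> tauto

theorem countP_ofFn : (List.ofFn c).countP (fun l => l.IsJoin) = ∑ i, letterDim c i := by
  unfold letterDim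
  rw [← Finset.card_filter]
  induction n with
  | zero => simp
  | succ n ih =>
    rw [List.ofFn_succ, List.countP_cons, ih, Finset.card_filter, Finset.card_filter,
      Fin.sum_univ_succ, add_comm]
    simp

end Machine

/-! ### Counting runs -/

/-- The lists of at most `m` colours without equal neighbours that do not begin with `κ`. -/
def altLists : ℕ → Option Bool → Finset (List Bool)
  | 0, _ => {[]}
  | m + 1, κ => insert [] ((Finset.univ.filter fun b => κ ≠ some b).biUnion fun b =>
      (altLists m (some b)).image (List.cons b))

theorem mem_altLists {m : ℕ} {κ : Option Bool} {cs : List Bool} :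
    cs ∈ altLists m κ ↔ cs.length ≤ m ∧ (κ :: cs.map some).IsChain (· ≠ ·) := by
  induction m generalizing κ cs with
  | zero =>
    rw [altLists, Finset.mem_singleton, Nat.le_zero, List.length_eq_zero_iff]
    refine ⟨fun h => ⟨h, by simp [h]⟩, And.left⟩
  | succ m ih =>
    rw [altLists, Finset.mem_insert, Finset.mem_biUnion]
    cases cs with
    | nil => simp
    | cons b cs =>
      simp only [reduceCtorEq, Finset.mem_image, false_or, List.length_cons, List.map_cons,
        List.isChain_cons_cons, Nat.add_le_add_iff_right, Finset.mem_filter, Finset.mem_univ,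
        true_and, List.cons.injEq]
      constructor
      · rintro ⟨b', hb', cs', h, rfl, rfl⟩
        exact ⟨(ih.1 h).1, hb', (ih.1 h).2⟩
      · rintro ⟨h1, h2, h3⟩
        exact ⟨b, h2, cs, ih.2 ⟨h1, h3⟩, rfl, rfl⟩

theorem sum_altLists_succ {M : Type*} [AddCommMonoid M] (m : ℕ) (κ : Option Bool)
    (f : List Bool → M) :
    ∑ cs ∈ altLists (m + 1) κ, f cs =
      f [] + ∑ b with κ ≠ some b, ∑ cs ∈ altLists m (some b), f (b :: cs) := by
  rw [altLists, Finset.sum_insert (by simp), Finset.sum_biUnion]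
  · congr 1
    refine Finset.sum_congr rfl fun b _ => ?_
    rw [Finset.sum_image fun _ _ _ _ h => (List.cons.inj h).2]
  · intro b _ b' _ hb
    rw [Function.onFun, Finset.disjoint_left]
    simp only [Finset.mem_image]
    rintro _ ⟨cs, -, rfl⟩ ⟨cs', -, h⟩
    exact hb (List.cons.inj h).1.symm

noncomputable instance : DecidableEq Letter := Classical.decEq _

/-- The letters that may be read when the stack is `st`, with at most `m` new vertices. -/
noncomputable def letters (m : ℕ) : Stack → Finset Letter
  | [] => {.single true, .single false, .start}
  | (p, κ) :: _ => {.single true, .single false, .start} ∪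
      ((altLists m κ).image (.join p true) ∪
        if κ = none then ∅ else (altLists m κ).image (.join p false))

theorem mem_letters {m : ℕ} {st : Stack} {l : Letter} (j : ℕ) (hm : l = .start → 1 ≤ m) :
    l ∈ letters m st ↔ l.Legal st ∧ (l.pushes j).length ≤ m := by
  rcases l with b | _ | ⟨p, e, cs⟩
  · rcases st with _ | ⟨⟨q, κ⟩, st⟩ <;> cases b <;> simp [letters, Letter.Legal, Letter.pushes]
  · have := hm rfl
    rcases st with _ | ⟨⟨q, κ⟩, st⟩ <;> simpa [letters, Letter.Legal, Letter.pushes] using this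
  · rcases st with _ | ⟨⟨q, κ⟩, st⟩
    · simp [letters, Letter.Legal]
    · simp only [letters, Letter.Legal, Letter.pushes, List.length_reverse, List.length_mapIdx,
        Finset.mem_union, Finset.mem_insert, Finset.mem_singleton, reduceCtorEq, false_or,
        Finset.mem_image, Letter.join.injEq, List.cons.injEq, Prod.mk.injEq]
      constructor
      · rintro (⟨cs', h, rfl, rfl, rfl⟩ | h)
        · rw [mem_altLists] at h
          exact ⟨⟨κ, st, ⟨⟨rfl, rfl⟩, rfl⟩, fun _ => rfl, h.2⟩, h.1⟩
        · split_ifs at h with hκ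
          · exact absurd h (Finset.notMem_empty _)
          · obtain ⟨cs', h, h'⟩ := Finset.mem_image.1 h
            cases h'
            rw [mem_altLists] at h
            exact ⟨⟨κ, st, ⟨⟨rfl, rfl⟩, rfl⟩, fun h' => absurd h' hκ, h.2⟩, h.1⟩
      · rintro ⟨⟨κ', st', ⟨⟨rfl, rfl⟩, rfl⟩, he, hch⟩, hlen⟩
        have hmem := mem_altLists.2 ⟨hlen, hch⟩
        cases e
        · right
          rw [if_neg (fun h => Bool.false_ne_true (he h))]
          exact Finset.mem_image_of_mem _ hmem
        · exact Or.inl ⟨cs, hmem, rfl, rfl, rfl⟩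

/-- The words of length `n` that the stack machine can read. After the first letter the stack cannot
be higher than the number `n` of the remaining letters, so finitely many first letters suffice. -/
noncomputable def runs : ℕ → ℕ → Stack → Finset (List Letter)
  | 0, _, st => if st = [] then {[]} else ∅
  | n + 1, j, st => (letters n st).biUnion fun l =>
      (runs n (j + 1) (l.step j st)).image (List.cons l)

/-- Every letter removes at most one entry from the stack. -/
theorem Run.length_le {j : ℕ} {st : Stack} {w : List Letter} (h : Run j st w) :
    st.length ≤ w.length := by
  induction w generalizing j st with
  | nil => exact (congrArg List.length h).le
  | cons l w ih =>
    have h1 := ih h.2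
    have h2 : st.length ≤ (l.step j st).length + 1 := by
      rw [Letter.step, List.length_append]
      rcases l with b | _ | ⟨p, e | e, cs⟩ <;> simp only [Letter.rest, List.length_tail] <;> omega
    rw [List.length_cons]
    omega

theorem mem_runs {n j : ℕ} {st : Stack} {w : List Letter} :
    w ∈ runs n j st ↔ w.length = n ∧ Run j st w := by
  induction n generalizing j st w with
  | zero =>
    rw [runs, List.length_eq_zero_iff]
    split_ifs with h
    · simp only [Finset.mem_singleton, iff_self_and]
      rintro rfl
      exact h
    · simp only [Finset.notMem_empty, false_iff, not_and]
      rintro rfl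
      exact h
  | succ n ih =>
    rw [runs, Finset.mem_biUnion]
    simp only [Finset.mem_image]
    have hstart : ∀ {l : Letter} {w}, w ∈ runs n (j + 1) (l.step j st) →
        (l.pushes j).length ≤ n := by
      intro l w hw
      have h := ih.1 hw
      have := h.2.length_le
      rw [Letter.step, List.length_append] at this
      omega
    constructor
    · rintro ⟨l, hl, w, hw, rfl⟩
      have h := ih.1 hw
      rw [mem_letters j] at hl
      · exact ⟨by rw [List.length_cons, h.1], hl.1, h.2⟩
      · rintro rfl
        exact hstart hw
    · rintro ⟨hlen, h⟩
      cases w with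
      | nil => simp at hlen
      | cons l w =>
        have hw := ih.2 ⟨by simpa using hlen, h.2⟩
        refine ⟨l, (mem_letters j ?_).2 ⟨h.1, hstart hw⟩, w, hw, rfl⟩
        rintro rfl
        exact hstart hw

section Sums

variable {M : Type*} [AddCommMonoid M]

theorem sum_runs_succ (n j : ℕ) (st : Stack) (f : List Letter → M) :
    ∑ w ∈ runs (n + 1) j st, f w =
      ∑ l ∈ letters n st, ∑ w ∈ runs n (j + 1) (l.step j st), f (l :: w) := by
  rw [runs, Finset.sum_biUnion]
  · refine Finset.sum_congr rfl fun b _ => ?_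
    rw [Finset.sum_image fun _ _ _ _ h => (List.cons.inj h).2]
  · intro b _ b' _ hb
    rw [Function.onFun, Finset.disjoint_left]
    simp only [Finset.mem_image]
    rintro _ ⟨cs, -, rfl⟩ ⟨cs', -, h⟩
    exact hb (List.cons.inj h).1.symm

theorem sum_letters_nil (m : ℕ) (f : Letter → M) :
    ∑ l ∈ letters m [], f l = f (.single true) + f (.single false) + f .start := by
  classical
  rw [letters, Finset.sum_insert (by simp), Finset.sum_insert (by simp), Finset.sum_singleton,
    add_assoc]

theorem sum_letters_cons (m : ℕ) (p : ℕ × ℕ) (κ : Option Bool) (st : Stack) (f : Letter → M) :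
    ∑ l ∈ letters m ((p, κ) :: st), f l = f (.single true) + f (.single false) + f .start +
      (∑ cs ∈ altLists m κ, f (.join p true cs) +
        if κ = none then 0 else ∑ cs ∈ altLists m κ, f (.join p false cs)) := by
  classical
  rw [letters, Finset.sum_union, ← letters.eq_1 m, sum_letters_nil, Finset.sum_union,
    Finset.sum_image]
  · congr 2
    split_ifs
    · simp
    · rw [Finset.sum_image]
      intro _ _ _ _ h
      exact (Letter.join.inj h).2.2
  · intro _ _ _ _ h
    exact (Letter.join.inj h).2.2
  · split_ifs
    · simp
    · rw [Finset.disjoint_left]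
      simp only [Finset.mem_image]
      rintro _ ⟨cs, -, rfl⟩ ⟨cs', -, h⟩
      simp at h
  · rw [Finset.disjoint_left]
    intro l hl h
    have h1 : l.IsJoin := by
      rw [Finset.mem_union] at h
      rcases h with h | h
      · obtain ⟨cs, -, rfl⟩ := Finset.mem_image.1 h
        simp [Letter.IsJoin, Letter.parent]
      · split_ifs at h
        · exact absurd h (Finset.notMem_empty _)
        · obtain ⟨cs, -, rfl⟩ := Finset.mem_image.1 h
          simp [Letter.IsJoin, Letter.parent]
    simp only [Finset.mem_insert, Finset.mem_singleton] at hl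
    rcases hl with rfl | rfl | rfl <;> simp [Letter.IsJoin, Letter.parent] at h1

end Sums

section Weights

variable {K : Type*} [CommRing K] (u y q : K)

/-- The weight of a word: `u` for each tree, `y` for the helicity and `q` for the mom-dimension. -/
def runWeight (j : ℕ) (st : Stack) (w : List Letter) : K :=
  u ^ w.countP (fun l => ¬ l.IsJoin) * y ^ runHel j st w * q ^ w.countP (fun l => l.IsJoin)

theorem runWeight_nil (j : ℕ) (st : Stack) : runWeight u y q j st [] = 1 := by
  simp [runWeight, runHel]

theorem runWeight_single (j : ℕ) (st : Stack) (b : Bool) (w : List Letter) :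
    runWeight u y q j st (.single b :: w) =
      u * (if b then 1 else y) * runWeight u y q (j + 1) st w := by
  cases b <;>
    simp [runWeight, runHel, Letter.IsJoin, Letter.parent, Letter.hel, Letter.step,
      Letter.pushes, Letter.rest, pow_add] <;> ring

theorem runWeight_start (j : ℕ) (st : Stack) (w : List Letter) :
    runWeight u y q j st (.start :: w) =
      u * y * runWeight u y q (j + 1) (((j, 0), none) :: st) w := by
  simp [runWeight, runHel, Letter.IsJoin, Letter.parent, Letter.hel, Letter.step,
      Letter.pushes, Letter.rest, pow_add]
  ring

theorem runWeight_join (j : ℕ) (p : ℕ × ℕ) (κ : Option Bool) (st : Stack) (e : Bool)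
    (cs : List Bool) (w : List Letter) :
    runWeight u y q j ((p, κ) :: st) (.join p e cs :: w) =
      q * (if κ = some true then y else 1) *
        runWeight u y q (j + 1) ((Letter.join p e cs).step j ((p, κ) :: st)) w := by
  simp only [runWeight, runHel, Letter.IsJoin, Letter.parent, Letter.hel, List.countP_cons,
    List.head?_cons, Option.map_some, Option.some_inj, pow_add]
  split_ifs <;> simp_all <;> ring

variable {u y q}

/-- The product of the generating functions attached to the entries of a stack. -/
noncomputable def stackProd (R : Option Bool → K⟦X⟧) (st : Stack) : K⟦X⟧ :=
  (st.map fun a => R a.2).prod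

theorem stackProd_cons (R : Option Bool → K⟦X⟧) (a : (ℕ × ℕ) × Option Bool) (st : Stack) :
    stackProd R (a :: st) = R a.2 * stackProd R st := by
  simp [stackProd]

theorem stackProd_step_join (R : Option Bool → K⟦X⟧) (j : ℕ) (p : ℕ × ℕ) (e : Bool)
    (cs : List Bool) (st : Stack) :
    stackProd R ((Letter.join p e cs).step j st) =
      (cs.map fun b => R (some b)).prod * stackProd R (if e then st.tail else st) := by
  have h : ((Letter.join p e cs).pushes j).map (fun a => R a.2) =
      (cs.map fun b => R (some b)).reverse := by
    rw [Letter.pushes, List.map_reverse]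
    congr 1
    apply List.ext_getElem <;> simp
  rw [stackProd, Letter.step, List.map_append, List.prod_append, h, List.prod_reverse]
  cases e <;> rfl

/-- The generating functions of runs: `F` for the runs starting with an empty stack, `R κ` for the
factor due to an entry `κ` of the stack, and `A κ` for the lists of new vertices below a vertex
`κ`. The equation for `F` expresses that the first letter starts a tree, and that for `R κ` that
the first letter adding a child below `κ` does or does not add the last one; a boundary vertex has
only one child. -/
structure RunSeries (u y q : K) (F : K⟦X⟧) (R A : Option Bool → K⟦X⟧) : Prop where
  eq_F : F = 1 + X * C u * (1 + C y) * F + X * C u * C y * (F * R none)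
  eq_R : ∀ κ, R κ = X * (C q * C (if κ = some true then y else 1) * F * A κ *
    (1 + if κ = none then 0 else R κ))
  eq_A : ∀ κ, A κ = 1 + ∑ b with κ ≠ some b, R (some b) * A (some b)

variable {F : K⟦X⟧} {R A : Option Bool → K⟦X⟧}

/-- Up to a high power of `X`, it suffices to consider short lists of new vertices. -/
theorem RunSeries.dvd (h : RunSeries u y q F R A) (m : ℕ) (κ : Option Bool) :
    X ^ (m + 1) ∣ A κ - ∑ cs ∈ altLists m κ, (cs.map fun b => R (some b)).prod := by
  induction m generalizing κ with
  | zero =>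
    rw [altLists, Finset.sum_singleton, List.map_nil, List.prod_nil, h.eq_A, add_sub_cancel_left,
      zero_add, pow_one]
    refine Finset.dvd_sum fun b _ => Dvd.dvd.mul_right ?_ _
    rw [h.eq_R]
    exact dvd_mul_right _ _
  | succ m ih =>
    rw [h.eq_A, sum_altLists_succ, List.map_nil, List.prod_nil, add_sub_add_left_eq_sub,
      ← Finset.sum_sub_distrib]
    refine Finset.dvd_sum fun b _ => ?_
    simp only [List.map_cons, List.prod_cons]
    rw [← Finset.mul_sum, ← mul_sub, pow_succ']
    refine mul_dvd_mul ?_ (ih _)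
    rw [h.eq_R]
    exact dvd_mul_right _ _

theorem RunSeries.coeff_sum (h : RunSeries u y q F R A) (n : ℕ) (κ : Option Bool) (P : K⟦X⟧) :
    ∑ cs ∈ altLists n κ, coeff n (F * ((cs.map fun b => R (some b)).prod * P)) =
      coeff n (F * (A κ * P)) := by
  have h1 : X ^ (n + 1) ∣ F * (A κ * P) -
      ∑ cs ∈ altLists n κ, F * ((cs.map fun b => R (some b)).prod * P) := by
    rw [← Finset.mul_sum, ← Finset.sum_mul, ← mul_sub, ← sub_mul]
    exact Dvd.dvd.mul_left (Dvd.dvd.mul_right (h.dvd n κ) _) _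
  have h2 := (X_pow_dvd_iff.1 h1) n (Nat.lt_succ_self n)
  rw [map_sub, sub_eq_zero, map_sum] at h2
  exact h2.symm

/-- The generating function of the runs starting with a given stack is multiplicative in the
entries of the stack. -/
theorem RunSeries.sum_runWeight (h : RunSeries u y q F R A) (n j : ℕ) (st : Stack) :
    ∑ w ∈ runs n j st, runWeight u y q j st w = coeff n (F * stackProd R st) := by
  induction n generalizing j st with
  | zero =>
    have hF : constantCoeff F = 1 := by
      rw [h.eq_F]
      simp
    cases st with
    | nil => simp [runs, runWeight_nil, stackProd, hF]
    | cons a st =>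
      rw [stackProd_cons, h.eq_R, runs, if_neg (by simp)]
      simp
  | succ n ih =>
    rw [sum_runs_succ]
    cases st with
    | nil =>
      have hs : F * stackProd R [] = 1 + X * (C u * (1 + C y) * F + C u * C y * (F * R none)) := by
        conv_lhs => rw [h.eq_F]
        simp only [stackProd, List.map_nil, List.prod_nil]
        ring
      rw [hs, map_add, coeff_succ_X_mul, coeff_one, if_neg (by simp), sum_letters_nil]
      simp only [runWeight_single, runWeight_start, Letter.step, Letter.pushes, Letter.rest,
        List.nil_append, List.cons_append, ← Finset.mul_sum, ih]
      simp only [stackProd, List.map_nil, List.prod_nil, List.map_cons, mul_one, map_add,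
        mul_assoc, coeff_C_mul, mul_add, add_mul]
      simp
    | cons a st =>
      obtain ⟨p, κ⟩ := a
      have hs : F * stackProd R ((p, κ) :: st) =
          X * (C q * (C (if κ = some true then y else 1) * (F * (A κ * stackProd R st))) +
            C q * (C (if κ = some true then y else 1) *
              (F * (A κ * ((if κ = none then 0 else R κ) * stackProd R st)))) +
            C u * (F * stackProd R ((p, κ) :: st)) +
            C u * (C y * (F * stackProd R ((p, κ) :: st))) +
            C u * (C y * (F * (R none * stackProd R ((p, κ) :: st))))) := by
        have h1 := h.eq_F
        have h2 := h.eq_R κ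
        rw [stackProd_cons]
        dsimp only
        linear_combination (R κ * stackProd R st) * h1 + stackProd R st * h2
      rw [hs, coeff_succ_X_mul, sum_letters_cons]
      simp only [runWeight_single, runWeight_start, runWeight_join,
        Letter.step.eq_1 j ((p, κ) :: st) (.single _), Letter.step.eq_1 j ((p, κ) :: st) .start,
        Letter.pushes, Letter.rest,
        List.nil_append, List.cons_append, ← Finset.mul_sum, ih, stackProd_step_join,
        List.tail_cons, if_true, h.coeff_sum, Bool.false_eq_true, if_false, map_add, coeff_C_mul]
      rw [stackProd_cons R ((j, 0), none)]
      split_ifs <;> simp [stackProd_cons] <;> ring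

end Weights

/-! ### Isotopy classes of forests and words -/

namespace GrassmannianForest

variable {n : ℕ} {F F' : GrassmannianForest n} {c c' : Fin n → Letter}

theorem Represents.of_equivalent (h : F.Equivalent F') (hF : F.Represents c) :
    F'.Represents c := by
  obtain ⟨φ, hb, hh, -⟩ := h
  obtain ⟨ℓ, hℓ, hcol⟩ := hF
  have hinv : ∀ i, φ.symm (Sum.inl i) = Sum.inl i := fun i => by
    rw [← hb i, RelIso.symm_apply_apply]
  have hinr : ∀ v, ∃ w, φ.symm (Sum.inr v) = Sum.inr w := by
    intro v
    rcases h : φ.symm (Sum.inr v) with i | w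
    · have := congrArg φ h
      rw [RelIso.apply_symm_apply, hb] at this
      cases this
    · exact ⟨w, rfl⟩
  have hhel : ∀ {v w}, φ.symm (Sum.inr v) = Sum.inr w →
      F'.hel v = F.hel w ∧ F'.deg v = F.deg w := by
    intro v w h
    have h' : φ (Sum.inr w) = Sum.inr v := by rw [← h, RelIso.apply_symm_apply]
    refine ⟨hh w v h', ?_⟩
    unfold deg
    rw [← h', ← Nat.card_coe_set_eq, ← Nat.card_coe_set_eq]
    exact (Nat.card_congr (φ.mapNeighborSet _)).symm
  refine ⟨ℓ ∘ φ.symm, ⟨hℓ.inj.comp φ.symm.injective, fun i => ?_, fun v => ?_, fun i t ht => ?_,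
    fun u v => ?_⟩, fun v => ?_⟩
  · rw [Function.comp_apply, hinv, hℓ.inl]
  · obtain ⟨w, hw⟩ := hinr v
    rw [Function.comp_apply, hw]
    exact hℓ.inr w
  · obtain ⟨w, hw⟩ := hℓ.surj i t ht
    rcases hv : φ (Sum.inr w) with j | v
    · have := congrArg φ.symm hv
      rw [RelIso.symm_apply_apply, hinv] at this
      cases this
    · refine ⟨v, ?_⟩
      rw [Function.comp_apply, ← hv, RelIso.symm_apply_apply, hw]
  · rw [← φ.symm.map_adj_iff]
    exact hℓ.adj _ _
  · obtain ⟨w, hw⟩ := hinr v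
    rw [Function.comp_apply, hw]
    unfold Black White
    rw [(hhel hw).1, (hhel hw).2]
    exact hcol w

theorem mk_wordForest_eq_iff (hc : IsCode c) :
    Quotient.mk (setoid n) F = Quotient.mk (setoid n) (wordForest hc) ↔ F.Represents c := by
  rw [Quotient.eq]
  exact ⟨fun h => (represents_wordForest hc).of_equivalent (Equivalent.symm h),
    fun h => h.equivalent (represents_wordForest hc)⟩

/-- The isotopy classes of the forests described by the words in `S` are counted by these words. -/
theorem card_classes (S : Set (Fin n → Letter)) (hS : S.Finite) (hSc : ∀ c ∈ S, IsCode c)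
    (Q : Set (Quotient (setoid n)))
    (hQ : ∀ C, C ∈ Q ↔ ∃ c, ∃ h : c ∈ S, Quotient.mk (setoid n) (wordForest (hSc c h)) = C) :
    Q.Finite ∧ Q.ncard = S.ncard := by
  let f : S → Q := fun c => ⟨Quotient.mk (setoid n) (wordForest (hSc c.1 c.2)),
    (hQ _).2 ⟨c.1, c.2, rfl⟩⟩
  have hf : Function.Bijective f := by
    constructor
    · rintro ⟨c, hc⟩ ⟨c', hc'⟩ h
      have h := (mk_wordForest_eq_iff (hSc c' hc')).1 (Subtype.ext_iff.1 h)
      exact Subtype.ext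
        ((represents_wordForest (hSc c hc)).unique h (hSc c hc) (hSc c' hc'))
    · rintro ⟨C, hC⟩
      obtain ⟨c, hc, rfl⟩ := (hQ C).1 hC
      exact ⟨⟨c, hc⟩, rfl⟩
  have := hS.to_subtype
  refine ⟨Set.finite_coe_iff.1 (Finite.of_surjective f hf.2), ?_⟩
  rw [← Nat.card_coe_set_eq, ← Nat.card_coe_set_eq]
  exact (Nat.card_congr (Equiv.ofBijective f hf)).symm

theorem exists_code (hF : F.IsPlabic) (hF' : F.IsContracted) : ∃ c, ∃ hc : IsCode c,
    Quotient.mk (setoid n) (wordForest hc) = Quotient.mk (setoid n) F ∧ F.Represents c := by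
  have h := represents_word hF
  have hc := isCode_word hF hF'
  exact ⟨F.word, hc, ((mk_wordForest_eq_iff hc).2 h).symm, h⟩

/-- The words describing contracted plabic forests are the runs of the stack machine. -/
theorem code_card (P : List Letter → Prop) [DecidablePred P] :
    {c : Fin n → Letter | IsCode c ∧ P (List.ofFn c)}.Finite ∧
      {c : Fin n → Letter | IsCode c ∧ P (List.ofFn c)}.ncard = ((runs n 0 []).filter P).card := by
  have himg : List.ofFn '' {c : Fin n → Letter | IsCode c ∧ P (List.ofFn c)} =
      ((runs n 0 []).filter P : Set (List Letter)) := by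
    ext w
    simp only [Set.mem_image, Set.mem_ofPred_eq, Finset.coe_filter, mem_runs]
    constructor
    · rintro ⟨c, ⟨h1, h2⟩, rfl⟩
      exact ⟨⟨List.length_ofFn, isCode_iff_run.1 h1⟩, h2⟩
    · rintro ⟨⟨rfl, h1⟩, h2⟩
      refine ⟨w.get, ⟨isCode_iff_run.2 ?_, ?_⟩, List.ofFn_get w⟩ <;> rwa [List.ofFn_get]
  have hinj : Function.Injective (List.ofFn : (Fin n → Letter) → List Letter) :=
    List.ofFn_injective
  constructor
  · refine Set.Finite.of_finite_image ?_ hinj.injOn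
    rw [himg]
    exact Finset.finite_toSet _
  · rw [← Set.ncard_image_of_injective _ hinj, himg, Set.ncard_coe_finset]

theorem card_contractedPlabicForests (n k r : ℕ) :
    (contractedPlabicForests n k r).Finite ∧ (contractedPlabicForests n k r).ncard =
      ((runs n 0 []).filter fun w =>
        runHel 0 [] w = k ∧ w.countP (fun l => l.IsJoin) = r).card := by
  obtain ⟨h1, h2⟩ := code_card (n := n)
    fun w => runHel 0 [] w = k ∧ w.countP (fun l => l.IsJoin) = r
  rw [← h2]
  refine card_classes _ h1 (fun c h => h.1) _ fun C => ⟨?_, ?_⟩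
  · rintro ⟨F, rfl, hF, hF', hk, hr⟩
    obtain ⟨c, hc, h, hrep⟩ := exists_code hF hF'
    refine ⟨c, ⟨hc, ?_, ?_⟩, h⟩
    · rw [runHel_ofFn hc]
      rw [hrep.helicity_eq hc] at hk
      exact_mod_cast hk
    · rw [countP_ofFn]
      rw [hrep.momDim_eq hc] at hr
      exact_mod_cast hr
  · rintro ⟨c, ⟨hc, hk, hr⟩, rfl⟩
    have hrep := represents_wordForest hc
    refine ⟨_, rfl, isPlabic_wordForest hc, isContracted_wordForest hc, ?_, ?_⟩
    · rw [hrep.helicity_eq hc, ← runHel_ofFn hc, hk]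
    · rw [hrep.momDim_eq hc, ← hr, countP_ofFn]

theorem card_contractedPlabicTrees (n k r : ℕ) :
    (contractedPlabicTrees n k r).Finite ∧ (contractedPlabicTrees n k r).ncard =
      ((runs n 0 []).filter fun w => w.countP (fun l => l.IsJoin) + 1 = n ∧
        runHel 0 [] w = k ∧ w.countP (fun l => l.IsJoin) = r).card := by
  obtain ⟨h1, h2⟩ := code_card (n := n)
    fun w => w.countP (fun l => l.IsJoin) + 1 = n ∧
      runHel 0 [] w = k ∧ w.countP (fun l => l.IsJoin) = r
  rw [← h2]
  refine card_classes _ h1 (fun c h => h.1) _ fun C => ⟨?_, ?_⟩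
  · rintro ⟨F, rfl, hT, hF, hF', hk, hr⟩
    obtain ⟨c, hc, h, hrep⟩ := exists_code hF hF'
    refine ⟨c, ⟨hc, ?_, ?_, ?_⟩, h⟩
    · rw [countP_ofFn]
      exact (hrep.isTree_iff hc).1 hT
    · rw [runHel_ofFn hc]
      rw [hrep.helicity_eq hc] at hk
      exact_mod_cast hk
    · rw [countP_ofFn]
      rw [hrep.momDim_eq hc] at hr
      exact_mod_cast hr
  · rintro ⟨c, ⟨hc, hT, hk, hr⟩, rfl⟩
    have hrep := represents_wordForest hc
    refine ⟨_, rfl, (hrep.isTree_iff hc).2 ?_, isPlabic_wordForest hc,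
      isContracted_wordForest hc, ?_, ?_⟩
    · rwa [← countP_ofFn]
    · rw [hrep.helicity_eq hc, ← runHel_ofFn hc, hk]
    · rw [hrep.momDim_eq hc, ← hr, countP_ofFn]

end GrassmannianForest

/-! ### Sums over runs and coefficients -/

section Coefficients

variable {K : Type*} [CommRing K]

/-- For `u = 0` only the words continuing the given trees have nonzero weight. -/
theorem runWeight_zero (y q : K) {n j : ℕ} {st : Stack} {w : List Letter}
    (hw : w ∈ runs n j st) : runWeight 0 y q j st w =
      if w.countP (fun l => l.IsJoin) = n then runWeight 1 y q j st w else 0 := by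
  have h := List.length_eq_countP_add_countP (fun l : Letter => decide l.IsJoin) (l := w)
  rw [(mem_runs.1 hw).1] at h
  have h' : w.countP (fun l => decide (¬ l.IsJoin)) =
      w.countP (fun a => decide ¬ (fun l : Letter => decide l.IsJoin) a = true) := by
    congr 1
    funext l
    simp
  rw [← h'] at h
  unfold runWeight
  split_ifs with h1
  · rw [show w.countP (fun l => decide (¬ l.IsJoin)) = 0 by omega]
    simp
  · rw [zero_pow (by omega), zero_mul, zero_mul]

/-- The words describing trees consist of a letter starting the tree and of letters continuing
it. -/
theorem RunSeries.sum_trees {y q : K} {F : K⟦X⟧} {R A : Option Bool → K⟦X⟧}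
    (h : RunSeries 0 y q F R A) (n : ℕ) :
    ∑ w ∈ (runs (n + 1) 0 []).filter (fun w => w.countP (fun l => l.IsJoin) = n),
      runWeight 1 y q 0 [] w = coeff n (1 + C y + C y * R none) := by
  have hF : F = 1 := by
    rw [h.eq_F]
    simp
  rw [Finset.sum_filter, sum_runs_succ, sum_letters_nil]
  have h1 : ∀ l : Letter, ¬ l.IsJoin → ∀ a : K,
      (∀ w, runWeight 1 y q 0 [] (l :: w) = a * runWeight 1 y q 1 (l.step 0 []) w) →
      ∑ w ∈ runs n (0 + 1) (l.step 0 []),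
        (if (l :: w).countP (fun l => l.IsJoin) = n then runWeight 1 y q 0 [] (l :: w) else 0) =
      a * coeff n (stackProd R (l.step 0 [])) := by
    intro l hl a ha
    rw [← one_mul (stackProd R _), ← hF, ← h.sum_runWeight n (0 + 1), Finset.mul_sum]
    refine Finset.sum_congr rfl fun w hw => ?_
    rw [runWeight_zero y q hw, List.countP_cons_of_neg (by simpa using hl), ha, mul_ite, mul_zero]
  rw [h1 (.single true) (by simp [Letter.IsJoin, Letter.parent]) 1,
    h1 (.single false) (by simp [Letter.IsJoin, Letter.parent]) y,
    h1 .start (by simp [Letter.IsJoin, Letter.parent]) y]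
  · simp [Letter.step, Letter.pushes, Letter.rest, stackProd, coeff_C_mul]
    by_cases hn : n = 0 <;> simp [coeff_C, hn]
  · intro w
    rw [runWeight_start, one_mul]
    rfl
  · intro w
    rw [runWeight_single, one_mul]
    rfl
  · intro w
    rw [runWeight_single, one_mul]
    rfl

open Polynomial in
/-- The coefficients of a sum of weights count words. -/
theorem coeff_sum_runWeight (S : Finset (List Letter)) (k r : ℕ) :
    ((∑ w ∈ S, runWeight (1 : ℚ[X][X]) (Polynomial.C Polynomial.X) Polynomial.X 0 [] w).coeff
      r).coeff k =
    ((S.filter fun w => runHel 0 [] w = k ∧ w.countP (fun l => l.IsJoin) = r).card : ℚ) := by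
  rw [Polynomial.finsetSum_coeff, Polynomial.finsetSum_coeff, Finset.card_filter, Nat.cast_sum]
  refine Finset.sum_congr rfl fun w _ => ?_
  rw [runWeight, one_pow, one_mul, ← Polynomial.C_pow, Polynomial.coeff_C_mul,
    Polynomial.coeff_X_pow]
  by_cases h : w.countP (fun l => l.IsJoin) = r
  · rw [if_pos h.symm, mul_one, Polynomial.coeff_X_pow]
    by_cases h' : runHel 0 [] w = k
    · simp [h, h']
    · simp [h', Ne.symm h']
  · simp [h, Ne.symm h]

end Coefficients

/-! ### Lagrange inversion -/

section Lagrange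

variable {K : Type*} [CommRing K]

/-- The change of variables formula for the coefficient of `x ^ n`, with the substitution
`x ↦ x / φ`. -/
theorem coeff_subst_mul_derivative_mul_pow [IsAddTorsionFree K] {φ ψ : K⟦X⟧} (h : φ * ψ = 1)
    (n : ℕ) (f : K⟦X⟧) :
    coeff n (f.subst (X * ψ) * derivative K (X * ψ) * φ ^ (n + 1)) = coeff n f := by
  have hs : HasSubst (X * ψ) := HasSubst.of_constantCoeff_zero' (by simp)
  have hd : derivative K (X * ψ) = ψ + X * derivative K ψ := by
    rw [Derivation.leibniz, derivative_X, smul_eq_mul, smul_eq_mul, mul_one, add_comm]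
  have hψ : φ ^ 2 * derivative K ψ = - derivative K φ := by
    have h1 : φ * derivative K ψ + ψ * derivative K φ = 0 := by
      have := congrArg (derivative K) h
      rwa [Derivation.leibniz, smul_eq_mul, smul_eq_mul, derivative_one] at this
    linear_combination φ * h1 - derivative K φ * h
  induction n generalizing f with
  | zero =>
    have h0 : constantCoeff φ * constantCoeff ψ = 1 := by rw [← map_mul, h, map_one]
    have h1 : constantCoeff (f.subst (X * ψ)) = constantCoeff f := by
      generalize ha : constantCoeff f = a
      obtain ⟨g, hg⟩ := X_dvd_iff.2 (show constantCoeff (f - C a) = 0 by simp [ha])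
      rw [eq_add_of_sub_eq hg, subst_add hs, subst_mul hs, subst_X hs, map_add, map_mul, map_mul,
        constantCoeff_X, zero_mul, zero_mul, zero_add]
      exact (congrArg constantCoeff (subst_C _)).trans (constantCoeff_C _)
    rw [coeff_zero_eq_constantCoeff_apply, coeff_zero_eq_constantCoeff_apply, hd]
    simp only [map_mul, map_add, constantCoeff_X, zero_mul, add_zero, zero_add, pow_one, h1]
    rw [mul_assoc, mul_comm (constantCoeff ψ), h0, mul_one]
  | succ n ih =>
    obtain ⟨g, hg⟩ := X_dvd_iff.2 (show constantCoeff (f - C (constantCoeff f)) = 0 by simp)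
    have hg := eq_add_of_sub_eq hg
    -- `(n + 1) R' φ ^ (n + 2) = (n + 1) φ ^ (n + 1) - x (φ ^ (n + 1))'` with `R = x / φ`
    have h1 : coeff (n + 1) (derivative K (X * ψ) * φ ^ (n + 2)) = 0 := by
      have h2 : (n + 1 : K⟦X⟧) * (derivative K (X * ψ) * φ ^ (n + 2)) =
          (n + 1 : K⟦X⟧) * φ ^ (n + 1) - X * derivative K (φ ^ (n + 1)) := by
        rw [hd, derivative_pow, Nat.add_sub_cancel]
        push_cast
        linear_combination (n + 1 : K⟦X⟧) * φ ^ (n + 1) * h + (n + 1) * X * φ ^ n * hψ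
      have h3 := congrArg (coeff (n + 1)) h2
      have hcast : (n + 1 : K⟦X⟧) = C ((n + 1 : ℕ) : K) := by simp
      rw [map_sub, coeff_succ_X_mul, coeff_derivative, hcast, coeff_C_mul, coeff_C_mul,
        mul_comm (coeff (n + 1) (φ ^ (n + 1)))] at h3
      push_cast at h3
      rw [sub_self] at h3
      have h4 : (n + 1) • coeff (n + 1) (derivative K (X * ψ) * φ ^ (n + 2)) = 0 := by
        rw [nsmul_eq_mul]
        push_cast
        exact h3
      exact (smul_eq_zero_iff_right (Nat.succ_ne_zero n)).1 h4
    rw [hg, subst_add hs, subst_mul hs, subst_X hs]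
    have h5 : (X * ψ * g.subst (X * ψ) + (C (constantCoeff f)).subst (X * ψ)) *
        derivative K (X * ψ) * φ ^ (n + 1 + 1) =
        X * (g.subst (X * ψ) * derivative K (X * ψ) * φ ^ (n + 1)) +
          C (constantCoeff f) * (derivative K (X * ψ) * φ ^ (n + 2)) := by
      have : (C (constantCoeff f) : K⟦X⟧).subst (X * ψ) = C (constantCoeff f) := subst_C _
      rw [this]
      linear_combination X * g.subst (X * ψ) * derivative K (X * ψ) * φ ^ (n + 1) * h
    rw [h5, map_add, coeff_succ_X_mul, ih, coeff_C_mul, h1, mul_zero, add_zero, map_add,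
      coeff_succ_X_mul, coeff_C, if_neg (Nat.succ_ne_zero n), add_zero]

/-- Lagrange inversion: the inverse series of `x / φ` has the coefficients
`[x ^ (n + 1)] = [x ^ n] φ ^ (n + 1) / (n + 1)`. -/
theorem coeff_substInvOfIsUnit [IsAddTorsionFree K] {φ ψ : K⟦X⟧} (h : φ * ψ = 1)
    (hu : IsUnit (coeff 1 (X * ψ))) (n : ℕ) :
    coeff (n + 1) ((X * ψ).substInvOfIsUnit hu) * (n + 1) = coeff n (φ ^ (n + 1)) := by
  have h0 : constantCoeff (X * ψ) = 0 := by simp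
  rw [← coeff_derivative, ← coeff_subst_mul_derivative_mul_pow h n (derivative K _),
    ← derivative_subst (HasSubst.of_constantCoeff_zero' h0), subst_substInvOfIsUnit_left _ h0,
    derivative_X, one_mul]

end Lagrange

/-! ### The functional equations of the tree and forest series -/

section FunctionalEquations

variable {K : Type*} [CommRing K] {u y q : K} {F T : K⟦X⟧}

/-- The factor of the generating function of runs due to an entry of the stack. -/
noncomputable def entrySeries (y : K) (T : K⟦X⟧) : Option Bool → K⟦X⟧
  | some true => C y * T
  | _ => T

/-- The generating function of the lists of new vertices below a vertex of the given colour. -/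
noncomputable def chainSeries (y : K) (T : K⟦X⟧) : Option Bool → K⟦X⟧
  | none => (1 + T) * (1 + C y * T) * invOfUnit (1 - C y * T ^ 2) 1
  | some false => (1 + C y * T) * invOfUnit (1 - C y * T ^ 2) 1
  | some true => (1 + T) * invOfUnit (1 - C y * T ^ 2) 1

/-- In the presence of these two equations, `F` is the generating function of the runs starting with
an empty stack, and `T` and `y T` are the factors due to the entries of a stack. -/
theorem runSeries_of_eq (hT0 : constantCoeff T = 0)
    (hF : F = 1 + X * C u * (1 + C y) * F + X * C u * C y * (F * T))
    (hT : T * (1 - C y * T ^ 2) = X * C q * F * ((1 + T) * (1 + C y * T))) :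
    RunSeries u y q F (entrySeries y T) (chainSeries y T) := by
  have hD : (1 - C y * T ^ 2) * invOfUnit (1 - C y * T ^ 2) 1 = 1 :=
    mul_invOfUnit _ 1 (by simp [hT0])
  set D := invOfUnit (1 - C y * T ^ 2) 1 with hDdef
  refine ⟨hF, ?_, ?_⟩
  · rintro (_ | _ | _) <;> simp only [entrySeries, chainSeries, ← hDdef, reduceCtorEq,
      if_true, if_false, Option.some_inj, Bool.false_eq_true, map_one]
    · linear_combination D * hT - T * hD
    · linear_combination D * hT - T * hD
    · linear_combination C y * D * hT - C y * T * hD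
  · rintro (_ | _ | _) <;> rw [Finset.sum_filter, Fintype.sum_bool] <;>
      simp only [entrySeries, chainSeries, ← hDdef, ne_eq, reduceCtorEq, if_true, if_false,
        not_true, not_false_eq_true, Option.some_inj, Bool.false_eq_true, Bool.true_eq_false]
    · linear_combination hD
    · linear_combination hD
    · linear_combination hD

end FunctionalEquations

section Constants

variable {K : Type*} [CommRing K]

theorem subst_const {g : K⟦X⟧} (a : K) : (C a : K⟦X⟧).subst g = C a := subst_C _

theorem subst_one_eq_one {g : K⟦X⟧} : (1 : K⟦X⟧).subst g = 1 := by
  rw [← map_one C, subst_const]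

end Constants

/-- `q C^{⟨-1⟩}`, which is the generating function of the runs that complete the tree of a boundary
vertex without starting other trees. -/
noncomputable def branchSeries : GF := vq * seriesC.substInvOfIsUnit isUnit_coeff_one_seriesC

theorem constantCoeff_branchSeries : constantCoeff branchSeries = 0 := by
  simp [branchSeries]

theorem branchSeries_eq : branchSeries * (1 - vy * branchSeries ^ 2) =
    X * vq * ((1 + branchSeries) * (1 + vy * branchSeries)) := by
  have h0 : constantCoeff seriesC = 0 := by simp [seriesC]
  have h1 := subst_substInvOfIsUnit_right seriesC h0 isUnit_coeff_one_seriesC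
  have hs := HasSubst.substInvOfIsUnit seriesC isUnit_coeff_one_seriesC
  rw [branchSeries]
  set H := seriesC.substInvOfIsUnit isUnit_coeff_one_seriesC
  have h2 : seriesC * ((1 + X * vq) * (1 + X * vy * vq)) = X * (1 - vq ^ 2 * X ^ 2 * vy) := by
    have := mul_recip (P := (1 + X * vq) * (1 + X * vy * vq)) (by simp)
    rw [seriesC]
    linear_combination X * (1 - vq ^ 2 * X ^ 2 * vy) * this
  have h3 := congrArg (subst H) h2
  have hq : subst H vq = vq := subst_const _
  have hy : subst H vy = vy := subst_const _
  simp only [subst_mul hs, subst_add hs, subst_sub hs, subst_pow hs, subst_one_eq_one, subst_X hs,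
    hq, hy, h1] at h3
  linear_combination -vq * h3

theorem treeSeries_eq : treeSeries = X * (1 + vy + vy * branchSeries) := by
  rw [treeSeries, branchSeries, mul_assoc vy vq]

theorem seriesR_mul : seriesR * (1 + treeSeries) = X := by
  have := mul_recip (P := 1 + treeSeries) (by simp [treeSeries])
  rw [seriesR]
  linear_combination X * this

/-- For `u = 0`, that is, without starting further trees, the empty word is the only run from an empty
stack. -/
theorem runSeries_tree : RunSeries 0 (Polynomial.C Polynomial.X) Polynomial.X (1 : GF)
    (entrySeries (Polynomial.C Polynomial.X) branchSeries)
    (chainSeries (Polynomial.C Polynomial.X) branchSeries) := by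
  refine runSeries_of_eq constantCoeff_branchSeries (by simp) ?_
  rw [mul_one]
  exact branchSeries_eq

/-- The series `F` with `x F = (x / (1 + P_tree))^{⟨-1⟩}` is the generating function of runs. -/
theorem exists_runSeries_forest : ∃ F : GF,
    X * F = seriesR.substInvOfIsUnit isUnit_coeff_one_seriesR ∧
    ∃ R A, RunSeries 1 (Polynomial.C Polynomial.X) Polynomial.X F R A := by
  have h0 : constantCoeff seriesR = 0 := by simp [seriesR]
  have h1 := subst_substInvOfIsUnit_right seriesR h0 isUnit_coeff_one_seriesR
  have hs := HasSubst.substInvOfIsUnit seriesR isUnit_coeff_one_seriesR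
  have hG := constantCoeff_substInvOfIsUnit seriesR isUnit_coeff_one_seriesR
  set G := seriesR.substInvOfIsUnit isUnit_coeff_one_seriesR
  obtain ⟨F, hF⟩ := X_dvd_iff.2 hG
  have hq : subst G vq = vq := subst_const _
  have hy : subst G vy = vy := subst_const _
  have h2 := congrArg (subst G) seriesR_mul
  have h3 := congrArg (subst G) treeSeries_eq
  have h4 := congrArg (subst G) branchSeries_eq
  simp only [subst_mul hs, subst_add hs, subst_sub hs, subst_pow hs, subst_one_eq_one, subst_X hs,
    hq, hy, h1] at h2 h3 h4
  set T := subst G branchSeries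
  have hT0 : constantCoeff T = 0 :=
    constantCoeff_subst_eq_zero hG _ constantCoeff_branchSeries
  rw [h3, hF] at h2
  have h5 := mul_left_cancel₀ X_ne_zero h2
  have hy' : (C (Polynomial.C Polynomial.X) : GF) = vy := rfl
  have hq' : (C Polynomial.X : GF) = vq := rfl
  refine ⟨F, hF.symm, _, _, runSeries_of_eq hT0 ?_ ?_⟩
  · rw [hy', map_one]
    linear_combination -h5
  · rw [hy', hq']
    rw [hF] at h4
    linear_combination h4

theorem mainTheorem2 :
    (∀ n k r : ℕ,
      (GrassmannianForest.contractedPlabicTrees n k r).Finite ∧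
      ((GrassmannianForest.contractedPlabicTrees n k r).ncard : ℚ) = coeffXYQ n k r treeSeries) ∧
    (∃ forestSeries : GF,
      PowerSeries.X * forestSeries = seriesR.substInvOfIsUnit isUnit_coeff_one_seriesR ∧
      (∀ n k r : ℕ,
        (GrassmannianForest.contractedPlabicForests n k r).Finite ∧
        ((GrassmannianForest.contractedPlabicForests n k r).ncard : ℚ) =
          coeffXYQ n k r forestSeries)) ∧
    (∀ P : GF,
      PowerSeries.X * P = seriesR.substInvOfIsUnit isUnit_coeff_one_seriesR ↔
      ∀ n : ℕ, PowerSeries.coeff n P =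
        (1 / ((n : ℚ) + 1)) • PowerSeries.coeff n ((1 + treeSeries) ^ (n + 1))) := by
  refine ⟨fun n k r => ?_, ?_, fun P => ?_⟩
  · obtain ⟨h1, h2⟩ := GrassmannianForest.card_contractedPlabicTrees n k r
    refine ⟨h1, ?_⟩
    rw [h2]
    cases n with
    | zero => simp [coeffXYQ, treeSeries]
    | succ n =>
      simp only [Nat.add_right_cancel_iff]
      rw [← Finset.filter_filter, ← coeff_sum_runWeight, runSeries_tree.sum_trees,
        coeffXYQ, treeSeries_eq, coeff_succ_X_mul]
      rfl
  · obtain ⟨F, hF, R, A, h⟩ := exists_runSeries_forest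
    refine ⟨F, hF, fun n k r => ?_⟩
    obtain ⟨h1, h2⟩ := GrassmannianForest.card_contractedPlabicForests n k r
    refine ⟨h1, ?_⟩
    rw [h2, ← coeff_sum_runWeight, h.sum_runWeight]
    simp [coeffXYQ, stackProd]
  · have hL := fun n => coeff_substInvOfIsUnit
      (mul_recip (P := 1 + treeSeries) (by simp [treeSeries])) isUnit_coeff_one_seriesR n
    change ∀ n, coeff (n + 1) (seriesR.substInvOfIsUnit isUnit_coeff_one_seriesR) * _ = _ at hL
    -- the formula determines `P`, so it suffices that the inverse series satisfies it
    have key : ∀ (n : ℕ) (a : Polynomial (Polynomial ℚ)),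
      a = (1 / ((n : ℚ) + 1)) • coeff n ((1 + treeSeries) ^ (n + 1)) ↔
        a = coeff (n + 1) (seriesR.substInvOfIsUnit isUnit_coeff_one_seriesR) := by
      intro n a
      have hn : ((n : ℚ) + 1) ≠ 0 := by positivity
      have hsm : ∀ b : Polynomial (Polynomial ℚ), b * (n + 1) = ((n : ℚ) + 1) • b := by
        intro b
        rw [add_smul, one_smul, mul_add, mul_one, Nat.cast_smul_eq_nsmul, nsmul_eq_mul, mul_comm]
      rw [← hL n, hsm, smul_smul, one_div_mul_cancel hn, one_smul]
    simp only [key]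
    constructor
    · intro h n
      rw [← h, coeff_succ_X_mul]
    · intro h
      ext1 n
      cases n with
      | zero => simp
      | succ n => rw [coeff_succ_X_mul, h]
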